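/- **Theorem (softmax gradient estimator).** There is a universal constant $C>0$ such that for each $p\in\{1,2\}$, with $\frac1p+\frac1{p^*}=1$, there is a data structure $\mathcal M$ as in (A) for which (B) holds. *Model.* Runtime is counted on a randomized real RAM with unit-cost operations, in which a vector of length $m$ can be preprocessed in time $O(m)$ so that afterwards an index can be drawn with probability proportional to the absolute values of its entries in time $O(1)$. **(A)** $\mathcal M$ is a randomized $\ell_p$-matrix-vector maintenance data structure, given by two fixed programs. $\mathcal M.\mathrm{init}(A,z_0,R,\epsilon,\delta)$ takes $A\in\mathbb R^{n\times d}$ with $n,d\ge 1$ whose rows have $\ell_{p^*}$ norm at most $1$, $z_0\in\mathbb R^d$, $0<\epsilon\le R/2$ and $\delta\in(0,1)$. Each call $\mathcal M.\mathrm{query}(\Delta_t)$, $t=1,2,\dots$, sets $z_t=z_{t-1}+\Delta_t$ and outputs a vector $w_t\in\mathbb R^n$ (or reports that its output is unchanged). For every sequence $\Delta_1,\dots,\Delta_T$ fixed in advance with $\sum_{t\le T}\|\Delta_t\|_p\le R$, with probability at least $1-\delta$ we have $\|w_t-Az_t\|_\infty\le\epsilon$ for all $t\le T$. **(B)** *Setting.*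 Let $n,d\ge1$, $T\ge 0$, let $\mathcal X\subseteq\mathbb R^d$ be convex, and let $f_1,\dots,f_n$ be differentiable on $\mathcal X$, $L_f$-Lipschitz ($|f_i(x)-f_i(y)|\le L_f\|x-y\|_p$ on $\mathcal X$) and $L_g$-smooth ($\|\nabla f_i(x)-\nabla f_i(y)\|_{p^*}\le L_g\|x-y\|_p$ on $\mathcal X$). If $\mathcal X$ has empty interior, so that the gradient is not determined by the values on $\mathcal X$, the gradients are chosen with $\|\nabla f_i\|_{p^*}\le L_f$ on $\mathcal X$. For $\epsilon'>0$ let $$f_{\rm smax}(x)=\epsilon'\log\sum_{i\in[n]}e^{f_i(x)/\epsilon'},\qquad \nabla f_{\rm smax}(x)=\sum_{i\in[n]}\frac{e^{f_i(x)/\epsilon'}}{\sum_k e^{f_k(x)/\epsilon'}}\nabla f_i(x);$$ the latter is the gradient of the former on $\mathcal X$. Let $r,r'>0$ with $\frac12L_gr^2\le\epsilon'$ and $\epsilon'\le L_fr'/2$, let $\delta\in(0,1)$ and $x_0\in\mathcal X$. *Algorithm.* Call $\mathcal M.\mathrm{init}\big(A,0,r',\frac{\epsilon'}{L_f},\frac\delta2\big)$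 with $A=[\frac1{L_f}\nabla f_i(x_0)^\top]_{i\in[n]}$. For $t=1,\dots,T$: receive $x_t$; set $y_t=L_f\cdot\mathcal M.\mathrm{query}(x_t-x_{t-1})$; then repeat: draw $i\in[n]$ with probability proportional to $\exp\big(\frac{f_i(x_0)+[y_t]_i}{\epsilon'}\big)$ and accept it with probability $\min\big\{\exp\big(\frac{f_i(x_t)-f_i(x_0)-[y_t]_i}{\epsilon'}-2\big),1\big\}$, until an index $i_t$ is accepted; output $\mathcal G(x_t)=\nabla f_{i_t}(x_t)$. *Assumption on the queries.* Each $x_t$ is a deterministic function of the previous outputs $\mathcal G(x_1),\dots,\mathcal G(x_{t-1})$, and for all possible outputs $x_t\in\mathcal X$ and $\|x_t-x_0\|_p\le r$ for all $t\le T$, and $\sum_{t\le T}\|x_t-x_{t-1}\|_p\le r'$. *Conclusion.* Let $\mathcal F_t$ be the $\sigma$-algebra generated by all random numbers drawn by the algorithm up to iteration $t$ together with all those that $\mathcal M$ may ever use. Then there is an event $\mathcal E$ such that: 1. $\Pr(\mathcal E)\ge1-\delta$. 2. Almost surely on $\mathcal E$, $\mathbb E[\mathcal G(x_t)\mid\mathcal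 F_{t-1}]=\nabla f_{\rm smax}(x_t)$ for all $t\in\{1,\dots,T\}$. 3. On $\mathcal E$ the algorithm makes at most $C\big(n+T(1+\log\frac1\delta)\big)$ queries of the form $\{f_i(x),\nabla f_i(x)\}$, and its additional runtime (including that of $\mathcal M$) is at most $$C\Big[T\Big(d+\log\tfrac1\delta\Big)+\Big(nd\log^{p-1}\tfrac{L_fr'}{\epsilon'}+d\,\tfrac{L_fr'}{\epsilon'}\Big)\log^{p-1}\tfrac{nL_fr'}{\epsilon'\delta}+n\Big(\tfrac{L_fr'}{\epsilon'}\Big)^2\log\tfrac{nL_fr'}{\epsilon'\delta}\Big].$$ 4. With probability $1$, $\|\mathcal G(x_t)\|_{p^*}\le L_f$ for all $t\in\{1,\dots,T\}$. -/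

import Mathlib

open MeasureTheory ProbabilityTheory
open scoped ENNReal

noncomputable section

namespace SoftmaxEst

/-! ### Vectors and norms -/

/-- Vectors of `ℝ^d`. -/
abbrev Vec (d : ℕ) := Fin d → ℝ

/-- The `ℓ_p` norm. -/
def pNorm {d : ℕ} (p : ℝ≥0∞) (v : Vec d) : ℝ := ‖WithLp.toLp p v‖

/-- The dual `ℓ_{p*}` norm, `1/p + 1/p* = 1`. -/
def dualNorm {d : ℕ} (p : ℝ≥0∞) (v : Vec d) : ℝ := pNorm p.conjExponent v

/-- The linear functional `v ↦ ⟨g, v⟩`. -/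
def dot {d : ℕ} (g : Vec d) : Vec d →L[ℝ] ℝ :=
  ∑ j, g j • (ContinuousLinearMap.proj j : Vec d →L[ℝ] ℝ)

/-- The cells of an array that holds the vector `v` (zero outside). -/
def ofVec {m : ℕ} (v : Fin m → ℝ) : ℕ → ℝ := fun k => if h : k < m then v ⟨k, h⟩ else 0

/-! ### A randomized real RAM with unit costs

Programs are finite pieces of syntax in a small structured language. The store has arrays of
naturals and arrays of reals (a register is the cell `0` of an array). Every operator of an
expression, every assignment, test, loop iteration and random draw costs one unit of time;
preprocessing a vector with `m` entries costs `m + 1`, after which an index proportional to the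
absolute values of the entries can be drawn in one unit. -/

/-- Expressions for natural numbers. -/
inductive NExp where
  | const (k : ℕ)
  | get (a : ℕ) (i : NExp)
  | add (e₁ e₂ : NExp)
  | sub (e₁ e₂ : NExp)
  | mul (e₁ e₂ : NExp)

/-- Expressions for real numbers. -/
inductive RExp where
  | const (q : ℚ)
  | ofNat (e : NExp)
  | get (a : ℕ) (i : NExp)
  | add (e₁ e₂ : RExp)
  | sub (e₁ e₂ : RExp)
  | mul (e₁ e₂ : RExp)
  | div (e₁ e₂ : RExp)
  | exp (e : RExp)
  | log (e : RExp)
  | sqrt (e : RExp)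

/-- Programs. -/
inductive Cmd where
  | skip
  /-- `N[a][i] := e` -/
  | setN (a : ℕ) (i e : NExp)
  /-- `R[a][i] := e` -/
  | setR (a : ℕ) (i : NExp) (e : RExp)
  | seq (c₁ c₂ : Cmd)
  /-- `if e₁ ≤ e₂ then c₁ else c₂` -/
  | ite (e₁ e₂ : RExp) (c₁ c₂ : Cmd)
  /-- `for (N[a][0] := 0; N[a][0] < e; N[a][0]++) c`, with `e` evaluated once, at the start -/
  | loop (a : ℕ) (e : RExp) (c : Cmd)
  /-- `R[a][i] :=` a fresh uniform number in `[0,1]` -/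
  | rand (a : ℕ) (i : NExp)
  /-- preprocess the vector `R[a][0], …, R[a][m-1]` for sampling, under the name `s` -/
  | prep (s a : ℕ) (m : NExp)
  /-- `N[b][i] :=` a fresh random index, proportional to the entries preprocessed as `s` -/
  | draw (s b : ℕ) (i : NExp)

/-- The store: arrays of naturals, arrays of reals, preprocessed vectors (length and entries),
number of uniforms consumed so far, time used so far. -/
structure Store where
  N : ℕ → ℕ → ℕ
  R : ℕ → ℕ → ℝ
  S : ℕ → ℕ × (ℕ → ℝ)
  pos : ℕ
  time : ℕ

/-- Inverse-CDF sampling: for `u` uniform on `[0,1]`, `pick m w u` is an index `i < m` drawn with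
probability `|w i| / ∑ j < m, |w j|`. -/
def pick (m : ℕ) (w : ℕ → ℝ) (u : ℝ) : ℕ :=
  sInf {i | i < m ∧
    u * ∑ j ∈ Finset.range m, |w j| < ∑ j ∈ Finset.range (i + 1), |w j|}

def Store.setN (σ : Store) (a i k : ℕ) : Store :=
  { σ with N := Function.update σ.N a (Function.update (σ.N a) i k) }

def Store.setR (σ : Store) (a i : ℕ) (x : ℝ) : Store :=
  { σ with R := Function.update σ.R a (Function.update (σ.R a) i x) }

def Store.tick (σ : Store) (k : ℕ) : Store := { σ with time := σ.time + k }

def NExp.eval (σ : Store) : NExp → ℕ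
  | .const k => k
  | .get a i => σ.N a (i.eval σ)
  | .add e₁ e₂ => e₁.eval σ + e₂.eval σ
  | .sub e₁ e₂ => e₁.eval σ - e₂.eval σ
  | .mul e₁ e₂ => e₁.eval σ * e₂.eval σ

def NExp.cost : NExp → ℕ
  | .const _ => 1
  | .get _ i => i.cost + 1
  | .add e₁ e₂ => e₁.cost + e₂.cost + 1
  | .sub e₁ e₂ => e₁.cost + e₂.cost + 1
  | .mul e₁ e₂ => e₁.cost + e₂.cost + 1

def RExp.eval (σ : Store) : RExp → ℝ
  | .const q => q
  | .ofNat e => e.eval σ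
  | .get a i => σ.R a (i.eval σ)
  | .add e₁ e₂ => e₁.eval σ + e₂.eval σ
  | .sub e₁ e₂ => e₁.eval σ - e₂.eval σ
  | .mul e₁ e₂ => e₁.eval σ * e₂.eval σ
  | .div e₁ e₂ => e₁.eval σ / e₂.eval σ
  | .exp e => Real.exp (e.eval σ)
  | .log e => Real.log (e.eval σ)
  | .sqrt e => Real.sqrt (e.eval σ)

def RExp.cost : RExp → ℕ
  | .const _ => 1
  | .ofNat e => e.cost + 1
  | .get _ i => i.cost + 1
  | .add e₁ e₂ => e₁.cost + e₂.cost + 1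
  | .sub e₁ e₂ => e₁.cost + e₂.cost + 1
  | .mul e₁ e₂ => e₁.cost + e₂.cost + 1
  | .div e₁ e₂ => e₁.cost + e₂.cost + 1
  | .exp e => e.cost + 1
  | .log e => e.cost + 1
  | .sqrt e => e.cost + 1

open Classical in
/-- Execution of a program on the random tape `ω`. -/
def Cmd.exec (ω : ℕ → ℝ) : Cmd → Store → Store
  | .skip, σ => σ.tick 1
  | .setN a i e, σ => (σ.setN a (i.eval σ) (e.eval σ)).tick (i.cost + e.cost + 1)
  | .setR a i e, σ => (σ.setR a (i.eval σ) (e.eval σ)).tick (i.cost + e.cost + 1)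
  | .seq c₁ c₂, σ => c₂.exec ω (c₁.exec ω σ)
  | .ite e₁ e₂ c₁ c₂, σ =>
      if e₁.eval σ ≤ e₂.eval σ then c₁.exec ω (σ.tick (e₁.cost + e₂.cost + 1))
      else c₂.exec ω (σ.tick (e₁.cost + e₂.cost + 1))
  | .loop a e c, σ =>
      Nat.rec (σ.tick (e.cost + 1)) (fun j τ => c.exec ω ((τ.setN a 0 j).tick 1)) ⌈e.eval σ⌉₊
  | .rand a i, σ =>
      { (σ.setR a (i.eval σ) (ω σ.pos)).tick (i.cost + 1) with pos := σ.pos + 1 }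
  | .prep s a m, σ =>
      { σ.tick (m.cost + m.eval σ + 1) with S := Function.update σ.S s (m.eval σ, σ.R a) }
  | .draw s b i, σ =>
      { (σ.setN b (i.eval σ) (pick (σ.S s).1 (σ.S s).2 (ω σ.pos))).tick (i.cost + 1) with
        pos := σ.pos + 1 }

/-! ### Randomness -/

/-- The uniform distribution on `[0,1]`. -/
def uniform01 : Measure ℝ := volume.restrict (Set.Icc 0 1)

instance : IsProbabilityMeasure uniform01 := ⟨by simp [uniform01]⟩

/-- The law of an infinite tape of independent uniform numbers. -/
def tapeMeasure : Measure (ℕ → ℝ) := Measure.infinitePi fun _ => uniform01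

/-! ### Matrix-vector maintenance -/

/-- A data structure: the programs of its two operations. -/
structure DataStructure where
  init : Cmd
  query : Cmd

/-- The store on which `init(A, x₀, R, ε, δ)` is executed: the numbers of rows and columns, the
entries of `A` in row-major order, `x₀`, and the three scalars; everything else is zero. -/
def initStore {n d : ℕ} (A : Fin n → Vec d) (x₀ : Vec d) (R ε δ : ℝ) : Store where
  N := fun a => if a = 0 then fun j => if j = 0 then n else if j = 1 then d else 0 else 0
  R := fun a =>
    if a = 0 then ofVec fun k : Fin (n * d) => A k.divNat k.modNat
    else if a = 1 then ofVec x₀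
    else if a = 2 then ofVec ![R, ε, δ]
    else 0
  S := fun _ => (0, 0)
  pos := 0
  time := 0

/-- Pass the argument `Δ` of a query in the array `R[3]`, and reset the flag `N[1][0]`. -/
def loadQuery {d : ℕ} (σ : Store) (Δ : Vec d) : Store :=
  { σ.setN 1 0 0 with
    R := Function.update σ.R 3 fun j => if h : j < d then Δ ⟨j, h⟩ else σ.R 3 j }

/-- The store after `init`. -/
def DataStructure.runInit (M : DataStructure) (ω : ℕ → ℝ) {n d : ℕ} (A : Fin n → Vec d)
    (x₀ : Vec d) (R ε δ : ℝ) : Store :=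
  M.init.exec ω (initStore A x₀ R ε δ)

/-- The store after a query. -/
def DataStructure.runQuery (M : DataStructure) (ω : ℕ → ℝ) {d : ℕ} (σ : Store) (Δ : Vec d) :
    Store :=
  M.query.exec ω (loadQuery σ Δ)

/-- The estimate of the matrix-vector product is kept in the array `R[4]`. -/
def readEst (n : ℕ) (σ : Store) : Fin n → ℝ := fun i => σ.R 4 i

/-- A query that leaves the flag `N[1][0]` at zero reports that its output is the previous one;
otherwise the output is read from `R[4]`. -/
def newEst {n : ℕ} (σ : Store) (y : Fin n → ℝ) : Fin n → ℝ :=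
  if σ.N 1 0 = 0 then y else readEst n σ

/-- The store and the current output after `init` and the queries `Δ 0, …, Δ (t-1)`. -/
def DataStructure.runQueries (M : DataStructure) (ω : ℕ → ℝ) {n d : ℕ} (A : Fin n → Vec d)
    (x₀ : Vec d) (R ε δ : ℝ) (Δ : ℕ → Vec d) : ℕ → Store × (Fin n → ℝ)
  | 0 =>
      let σ := M.runInit ω A x₀ R ε δ
      (σ, readEst n σ)
  | t + 1 =>
      let s := M.runQueries ω A x₀ R ε δ Δ t
      let σ := M.runQuery ω s.1 (Δ t)
      (σ, newEst σ s.2)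

/-- `M` is an `ℓ_p`-matrix-vector maintenance data structure: against every oblivious (fixed in
advance) sequence of queries of total movement at most `R`, with probability at least `1 - δ` all
outputs are `ε`-accurate in the maximum norm. -/
def DataStructure.IsMVM (M : DataStructure) (p : ℝ≥0∞) : Prop :=
  ∀ (n d : ℕ) (A : Fin n → Vec d) (x₀ : Vec d) (R ε δ : ℝ) (T : ℕ) (Δ : ℕ → Vec d),
    0 < n → 0 < d → (∀ i, dualNorm p (A i) ≤ 1) → 0 < ε → ε ≤ R / 2 → 0 < δ → δ < 1 →
    ∑ t ∈ Finset.range T, pNorm p (Δ t) ≤ R →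
    ENNReal.ofReal (1 - δ) ≤ tapeMeasure {ω | ∀ t < T, ∀ i,
      |(M.runQueries ω A x₀ R ε δ Δ (t + 1)).2 i
        - ∑ j, A i j * (x₀ + ∑ s ∈ Finset.range (t + 1), Δ s) j| ≤ ε}

/-! ### The softmax and its gradient -/

/-- The softmax `ε' log ∑ i, exp (f i x / ε')`. -/
def smax {n d : ℕ} (f : Fin n → Vec d → ℝ) (ε' : ℝ) (x : Vec d) : ℝ :=
  ε' * Real.log (∑ i, Real.exp (f i x / ε'))

/-- The gradient of the softmax, where `g i` is the gradient of `f i`. -/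
def smaxGrad {n d : ℕ} (f : Fin n → Vec d → ℝ) (g : Fin n → Vec d → Vec d) (ε' : ℝ)
    (x : Vec d) : Vec d :=
  ∑ i, (Real.exp (f i x / ε') / ∑ k, Real.exp (f k x / ε')) • g i x

/-- `f` is differentiable on `X` with gradient `g`, is `Lf`-Lipschitz and is `Lg`-smooth with
respect to the `ℓ_p` norm. If `X` has empty interior (a simplex, say), the values of `f` on `X` do
not determine the gradient as a vector of `ℝ^d`; the gradient chosen then has to satisfy the bound
that Lipschitz continuity gives on sets with interior. -/
structure LipschitzSmooth {d : ℕ} (p : ℝ≥0∞) (X : Set (Vec d)) (Lf Lg : ℝ) (f : Vec d → ℝ)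
    (g : Vec d → Vec d) : Prop where
  hasGrad : ∀ x ∈ X, HasFDerivWithinAt f (dot (g x)) X x
  lipschitz : ∀ x ∈ X, ∀ y ∈ X, |f x - f y| ≤ Lf * pNorm p (x - y)
  smooth : ∀ x ∈ X, ∀ y ∈ X, dualNorm p (g x - g y) ≤ Lg * pNorm p (x - y)
  grad_le : interior X = ∅ → ∀ x ∈ X, dualNorm p (g x) ≤ Lf

/-! ### The softmax gradient estimator -/

/-- The input and the parameters of the estimator: the functions and their gradients, the
parameters `Lf`, `ε'`, `r'`, `δ`, the initial point, and the rule that gives the next query point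
as a function of the list of all previous outputs. -/
structure Input (n d : ℕ) where
  f : Fin n → Vec d → ℝ
  g : Fin n → Vec d → Vec d
  Lf : ℝ
  ε' : ℝ
  r' : ℝ
  δ : ℝ
  x₀ : Vec d
  next : List (Vec d) → Vec d

variable {n d : ℕ}

/-- The outputs of the first `t` iterations if iteration `s` yields the index `idx s`
(iterations are numbered from `0`). -/
def Input.outsAlong (P : Input n d) (idx : ℕ → Fin n) : ℕ → List (Vec d)
  | 0 => []
  | t + 1 => P.outsAlong idx t ++ [P.g (idx t) (P.next (P.outsAlong idx t))]

/-- The query points `x_0, x_1, …` if iteration `s` yields the index `idx s`. -/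
def Input.pointAlong (P : Input n d) (idx : ℕ → Fin n) : ℕ → Vec d
  | 0 => P.x₀
  | t + 1 => P.next (P.outsAlong idx t)

/-- The sources of randomness: the tape of the data structure, and for iteration `t` and rejection
sampling attempt `k` one uniform number `(t, k, false)` to draw an index and one uniform number
`(t, k, true)` to decide on its acceptance. -/
abbrev Source := ℕ ⊕ (ℕ × ℕ × Bool)

/-- The sample space. -/
abbrev Sample := Source → ℝ

/-- All sources are independent and uniform on `[0,1]`. -/
def sampleMeasure : Measure Sample := Measure.infinitePi fun _ => uniform01

instance : IsProbabilityMeasure sampleMeasure := by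
  unfold sampleMeasure; infer_instance

/-- The sources used by the data structure (at any time) or in the first `t` iterations. -/
def usedBefore (t : ℕ) : Set Source := {s | ∀ a, s = Sum.inr a → a.1 < t}

/-- The filtration generated by the random numbers drawn in the first `t` iterations and all those
of the data structure. -/
def sourceFiltration : Filtration ℕ (inferInstance : MeasurableSpace Sample) where
  seq t := ⨆ s ∈ usedBefore t, MeasurableSpace.comap (fun ω : Sample => ω s) inferInstance
  mono' _ _ h := biSup_mono fun _ hs a ha => (hs a ha).trans_le h
  le' _ := iSup₂_le fun s _ => (measurable_pi_apply s).comap_le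

/-- The state of the estimator between two iterations: memory of the data structure, current
estimate `y` (already multiplied by `Lf`), current point, list of outputs, number of queries
`{f_i(x), ∇f_i(x)}` so far, and runtime so far apart from these queries and from the time of the
data structure, which is recorded in `mem`. -/
structure State (n d : ℕ) where
  mem : Store
  est : Fin n → ℝ
  x : Vec d
  outs : List (Vec d)
  queries : ℕ∞
  work : ℕ∞

/-- Draw an index proportionally to `exp ((f_i(x_0) + y_i) / ε')`. -/
def Input.propose [NeZero n] (P : Input n d) (y : Fin n → ℝ) (u : ℝ) : Fin n :=
  Fin.ofNat n (pick n (ofVec fun i => Real.exp ((P.f i P.x₀ + y i) / P.ε')) u)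

/-- The probability to accept the index `i`. -/
def Input.acceptProb (P : Input n d) (y : Fin n → ℝ) (x : Vec d) (i : Fin n) : ℝ :=
  min (Real.exp ((P.f i x - P.f i P.x₀ - y i) / P.ε' - 2)) 1

/-- The attempts that would be accepted. -/
def Input.accepted [NeZero n] (P : Input n d) (y : Fin n → ℝ) (x : Vec d)
    (u : ℕ → Bool → ℝ) : Set ℕ :=
  {k | u k true < P.acceptProb y x (P.propose y (u k false))}

/-- The index proposed in the first accepted attempt. -/
def Input.chosen [NeZero n] (P : Input n d) (y : Fin n → ℝ) (x : Vec d)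
    (u : ℕ → Bool → ℝ) : Fin n :=
  P.propose y (u (sInf (P.accepted y x u)) false)

/-- The number of attempts made, `⊤` if none is ever accepted. -/
def Input.attempts [NeZero n] (P : Input n d) (y : Fin n → ℝ) (x : Vec d)
    (u : ℕ → Bool → ℝ) : ℕ∞ :=
  ⨅ k ∈ P.accepted y x u, ((k + 1 : ℕ) : ℕ∞)

/-- Initialization: query all functions at `x_0`, form `A = [∇f_i(x_0)ᵀ / Lf]`, call
`init(A, 0, r', ε'/Lf, δ/2)` and preprocess the weights of the indices for sampling. -/
def Input.start (P : Input n d) (M : DataStructure) (ω : ℕ → ℝ) : State n d :=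
  let σ := M.runInit ω (fun i => P.Lf⁻¹ • P.g i P.x₀) 0 P.r' (P.ε' / P.Lf) (P.δ / 2)
  { mem := σ
    est := P.Lf • readEst n σ
    x := P.x₀
    outs := []
    queries := n
    work := (2 * (n * d) + 10 * (n + d) + 10 : ℕ) }

/-- One iteration, with tape `ω` for the data structure and uniform numbers `u` for rejection
sampling. The work charged is a constant per coordinate of the points and of the output
vector, a constant per attempt, and, only if the data structure reports a new estimate, a constant
for each of the `n` weights, which then have to be preprocessed again. -/
def Input.step [NeZero n] (P : Input n d) (M : DataStructure) (ω : ℕ → ℝ) (u : ℕ → Bool → ℝ)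
    (s : State n d) : State n d :=
  let x := P.next s.outs
  let σ := M.runQuery ω s.mem (x - s.x)
  let y := if σ.N 1 0 = 0 then s.est else P.Lf • readEst n σ
  { mem := σ
    est := y
    x := x
    outs := s.outs ++ [P.g (P.chosen y x u) x]
    queries := s.queries + P.attempts y x u
    work := s.work + (10 * d + 10 : ℕ) + (if σ.N 1 0 = 0 then 0 else 10 * n : ℕ)
      + 10 * P.attempts y x u }

/-- The state after `t` iterations. -/
def Input.run [NeZero n] (P : Input n d) (M : DataStructure) (ω : Sample) : ℕ → State n d
  | 0 => P.start M fun k => ω (Sum.inl k)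
  | t + 1 => P.step M (fun k => ω (Sum.inl k)) (fun k b => ω (Sum.inr (t, k, b))) (P.run M ω t)

/-- The `t`-th query point (`x_0` for `t = 0`). -/
def Input.point [NeZero n] (P : Input n d) (M : DataStructure) (t : ℕ) (ω : Sample) : Vec d :=
  (P.run M ω t).x

/-- The output `𝒢(x_t)` of the `t`-th iteration, `t ≥ 1`. -/
def Input.output [NeZero n] (P : Input n d) (M : DataStructure) (t : ℕ) (ω : Sample) : Vec d :=
  (P.run M ω t).outs.getLastD 0

/-- The number of queries of the form `{f_i(x), ∇f_i(x)}` in the first `T` iterations. -/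
def Input.numQueries [NeZero n] (P : Input n d) (M : DataStructure) (T : ℕ) (ω : Sample) : ℕ∞ :=
  (P.run M ω T).queries

/-- The additional runtime of the first `T` iterations. -/
def Input.runtime [NeZero n] (P : Input n d) (M : DataStructure) (T : ℕ) (ω : Sample) : ℕ∞ :=
  (P.run M ω T).work + (P.run M ω T).mem.time

/-- The bound on the additional runtime, up to a constant factor. -/
def runtimeBound (p n d T : ℕ) (Lf ε' r' δ : ℝ) : ℝ :=
  T * (d + Real.log (1 / δ))
    + (n * d * Real.log (Lf * r' / ε') ^ (p - 1) + d * (Lf * r' / ε'))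
        * Real.log (n * Lf * r' / (ε' * δ)) ^ (p - 1)
    + n * (Lf * r' / ε') ^ 2 * Real.log (n * Lf * r' / (ε' * δ))

end SoftmaxEst

end

open SoftmaxEst

noncomputable section

namespace SoftmaxEst

/-! ### The `ℓ_1` and `ℓ_2` norms and their duals -/

/-! Maintenance of `A z`. Only the movement `D` since the last refresh is tracked. While `‖D‖_p ≤ ε
/ 2`, Hölder's inequality shows that the old estimate is still good. Otherwise `A D` is estimated
from about `16 ‖D‖ R L / ε²` columns drawn with probability proportional to `|D_j|^p`, where `L =
log (4 n R / (ε δ))`. Each term `y` enters through the influence function `log (1 + y + y²) / λ`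
with `λ = 4 L / ε`. Because `exp (± log (1 + y + y²)) ≤ 1 ± y + y²` for every real `y`
(`exp_mul_infl_le`), second moments alone give exponential concentration, also for `p = 2`, where
the terms are unbounded. The sample size is proportional to `‖D‖`, so variance is charged to
movement and adds up to at most `ε² / (16 L)` along a path of length `R`
(`lintegral_exp_samplingErr_le`). A Chernoff bound and a union bound over at most `2 R / ε`
refreshes, `n` rows and two signs give `sketch_isMVM`.

Rejection sampling. Linearizing `f_i` at `x₀` costs `ε'` and the maintained product costs another
`ε'`, so proposal and target weights differ by a factor between `e⁻²` and `e²`. The minimum in the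
acceptance probability is then inactive, the estimate cancels, and the accepted index has exactly
the softmax law (`Input.attemptMeasure_chosen`). Every attempt succeeds with probability at least
`e⁻⁴`.

Adaptivity. The queries depend on earlier outputs, hence possibly on the tape of the data structure,
whose guarantee is only oblivious. Exactness of the sampling removes this dependence: for a fixed
index sequence, the probability that the choices follow it and that the tape is good for it is the
product of the softmax weights and the oblivious probability (`Input.sampleMeasure_prefix`). The
weights sum to one over all sequences, so the oblivious guarantee survives
(`Input.le_sampleMeasure_accurate`).

Conclusion. The uniform numbers of an iteration are independent of its past, so on the accurate
event the conditional expectation of the output is the softmax average (`Input.condExp_output`).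
Exponential moments of the attempt counts multiply over the iterations
(`Input.lintegral_prod_moment_le`), and Markov's inequality leaves `O(T + log (1/δ))` attempts.
Inaccuracy and too many attempts each use `δ / 2`. -/

theorem pNorm_one {d : ℕ} (v : Vec d) : pNorm (1 : ℕ) v = ∑ j, |v j| := by
  -- The norm instance depends on the exponent, so the cast of `1` is replaced by substituting a
  -- variable `q` instead of by rewriting.
  have : ∀ q : ℝ≥0∞, q = 1 → pNorm q v = ∑ j, |v j| := by
    rintro _ rfl
    exact PiLp.norm_eq_of_L1 _
  exact this _ Nat.cast_one

theorem pNorm_two {d : ℕ} (v : Vec d) : pNorm (2 : ℕ) v = Real.sqrt (∑ j, v j ^ 2) := by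
  have : ∀ q : ℝ≥0∞, q = 2 → pNorm q v = Real.sqrt (∑ j, v j ^ 2) := by
    rintro _ rfl
    simp [pNorm, PiLp.norm_eq_of_L2]
  exact this _ (by norm_num)

theorem dualNorm_one {d : ℕ} (v : Vec d) : dualNorm (1 : ℕ) v = ⨆ j, |v j| := by
  have : ∀ q : ℝ≥0∞, q = ∞ → pNorm q v = ⨆ j, |v j| := by
    rintro _ rfl
    exact PiLp.norm_eq_ciSup _
  exact this _ (by simp [ENNReal.conjExponent])

theorem dualNorm_two {d : ℕ} (v : Vec d) : dualNorm (2 : ℕ) v = pNorm (2 : ℕ) v := by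
  have h : (2 - 1 : ℝ≥0∞) = 1 := by
    exact_mod_cast (rfl : ((2 - 1 : ℕ) : ℕ) = 1)
  have : ENNReal.conjExponent (2 : ℕ) = (2 : ℕ) := by
    simp only [ENNReal.conjExponent, Nat.cast_ofNat, h]
    norm_num
  rw [dualNorm, this]

theorem abs_le_dualNorm_one {d : ℕ} (v : Vec d) (j : Fin d) : |v j| ≤ dualNorm (1 : ℕ) v := by
  rw [dualNorm_one]
  exact le_ciSup (f := fun j => |v j|) (Set.finite_range _).bddAbove j

theorem pNorm_nonneg {d p : ℕ} (hp : p = 1 ∨ p = 2) (v : Vec d) : 0 ≤ pNorm p v := by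
  rcases hp with rfl | rfl
  · rw [pNorm_one]; positivity
  · rw [pNorm_two]; positivity

theorem pNorm_add_le {d p : ℕ} (hp : p = 1 ∨ p = 2) (v w : Vec d) :
    pNorm p (v + w) ≤ pNorm p v + pNorm p w := by
  have : Fact (1 ≤ (p : ℝ≥0∞)) := ⟨by rcases hp with rfl | rfl <;> simp⟩
  exact norm_add_le (WithLp.toLp (p : ℝ≥0∞) v) (WithLp.toLp (p : ℝ≥0∞) w)

theorem pNorm_smul {d p : ℕ} (hp : p = 1 ∨ p = 2) (a : ℝ) (v : Vec d) :
    pNorm p (a • v) = |a| * pNorm p v := by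
  have : Fact (1 ≤ (p : ℝ≥0∞)) := ⟨by rcases hp with rfl | rfl <;> simp⟩
  exact norm_smul a (WithLp.toLp (p : ℝ≥0∞) v)

theorem pNorm_zero {d p : ℕ} (hp : p = 1 ∨ p = 2) : pNorm p (0 : Vec d) = 0 := by
  simpa using pNorm_smul hp 0 (0 : Vec d)

theorem dualNorm_add_le {d p : ℕ} (hp : p = 1 ∨ p = 2) (v w : Vec d) :
    dualNorm p (v + w) ≤ dualNorm p v + dualNorm p w := by
  rcases hp with rfl | rfl
  · rw [dualNorm_one (v + w)]
    rcases isEmpty_or_nonempty (Fin d)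
    · simp only [dualNorm_one, Real.iSup_of_isEmpty, add_zero, le_refl]
    · exact ciSup_le fun j => (abs_add_le _ _).trans
        (add_le_add (abs_le_dualNorm_one v j) (abs_le_dualNorm_one w j))
  · simp only [dualNorm_two]
    exact pNorm_add_le (Or.inr rfl) v w

theorem dot_apply {d : ℕ} (g v : Vec d) : dot g v = ∑ j, g j * v j := by
  simp [dot]

/-- Hölder's inequality. -/
theorem abs_dot_le {d p : ℕ} (hp : p = 1 ∨ p = 2) (g v : Vec d) :
    |dot g v| ≤ dualNorm p g * pNorm p v := by
  rw [dot_apply]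
  rcases hp with rfl | rfl
  · rw [pNorm_one, Finset.mul_sum]
    refine (Finset.abs_sum_le_sum_abs _ _).trans (Finset.sum_le_sum fun j _ => ?_)
    rw [abs_mul]
    exact mul_le_mul_of_nonneg_right (abs_le_dualNorm_one g j) (abs_nonneg _)
  · rw [dualNorm_two, pNorm_two, pNorm_two, ← Real.sqrt_mul (by positivity)]
    exact Real.abs_le_sqrt (Finset.sum_mul_sq_le_sq_mul_sq _ _ _)

/-- The dual norm is the best constant in Hölder's inequality. -/
theorem dualNorm_le {d p : ℕ} (hp : p = 1 ∨ p = 2) {g : Vec d} {L : ℝ} (hL : 0 ≤ L)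
    (h : ∀ v, |dot g v| ≤ L * pNorm p v) : dualNorm p g ≤ L := by
  rcases hp with rfl | rfl
  · rw [dualNorm_one]
    refine Real.iSup_le (fun j => ?_) hL
    -- Coordinate vectors, up to sign, are the extreme points of the `ℓ_1` ball; for `p = 2` the
    -- vector `g` itself is extremal.
    have := h (Pi.single j 1)
    rw [dot_apply, pNorm_one] at this
    simpa [Pi.single_apply, apply_ite abs] using this
  · rw [dualNorm_two]
    have := h g
    have h2 : dot g g = pNorm (2 : ℕ) g ^ 2 := by
      rw [dot_apply, pNorm_two, Real.sq_sqrt (by positivity)]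
      exact Finset.sum_congr rfl fun _ _ => by ring
    have h0 := pNorm_nonneg (Or.inr rfl : (2 : ℕ) = 1 ∨ 2 = 2) g
    rw [h2, abs_of_nonneg (sq_nonneg _)] at this
    rcases h0.eq_or_lt with h0 | h0
    · rwa [← h0]
    · nlinarith

/-- The weights `|x|^p` from which coordinates are sampled. -/
def wt (p : ℕ) (x : ℝ) : ℝ := if p = 1 then |x| else x * x

/-- The `ℓ_p` norm as a function of the total weight. -/
def rootWt (p : ℕ) (W : ℝ) : ℝ := if p = 1 then W else Real.sqrt W

theorem wt_nonneg (p : ℕ) (x : ℝ) : 0 ≤ wt p x := by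
  unfold wt; split_ifs
  exacts [abs_nonneg x, mul_self_nonneg x]

theorem eq_zero_of_wt {p : ℕ} {x : ℝ} (h : wt p x = 0) : x = 0 := by
  unfold wt at h; split_ifs at h <;> simpa using h

theorem pNorm_eq_rootWt {d p : ℕ} (hp : p = 1 ∨ p = 2) (v : Vec d) :
    pNorm p v = rootWt p (∑ j, wt p (v j)) := by
  rcases hp with rfl | rfl
  · rw [pNorm_one]; simp [rootWt, wt]
  · rw [pNorm_two]; simp [rootWt, wt, sq]

theorem sum_wt_pos {d p : ℕ} (hp : p = 1 ∨ p = 2) {v : Vec d} (h : 0 < pNorm p v) :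
    0 < ∑ j, wt p (v j) := by
  refine (Finset.sum_nonneg fun j _ => wt_nonneg p (v j)).lt_of_ne' fun h0 => ?_
  rw [pNorm_eq_rootWt hp, h0] at h
  simp [rootWt] at h

/-- The second moment of the importance sampling estimator of `⟨a, v⟩`. -/
theorem sum_sq_div_wt_le {d p : ℕ} (hp : p = 1 ∨ p = 2) {a : Vec d} (ha : dualNorm p a ≤ 1)
    (v : Vec d) :
    (∑ j, wt p (v j)) * ∑ j, a j ^ 2 * v j ^ 2 / wt p (v j) ≤ pNorm p v ^ 2 := by
  rcases hp with rfl | rfl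
  -- For `p = 1` each summand is at most `|v j|` because `|a j| ≤ 1`. For `p = 2` each is at most
  -- `(a j)²`, and these sum to at most one.
  · rw [pNorm_one, sq (∑ j, |v j|)]
    refine mul_le_mul (le_of_eq (by simp [wt])) (Finset.sum_le_sum fun j _ => ?_)
      (Finset.sum_nonneg fun j _ => div_nonneg (by positivity) (wt_nonneg _ _)) (by positivity)
    have h1 : a j ^ 2 ≤ 1 := by
      have := (abs_le_dualNorm_one a j).trans ha
      rw [← sq_abs]; exact pow_le_one₀ (abs_nonneg _) this
    rcases eq_or_ne (v j) 0 with h | h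
    · simp [h]
    · rw [div_le_iff₀ (by simpa [wt] using h)]
      simp only [wt, if_true]
      rw [← sq, sq_abs]
      nlinarith [sq_nonneg (v j)]
  · have h1 : ∑ j, a j ^ 2 ≤ 1 := by
      rw [dualNorm_two, pNorm_two] at ha
      have := Real.sqrt_le_one.1 ha
      exact this
    rw [pNorm_two, Real.sq_sqrt (by positivity)]
    have h2 : ∑ j, a j ^ 2 * v j ^ 2 / wt 2 (v j) ≤ 1 := by
      refine (Finset.sum_le_sum fun j _ => ?_).trans h1
      rcases eq_or_ne (v j) 0 with h | h
      · simp [h, sq_nonneg]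
      · simp [wt, ← sq, h]
    have h3 : ∑ j, wt 2 (v j) = ∑ j, v j ^ 2 := by simp [wt, sq]
    rw [h3]
    exact mul_le_of_le_one_right (by positivity) h2

/-! ### Lipschitz and smooth functions on convex sets -/

section Smooth

variable {d p : ℕ} {X : Set (Vec d)} {Lf Lg : ℝ} {f : Vec d → ℝ} {g : Vec d → Vec d}

/-- At interior points the difference quotients in every direction are bounded by `Lf`. From any
other point of `X` one moves slightly towards an interior point, and smoothness bounds the change of
the gradient. With empty interior the bound is the field `grad_le`. -/
theorem dualNorm_grad_le (hp : p = 1 ∨ p = 2) (hX : Convex ℝ X) (hLf : 0 ≤ Lf)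
    (h : LipschitzSmooth p X Lf Lg f g) {x : Vec d} (hx : x ∈ X) : dualNorm p (g x) ≤ Lf := by
  rcases (interior X).eq_empty_or_nonempty with h0 | ⟨z, hz⟩
  · exact h.grad_le h0 x hx
  have key : ∀ y ∈ interior X, dualNorm p (g y) ≤ Lf := by
    intro y hy
    refine dualNorm_le hp hLf fun v => ?_
    have hy' : X ∈ nhds y := mem_interior_iff_mem_nhds.1 hy
    have h1 : HasFDerivAt f (dot (g y)) y :=
      (h.hasGrad y (interior_subset hy)).hasFDerivAt hy'
    have hl : HasDerivAt (fun t : ℝ => y + t • v) v 0 := by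
      simpa using ((hasDerivAt_id (0 : ℝ)).smul_const v).const_add y
    have h2 : HasDerivAt (fun t : ℝ => f (y + t • v)) (dot (g y) v) 0 := by
      have h1' : HasFDerivAt f (dot (g y)) (y + (0 : ℝ) • v) := by simpa using h1
      exact h1'.comp_hasDerivAt 0 hl
    refine h2.le_of_lip' (mul_nonneg hLf (pNorm_nonneg hp v)) ?_
    have hc : Filter.Tendsto (fun t : ℝ => y + t • v) (nhds 0) (nhds y) := by
      simpa using hl.continuousAt.tendsto
    filter_upwards [hc hy'] with t ht
    have := h.lipschitz _ ht _ (interior_subset hy)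
    simp only [zero_smul, add_zero, sub_zero, Real.norm_eq_abs]
    refine this.trans_eq ?_
    rw [add_sub_cancel_left, pNorm_smul hp]; ring
  refine le_of_forall_pos_le_add fun e he => ?_
  -- No sign of `Lg` is known, hence the absolute value; `t` is then chosen with `t * (c + 1) ≤ e`.
  set c := |Lg| * pNorm p (z - x) with hc
  have hc0 : 0 ≤ c := mul_nonneg (abs_nonneg _) (pNorm_nonneg hp _)
  set t : ℝ := min 1 (e / (c + 1)) with ht
  have ht0 : 0 < t := lt_min one_pos (by positivity)
  have hmem := hX.add_smul_sub_mem_interior hx hz ⟨ht0, min_le_left _ _⟩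
  have h1 := key _ hmem
  have h2 := h.smooth x hx _ (interior_subset hmem)
  have h3 := dualNorm_add_le hp (g (x + t • (z - x))) (g x - g (x + t • (z - x)))
  rw [add_sub_cancel] at h3
  have h4 : pNorm p (x - (x + t • (z - x))) = t * pNorm p (z - x) := by
    rw [show x - (x + t • (z - x)) = (-t) • (z - x) by rw [neg_smul]; abel, pNorm_smul hp, abs_neg,
      abs_of_pos ht0]
  rw [h4] at h2
  have h5 : t * (c + 1) ≤ e := by
    have := min_le_right 1 (e / (c + 1))
    rwa [← ht, le_div_iff₀ (by positivity)] at this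
  have h6 : Lg * (t * pNorm p (z - x)) ≤ t * c := by
    rw [hc]
    have : Lg * (t * pNorm p (z - x)) ≤ |Lg| * (t * pNorm p (z - x)) :=
      mul_le_mul_of_nonneg_right (le_abs_self _) (mul_nonneg ht0.le (pNorm_nonneg hp _))
    linarith [this]
  linarith

/-- Along the segment the remainder has derivative `⟨g (x + t v) - g x, v⟩`, which Hölder and
smoothness bound by `Lg ‖v‖² t`; the mean value inequality compares it with `Lg ‖v‖² t² / 2`. -/
theorem abs_taylor_le (hp : p = 1 ∨ p = 2) (hX : Convex ℝ X)
    (h : LipschitzSmooth p X Lf Lg f g) {x y : Vec d} (hx : x ∈ X) (hy : y ∈ X) :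
    |f y - f x - dot (g x) (y - x)| ≤ Lg * pNorm p (y - x) ^ 2 / 2 := by
  set v := y - x with hv
  set N := pNorm p v with hN
  have hN0 : 0 ≤ N := pNorm_nonneg hp v
  have hmem : ∀ t ∈ Set.Icc (0 : ℝ) 1, x + t • v ∈ X := fun t ht =>
    hX.add_smul_sub_mem hx hy ht
  have hd : ∀ t ∈ Set.Icc (0 : ℝ) 1,
      HasDerivWithinAt (fun t : ℝ => f (x + t • v)) (dot (g (x + t • v)) v) (Set.Icc 0 1) t := by
    intro t ht
    have hl : HasDerivWithinAt (fun t : ℝ => x + t • v) v (Set.Icc 0 1) t := by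
      simpa using (((hasDerivAt_id t).smul_const v).const_add x).hasDerivWithinAt
    exact (h.hasGrad _ (hmem t ht)).comp_hasDerivWithinAt t hl hmem
  have hd' : ∀ t ∈ Set.Icc (0 : ℝ) 1,
      HasDerivWithinAt (fun t : ℝ => f (x + t • v) - f x - t * dot (g x) v)
        (dot (g (x + t • v)) v - dot (g x) v) (Set.Icc 0 1) t := by
    intro t ht
    have := ((hd t ht).sub_const (f x)).sub
      (((hasDerivAt_id t).mul_const (dot (g x) v)).hasDerivWithinAt (s := Set.Icc 0 1))
    rw [one_mul] at this
    exact this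
  have := image_norm_le_of_norm_deriv_right_le_deriv_boundary
    (f := fun t : ℝ => f (x + t • v) - f x - t * dot (g x) v)
    (f' := fun t => dot (g (x + t • v)) v - dot (g x) v) (a := 0) (b := 1)
    (B := fun t => Lg * N ^ 2 / 2 * t ^ 2) (B' := fun t => Lg * N ^ 2 * t)
    (fun t ht => (hd' t ht).continuousWithinAt)
    (fun t ht => (hd' t ⟨ht.1, ht.2.le⟩).mono_of_mem_nhdsWithin
      (Icc_mem_nhdsGE_of_mem ht))
    (by simp) (fun t => by
      have := ((hasDerivAt_id t).pow 2).const_mul (Lg * N ^ 2 / 2)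
      refine this.congr_deriv ?_
      simp; ring)
    (fun t ht => by
      have ht' : t ∈ Set.Icc (0 : ℝ) 1 := ⟨ht.1, ht.2.le⟩
      have h1 : dot (g (x + t • v)) v - dot (g x) v = dot (g (x + t • v) - g x) v := by
        simp [dot_apply, sub_mul]
      rw [Real.norm_eq_abs, h1]
      refine (abs_dot_le hp _ _).trans ?_
      have h2 := h.smooth _ (hmem t ht') _ hx
      rw [add_sub_cancel_left, pNorm_smul hp, abs_of_nonneg ht.1] at h2
      calc _ ≤ Lg * (t * pNorm p v) * pNorm p v := mul_le_mul_of_nonneg_right h2 hN0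
        _ = _ := by rw [← hN]; ring)
    (x := 1) ⟨zero_le_one, le_rfl⟩
  simpa [hv] using this

theorem abs_taylor_le_of_dist_le (hp : p = 1 ∨ p = 2) (hX : Convex ℝ X)
    (h : LipschitzSmooth p X Lf Lg f g) {x y : Vec d} (hx : x ∈ X) (hy : y ∈ X) {r e : ℝ}
    (hr : pNorm p (y - x) ≤ r) (he : 0 ≤ e) (hre : Lg * r ^ 2 / 2 ≤ e) :
    |f y - f x - dot (g x) (y - x)| ≤ e := by
  refine (abs_taylor_le hp hX h hx hy).trans ?_
  -- A nonpositive `Lg` makes the Taylor bound nonpositive, so `0 ≤ e` suffices.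
  rcases le_total 0 Lg with hL | hL
  · have : pNorm p (y - x) ^ 2 ≤ r ^ 2 := pow_le_pow_left₀ (pNorm_nonneg hp _) hr 2
    nlinarith
  · nlinarith [sq_nonneg (pNorm p (y - x))]

end Smooth

theorem hasFDerivWithinAt_smax {n d : ℕ} [NeZero n] {f : Fin n → Vec d → ℝ}
    {g : Fin n → Vec d → Vec d} {e : ℝ} (he : e ≠ 0) {X : Set (Vec d)} {x : Vec d}
    (h : ∀ i, HasFDerivWithinAt (f i) (dot (g i x)) X x) :
    HasFDerivWithinAt (smax f e) (dot (smaxGrad f g e x)) X x := by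
  have hpos : 0 < ∑ i, Real.exp (f i x / e) :=
    Finset.sum_pos (fun _ _ => Real.exp_pos _) Finset.univ_nonempty
  have h1 : HasFDerivWithinAt (fun x => ∑ i, Real.exp (f i x / e))
      (∑ i, Real.exp (f i x / e) • (e⁻¹ • dot (g i x))) X x := by
    refine HasFDerivWithinAt.fun_sum fun i _ => HasFDerivWithinAt.exp ?_
    simp only [div_eq_inv_mul]
    exact (h i).const_smul e⁻¹
  have h2 := (h1.log hpos.ne').const_mul e
  refine h2.congr_fderiv ?_
  ext v
  simp only [smul_apply, sum_apply, smul_eq_mul, dot_apply,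
    smaxGrad, Finset.sum_apply, Pi.smul_apply]
  rw [Finset.mul_sum, Finset.mul_sum]
  simp_rw [Finset.sum_mul]
  rw [Finset.sum_comm]
  refine Finset.sum_congr rfl fun i _ => ?_
  rw [Finset.mul_sum, Finset.mul_sum, Finset.mul_sum, Finset.mul_sum]
  refine Finset.sum_congr rfl fun j _ => ?_
  field_simp

/-! ### Sampling an index -/

theorem measurable_sInf_nat {α : Type*} [MeasurableSpace α] {Q : ℕ → Set α}
    (hQ : ∀ i, MeasurableSet (Q i)) : Measurable fun a => sInf {i | a ∈ Q i} := by
  refine measurable_to_countable' fun i => ?_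
  -- The second piece accounts for `sInf ∅ = 0` and only enlarges the fibre over `0`.
  have : (fun a => sInf {i | a ∈ Q i}) ⁻¹' {i} =
      ((Q i ∩ ⋂ j : Fin i, (Q j)ᶜ) ∪ {a | i = 0 ∧ a ∈ ⋂ j, (Q j)ᶜ}) := by
    ext a
    simp only [Set.mem_preimage, Set.mem_singleton_iff, Set.mem_union, Set.mem_inter_iff,
      Set.mem_iInter, Set.mem_compl_iff, Set.mem_ofPred_eq]
    constructor
    · rintro rfl
      rcases {i | a ∈ Q i}.eq_empty_or_nonempty with h | h
      · right
        refine ⟨by rw [h, Nat.sInf_empty], fun j hj => ?_⟩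
        exact (Set.eq_empty_iff_forall_notMem.1 h) j hj
      · exact Or.inl ⟨Nat.sInf_mem h, fun j hj => Nat.notMem_of_lt_sInf j.2 hj⟩
    · rintro (⟨h1, h2⟩ | ⟨rfl, h2⟩)
      · refine le_antisymm (Nat.sInf_le h1) (le_csInf ⟨i, h1⟩ fun j hj => ?_)
        by_contra hlt
        exact h2 ⟨j, not_le.1 hlt⟩ hj
      · rw [(Set.eq_empty_iff_forall_notMem.2 h2 : {i | a ∈ Q i} = ∅), Nat.sInf_empty]
  rw [this]
  refine ((hQ i).inter (.iInter fun j : Fin i => (hQ j).compl)).union ?_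
  by_cases h : i = 0
  · simp only [h, true_and]
    exact MeasurableSet.iInter fun j => (hQ j).compl
  · simp [h]

theorem measurable_pick {α : Type*} [MeasurableSpace α] {m : ℕ} {w : α → ℕ → ℝ} {u : α → ℝ}
    (hw : ∀ j, Measurable fun a => w a j) (hu : Measurable u) :
    Measurable fun a => pick m (w a) (u a) := by
  refine measurable_sInf_nat (Q := fun i => {a | i < m ∧ u a * ∑ j ∈ Finset.range m, |w a j|
    < ∑ j ∈ Finset.range (i + 1), |w a j|}) fun i => ?_
  have hs : ∀ k, Measurable fun a => ∑ j ∈ Finset.range k, |w a j| := fun k =>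
    Finset.measurable_fun_sum _ fun j _ => (hw j).abs
  exact (MeasurableSet.const (i < m)).inter (measurableSet_lt (hu.mul (hs m)) (hs (i + 1)))

theorem ae_uniform01_mem_Ico : ∀ᵐ u ∂uniform01, u ∈ Set.Ico (0 : ℝ) 1 := by
  rw [uniform01, restrict_Ico_eq_restrict_Icc.symm]
  exact ae_restrict_mem measurableSet_Ico

/-- Partial sums are monotone, so the least index whose partial sum exceeds `u * W` is the cell
containing `u * W`. The condition `u < 1` lets the last index qualify; at `u = 1` none does and
`pick` returns its default. -/
theorem pick_eq_iff {m : ℕ} {w : ℕ → ℝ} (hW : 0 < ∑ j ∈ Finset.range m, |w j|) {u : ℝ}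
    (hu : u ∈ Set.Ico (0 : ℝ) 1) (i : ℕ) :
    pick m w u = i ↔ i < m ∧ ∑ j ∈ Finset.range i, |w j| ≤ u * ∑ j ∈ Finset.range m, |w j| ∧
      u * ∑ j ∈ Finset.range m, |w j| < ∑ j ∈ Finset.range (i + 1), |w j| := by
  set W := ∑ j ∈ Finset.range m, |w j| with hWdef
  have hmono : Monotone fun k => ∑ j ∈ Finset.range k, |w j| :=
    monotone_nat_of_le_succ fun k => by
      rw [Finset.sum_range_succ]; exact le_add_of_nonneg_right (abs_nonneg _)
  have hm : 0 < m := by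
    rcases Nat.eq_zero_or_pos m with rfl | h
    · simp [hWdef] at hW
    · exact h
  set Q := {i | i < m ∧ u * W < ∑ j ∈ Finset.range (i + 1), |w j|} with hQ
  have hne : Q.Nonempty := by
    refine ⟨m - 1, by omega, ?_⟩
    rw [Nat.sub_add_cancel hm, ← hWdef]
    nlinarith [hu.2]
  have hp : pick m w u = sInf Q := rfl
  rw [hp]
  constructor
  · rintro rfl
    have h1 := Nat.sInf_mem hne
    refine ⟨h1.1, ?_, h1.2⟩
    by_contra hlt
    rw [not_le] at hlt
    rcases Nat.eq_zero_or_pos (sInf Q) with h0 | h0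
    · rw [h0, Finset.sum_range_zero] at hlt
      nlinarith [hu.1]
    · refine Nat.notMem_of_lt_sInf (Nat.sub_lt h0 one_pos) (s := Q) ⟨?_, ?_⟩
      · have := h1.1; omega
      · rwa [Nat.sub_add_cancel (show 1 ≤ sInf Q from h0)]
  · rintro ⟨h1, h2, h3⟩
    refine le_antisymm (Nat.sInf_le ⟨h1, h3⟩) (le_csInf hne fun k hk => ?_)
    by_contra hlt
    have := hmono (show k + 1 ≤ i by omega)
    exact absurd (hk.2.trans_le this) (not_lt.2 h2)

/-- Up to a null set the event is an interval of length `|w i| / W`. -/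
theorem uniform01_pick {m : ℕ} {w : ℕ → ℝ} (hW : 0 < ∑ j ∈ Finset.range m, |w j|) {i : ℕ}
    (hi : i < m) : uniform01 {u | pick m w u = i} =
      ENNReal.ofReal (|w i| / ∑ j ∈ Finset.range m, |w j|) := by
  set W := ∑ j ∈ Finset.range m, |w j| with hWdef
  have hmono : Monotone fun k => ∑ j ∈ Finset.range k, |w j| :=
    monotone_nat_of_le_succ fun k => by
      rw [Finset.sum_range_succ]; exact le_add_of_nonneg_right (abs_nonneg _)
  have h : {u | pick m w u = i} =ᵐ[uniform01] Set.Ico ((∑ j ∈ Finset.range i, |w j|) / W)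
      ((∑ j ∈ Finset.range (i + 1), |w j|) / W) := by
    filter_upwards [ae_uniform01_mem_Ico] with u hu
    refine propext ?_
    change pick m w u = i ↔ _ ∧ _
    rw [pick_eq_iff hW hu, ← hWdef, div_le_iff₀ hW, lt_div_iff₀ hW]
    simp [hi]
  rw [measure_congr h, uniform01, Measure.restrict_apply measurableSet_Ico,
    Set.inter_eq_self_of_subset_left, Real.volume_Ico, ← sub_div, Finset.sum_range_succ,
    add_sub_cancel_left]
  refine Set.Ico_subset_Icc_self.trans (Set.Icc_subset_Icc (by positivity) ?_)
  rw [div_le_one hW]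
  exact hmono (show i + 1 ≤ m by omega)

theorem lintegral_pick {m : ℕ} {w : ℕ → ℝ} (hW : 0 < ∑ j ∈ Finset.range m, |w j|)
    (F : ℕ → ℝ≥0∞) : ∫⁻ u, F (pick m w u) ∂uniform01 =
      ∑ i ∈ Finset.range m, F i * ENNReal.ofReal (|w i| / ∑ j ∈ Finset.range m, |w j|) := by
  have hmeas : Measurable fun u => pick m w u :=
    measurable_pick (w := fun _ => w) (fun _ => measurable_const) measurable_id
  rw [← lintegral_map (f := F) (measurable_of_countable _) hmeas, lintegral_countable']
  have hz : ∀ i, i ∉ Finset.range m → F i * Measure.map (fun u => pick m w u) uniform01 {i} = 0 := by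
    intro i hi
    rw [Measure.map_apply hmeas (measurableSet_singleton i)]
    refine mul_eq_zero_of_right _ ?_
    refine measure_mono_null (t := {u | u ∉ Set.Ico (0 : ℝ) 1}) (fun u hu hu' => ?_)
      (ae_iff.1 ae_uniform01_mem_Ico)
    exact hi (Finset.mem_range.2 ((pick_eq_iff hW hu' i).1 hu).1)
  rw [tsum_eq_sum hz]
  refine Finset.sum_congr rfl fun i hi => ?_
  rw [Measure.map_apply hmeas (measurableSet_singleton i)]
  congr 1
  exact uniform01_pick hW (Finset.mem_range.1 hi)

theorem sum_range_ofVec {m : ℕ} {β : Type*} [AddCommMonoid β] (v : Fin m → ℝ) (F : ℕ → ℝ → β) :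
    ∑ j ∈ Finset.range m, F j (ofVec v j) = ∑ j : Fin m, F j (v j) := by
  rw [Finset.sum_range]
  exact Finset.sum_congr rfl fun j _ => by simp [ofVec]

/-! ### Products of independent uniform numbers -/

/-- Injectivity of `e` makes the coordinates `ω (e i)` independent, so the expectation factors. It
is applied to the tape cells read by the samples. -/
theorem lintegral_prod_infinitePi {ι κ α : Type*} [Fintype ι] [MeasurableSpace α] (β : Measure α)
    [IsProbabilityMeasure β] {e : ι → κ} (he : Function.Injective e) {F : ι → α → ℝ≥0∞}
    (hF : ∀ i, Measurable (F i)) :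
    ∫⁻ ω, ∏ i, F i (ω (e i)) ∂(Measure.infinitePi fun _ : κ => β) = ∏ i, ∫⁻ u, F i u ∂β := by
  have h1 := Measure.map_infinitePi_infinitePi_of_inj (P := fun _ : κ => β) he
  have h2 : ∫⁻ ω, ∏ i, F i (ω (e i)) ∂(Measure.infinitePi fun _ : κ => β)
      = ∫⁻ v, ∏ i, F i (v i) ∂(Measure.infinitePi fun _ : ι => β) := by
    rw [← h1, lintegral_map (by fun_prop) (by fun_prop)]
  rw [h2, lintegral_prod_eq_prod_lintegral_of_indepFun Finset.univ
    (fun i (v : ι → α) => F i (v i)) (iIndepFun_infinitePi hF) (by fun_prop)]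
  refine Finset.prod_congr rfl fun i _ => ?_
  have := Measure.infinitePi_map_eval (fun _ : ι => β) i
  rw [← lintegral_map (μ := Measure.infinitePi fun _ : ι => β) (hF i)
    (measurable_pi_apply i), this]

/-! ### The programs of the data structure

Arrays: `R[5]` is the movement since the last refresh, `R[6]` holds the logarithmic factor, the
total weight and the number of samples, `R[7]` holds the weights. -/

namespace Prog

/-- The cell `0` of an array of naturals. -/
def reg (a : ℕ) : NExp := .get a (.const 0)

/-- The number of rows. -/
def rows : NExp := reg 0

/-- The number of columns. -/
def cols : NExp := .get 0 (.const 1)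

/-- A cell of an array of reals with constant index. -/
def cell (a k : ℕ) : RExp := .get a (.const k)

/-- The weight of a coordinate. -/
def wtExp (p : ℕ) (e : RExp) : RExp := if p = 1 then .sqrt (.mul e e) else .mul e e

/-- The norm from the total weight. -/
def rootExp (p : ℕ) (e : RExp) : RExp := if p = 1 then e else .sqrt e

/-- `R[4] := A x₀`, preceded by the computation of the logarithmic factor. -/
def initCmd : Cmd :=
  .seq (.setR 6 (.const 0) (.log (.div (.mul (.const 4) (.mul (.ofNat rows) (cell 2 0)))
      (.mul (cell 2 1) (cell 2 2)))))
    (.loop 2 (.ofNat rows) (.loop 3 (.ofNat cols)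
      (.setR 4 (reg 2) (.add (.get 4 (reg 2))
        (.mul (.get 0 (.add (.mul (reg 2) cols) (reg 3))) (.get 1 (reg 3)))))))

/-- Add the query to the movement and compute the weights. -/
def accum (p : ℕ) : Cmd :=
  .loop 3 (.ofNat cols)
    (.seq (.setR 5 (reg 3) (.add (.get 5 (reg 3)) (.get 3 (reg 3))))
      (.seq (.setR 7 (reg 3) (wtExp p (.get 5 (reg 3))))
        (.setR 6 (.const 1) (.add (cell 6 1) (.get 7 (reg 3))))))

/-- The number of samples of a refresh, before rounding. -/
def samplesExp (p : ℕ) : RExp :=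
  .div (.mul (.const 16) (.mul (rootExp p (cell 6 1)) (.mul (cell 2 0) (cell 6 0))))
    (.mul (cell 2 1) (cell 2 1))

/-- The number of samples of a refresh. -/
def count (p : ℕ) : Cmd :=
  .loop 4 (samplesExp p) (.setR 6 (.const 2) (.add (.ofNat (reg 4)) (.const 1)))

/-- The scale factor of the influence function. -/
def lamExp : RExp := .div (.mul (.const 4) (cell 6 0)) (cell 2 1)

/-- The scaled importance sampling estimate for a row and the sampled column. -/
def yExp : RExp :=
  .mul lamExp (.div (.mul (.get 0 (.add (.mul (reg 2) cols) (reg 5)))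
    (.mul (.get 5 (reg 5)) (cell 6 1))) (.mul (.get 7 (reg 5)) (cell 6 2)))

/-- Update all rows with one sample. -/
def addSample : Cmd :=
  .loop 2 (.ofNat rows) (.setR 4 (reg 2) (.add (.get 4 (reg 2))
    (.div (.log (.add (.const 1) (.add yExp (.mul yExp yExp)))) lamExp)))

/-- All samples of a refresh. -/
def sample (p : ℕ) : Cmd :=
  .loop 4 (samplesExp p) (.seq (.draw 0 5 (.const 0)) addSample)

/-- Reset the movement. -/
def reset : Cmd := .loop 3 (.ofNat cols) (.setR 5 (reg 3) (.const 0))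

/-- A refresh of the estimate. -/
def refresh (p : ℕ) : Cmd :=
  .seq (.prep 0 7 cols) (.seq (count p) (.seq (sample p) (.seq reset
    (.setN 1 (.const 0) (.const 1)))))

/-- A query: refresh the estimate if the movement exceeds `ε / 2`. -/
def queryCmd (p : ℕ) : Cmd :=
  .seq (.setR 6 (.const 1) (.const 0)) (.seq (accum p)
    (.ite (rootExp p (cell 6 1)) (.div (cell 2 1) (.const 2)) .skip (refresh p)))

end Prog

/-- The data structure for `p = 1, 2`. -/
def sketch (p : ℕ) : DataStructure := ⟨Prog.initCmd, Prog.queryCmd p⟩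

/-! ### Execution of the programs -/

/-- The invariant rule for loops: `I k` describes the store after `k` rounds. The number of rounds
is fixed by the store at entry. -/
theorem exec_loop {ω : ℕ → ℝ} {a : ℕ} {e : RExp} {c : Cmd} {σ : Store} (I : ℕ → Store → Prop)
    {m : ℕ} (hm : ⌈e.eval σ⌉₊ = m) (h0 : I 0 (σ.tick (e.cost + 1)))
    (hs : ∀ j < m, ∀ τ, I j τ → I (j + 1) (c.exec ω ((τ.setN a 0 j).tick 1))) :
    I m ((Cmd.loop a e c).exec ω σ) := by
  simp only [Cmd.exec, hm]
  have : ∀ k ≤ m, I k (Nat.rec (motive := fun _ => Store) (σ.tick (e.cost + 1))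
      (fun j τ => c.exec ω ((τ.setN a 0 j).tick 1)) k) := by
    intro k
    induction k with
    | zero => intro _; exact h0
    | succ k ih => intro hk; exact hs k (by omega) _ (ih (by omega))
  exact this m le_rfl

theorem wtExp_eval (p : ℕ) (e : RExp) (σ : Store) :
    (Prog.wtExp p e).eval σ = wt p (e.eval σ) := by
  unfold Prog.wtExp wt
  split_ifs
  · simp [RExp.eval, Real.sqrt_mul_self_eq_abs]
  · simp [RExp.eval]

theorem wtExp_cost (p : ℕ) (e : RExp) : (Prog.wtExp p e).cost ≤ 2 * e.cost + 2 := by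
  unfold Prog.wtExp
  split_ifs <;> simp [RExp.cost] <;> omega

theorem rootExp_eval (p : ℕ) (e : RExp) (σ : Store) :
    (Prog.rootExp p e).eval σ = rootWt p (e.eval σ) := by
  unfold Prog.rootExp rootWt
  split_ifs
  · rfl
  · simp [RExp.eval]

theorem rootExp_cost (p : ℕ) (e : RExp) : (Prog.rootExp p e).cost ≤ e.cost + 1 := by
  unfold Prog.rootExp
  split_ifs <;> simp [RExp.cost]

theorem samplesExp_cost (p : ℕ) : (Prog.samplesExp p).cost ≤ 20 := by
  have := rootExp_cost p (Prog.cell 6 1)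
  simp [Prog.samplesExp, RExp.cost, NExp.cost, Prog.cell] at this ⊢
  omega

/-- The number of samples, before rounding, for a movement of norm `N`. -/
def numSamples (R ε L N : ℝ) : ℝ := 16 * (N * (R * L)) / (ε * ε)

theorem samplesExp_eval (p : ℕ) (σ : Store) : (Prog.samplesExp p).eval σ =
    numSamples (σ.R 2 0) (σ.R 2 1) (σ.R 6 0) (rootWt p (σ.R 6 1)) := by
  simp [Prog.samplesExp, RExp.eval, NExp.eval, Prog.cell, rootExp_eval, numSamples]

theorem accum_spec (p : ℕ) (ω : ℕ → ℝ) (σ : Store) (h : σ.R 6 1 = 0) :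
    let σ' := (Prog.accum p).exec ω σ
    (∀ a, a ≠ 5 → a ≠ 6 → a ≠ 7 → σ'.R a = σ.R a) ∧ (∀ a, a ≠ 3 → σ'.N a = σ.N a) ∧
    σ'.pos = σ.pos ∧ (∀ j < σ.N 0 1, σ'.R 5 j = σ.R 5 j + σ.R 3 j) ∧
    (∀ j < σ.N 0 1, σ'.R 7 j = wt p (σ.R 5 j + σ.R 3 j)) ∧ σ'.R 6 0 = σ.R 6 0 ∧
    σ'.R 6 1 = ∑ j ∈ Finset.range (σ.N 0 1), wt p (σ.R 5 j + σ.R 3 j) ∧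
    σ'.time ≤ σ.time + 40 * (σ.N 0 1) + 10 := by
  intro σ'
  have := exec_loop (ω := ω) (a := 3) (e := .ofNat Prog.cols) (σ := σ)
    (c := .seq (.setR 5 (Prog.reg 3) (.add (.get 5 (Prog.reg 3)) (.get 3 (Prog.reg 3))))
      (.seq (.setR 7 (Prog.reg 3) (Prog.wtExp p (.get 5 (Prog.reg 3))))
        (.setR 6 (.const 1) (.add (Prog.cell 6 1) (.get 7 (Prog.reg 3))))))
    (m := σ.N 0 1)
    -- The clause for `j ≥ k` keeps the cells not yet visited at their old values, which is what
    -- round `k` reads.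
    (fun k τ => (∀ a, a ≠ 5 → a ≠ 6 → a ≠ 7 → τ.R a = σ.R a) ∧ (∀ a, a ≠ 3 → τ.N a = σ.N a) ∧
      τ.pos = σ.pos ∧ (∀ j < k, τ.R 5 j = σ.R 5 j + σ.R 3 j) ∧ (∀ j ≥ k, τ.R 5 j = σ.R 5 j) ∧
      (∀ j < k, τ.R 7 j = wt p (σ.R 5 j + σ.R 3 j)) ∧ τ.R 6 0 = σ.R 6 0 ∧
      τ.R 6 1 = ∑ j ∈ Finset.range k, wt p (σ.R 5 j + σ.R 3 j) ∧
      τ.time ≤ σ.time + 40 * k + 10)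
    (by simp [RExp.eval, NExp.eval, Prog.cols])
    (by simp [Store.tick, h, RExp.cost, NExp.cost, Prog.cols])
    (by
      rintro k hk τ ⟨h1, h2, h3, h4, h5, h6, h7, h8, h9⟩
      have hc := wtExp_cost p (.get 5 (Prog.reg 3))
      have h13 := h1 3 (by decide) (by decide) (by decide)
      simp only [Cmd.exec, Store.tick, Store.setN, Store.setR, NExp.eval, RExp.eval, Prog.reg,
        Prog.cell, wtExp_eval, NExp.cost, RExp.cost] at hc ⊢
      refine ⟨fun a ha hb hc => ?_, fun a ha => ?_, h3, fun j hj => ?_, fun j hj => ?_,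
        fun j hj => ?_, ?_, ?_, ?_⟩
      · simp [ha, hb, hc, h1]
      · simp [ha, h2]
      · rcases (Nat.lt_succ_iff_lt_or_eq.1 hj) with hj | rfl
        · simp [hj.ne, h4 j hj]
        · simp [h5 j le_rfl, h13]
      · have : j ≠ k := by omega
        simp [this, h5 j (by omega)]
      · rcases (Nat.lt_succ_iff_lt_or_eq.1 hj) with hj | rfl
        · simp [hj.ne, h6 j hj]
        · simp [h5 j le_rfl, h13]
      · simp [h7]
      · simp [h8, Finset.sum_range_succ, h5 k le_rfl, h13]
      · omega)
  obtain ⟨h1, h2, h3, h4, -, h6, h7, h8, h9⟩ := this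
  exact ⟨h1, h2, h3, h4, h6, h7, h8, h9⟩


/-- The influence of a sample on the estimate. -/
def infl (lam y : ℝ) : ℝ := Real.log (1 + (y + y * y)) / lam

/-- The scaled importance sampling estimate: `a` and `x` are the entries of the row and of the
movement, `w` and `W` the weight and the total weight, `m` the number of samples. -/
def scaledEst (lam a x w W m : ℝ) : ℝ := lam * (a * (x * W) / (w * m))

theorem addSample_spec (ω : ℕ → ℝ) (σ : Store) :
    let σ' := Prog.addSample.exec ω σ
    let lam := 4 * σ.R 6 0 / σ.R 2 1
    let J := σ.N 5 0
    (∀ a, a ≠ 4 → σ'.R a = σ.R a) ∧ (∀ a, a ≠ 2 → σ'.N a = σ.N a) ∧ σ'.S = σ.S ∧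
    σ'.pos = σ.pos ∧
    (∀ i < σ.N 0 0, σ'.R 4 i = σ.R 4 i + infl lam (scaledEst lam (σ.R 0 (i * σ.N 0 1 + J))
      (σ.R 5 J) (σ.R 7 J) (σ.R 6 1) (σ.R 6 2))) ∧
    σ'.time ≤ σ.time + 200 * (σ.N 0 0) + 10 := by
  intro σ' lam J
  have := exec_loop (ω := ω) (a := 2) (e := .ofNat Prog.rows) (σ := σ)
    (c := .setR 4 (Prog.reg 2) (.add (.get 4 (Prog.reg 2))
    (.div (.log (.add (.const 1) (.add Prog.yExp (.mul Prog.yExp Prog.yExp)))) Prog.lamExp)))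
    (m := σ.N 0 0)
    (fun k τ => (∀ a, a ≠ 4 → τ.R a = σ.R a) ∧ (∀ a, a ≠ 2 → τ.N a = σ.N a) ∧ τ.S = σ.S ∧
      τ.pos = σ.pos ∧ (∀ i < k, τ.R 4 i = σ.R 4 i + infl lam (scaledEst lam
        (σ.R 0 (i * σ.N 0 1 + J)) (σ.R 5 J) (σ.R 7 J) (σ.R 6 1) (σ.R 6 2))) ∧
      (∀ i ≥ k, τ.R 4 i = σ.R 4 i) ∧ τ.time ≤ σ.time + 200 * k + 10)
    (by simp [RExp.eval, NExp.eval, Prog.rows, Prog.reg])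
    (by simp [Store.tick, RExp.cost, NExp.cost, Prog.rows, Prog.reg])
    (by
      rintro k hk τ ⟨h1, h2, h3, h4, h5, h6, h7⟩
      simp only [Cmd.exec, Store.tick, Store.setN, Store.setR, NExp.eval, RExp.eval, Prog.reg,
        Prog.cell, Prog.yExp, Prog.lamExp, Prog.cols, NExp.cost, RExp.cost]
      refine ⟨fun a ha => ?_, fun a ha => ?_, h3, h4, fun j hj => ?_, fun j hj => ?_, ?_⟩
      · simp [ha, h1]
      · simp [ha, h2]
      · rcases (Nat.lt_succ_iff_lt_or_eq.1 hj) with hj | rfl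
        · simp [hj.ne, h5 j hj]
        · simp [h6 j le_rfl, h1, h2, infl, scaledEst, lam, J]
      · have : j ≠ k := by omega
        simp [this, h6 j (by omega)]
      · omega)
  obtain ⟨h1, h2, h3, h4, h5, -, h7⟩ := this
  exact ⟨h1, h2, h3, h4, h5, h7⟩

/-- Expressions have no rounding, but a loop bound is rounded up, so the number of samples is
obtained by counting rounds. With no rounds the cell is never written, hence the condition `0 < m`.
-/
theorem count_spec (p : ℕ) (ω : ℕ → ℝ) (σ : Store) {m : ℕ}
    (hm : ⌈numSamples (σ.R 2 0) (σ.R 2 1) (σ.R 6 0) (rootWt p (σ.R 6 1))⌉₊ = m) :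
    let σ' := (Prog.count p).exec ω σ
    (∀ a, a ≠ 6 → σ'.R a = σ.R a) ∧ (∀ a, a ≠ 4 → σ'.N a = σ.N a) ∧ σ'.S = σ.S ∧
    σ'.pos = σ.pos ∧ (∀ k, k ≠ 2 → σ'.R 6 k = σ.R 6 k) ∧ (0 < m → σ'.R 6 2 = m) ∧
    σ'.time ≤ σ.time + 10 * m + 30 := by
  intro σ'
  have hc := samplesExp_cost p
  exact exec_loop (ω := ω) (a := 4) (e := Prog.samplesExp p) (σ := σ)
    (c := .setR 6 (.const 2) (.add (.ofNat (Prog.reg 4)) (.const 1)))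
    (m := m)
    (fun k τ => (∀ a, a ≠ 6 → τ.R a = σ.R a) ∧ (∀ a, a ≠ 4 → τ.N a = σ.N a) ∧ τ.S = σ.S ∧
      τ.pos = σ.pos ∧ (∀ k, k ≠ 2 → τ.R 6 k = σ.R 6 k) ∧ (0 < k → τ.R 6 2 = k) ∧
      τ.time ≤ σ.time + 10 * k + 30)
    (by rw [samplesExp_eval, hm])
    (by simp only [Store.tick]; simp; omega)
    (by
      rintro k hk τ ⟨h1, h2, h3, h4, h5, h6, h7⟩
      simp only [Cmd.exec, Store.tick, Store.setN, Store.setR, NExp.eval, RExp.eval, Prog.reg,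
        NExp.cost, RExp.cost]
      refine ⟨fun a ha => ?_, fun a ha => ?_, h3, h4, fun j hj => ?_, fun _ => ?_, ?_⟩
      · simp [ha, h1]
      · simp [ha, h2]
      · simp [hj, h5]
      · simp
      · omega)

/-- The `k`-th draw reads the tape at `σ.pos + k`. Movement, weights and the preprocessed vector
stay fixed, so all samples of a refresh come from one distribution. -/
theorem sample_spec (p : ℕ) (ω : ℕ → ℝ) (σ : Store) {m : ℕ}
    (hm : ⌈numSamples (σ.R 2 0) (σ.R 2 1) (σ.R 6 0) (rootWt p (σ.R 6 1))⌉₊ = m) :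
    let σ' := (Prog.sample p).exec ω σ
    let lam := 4 * σ.R 6 0 / σ.R 2 1
    let J : ℕ → ℕ := fun k => pick (σ.S 0).1 (σ.S 0).2 (ω (σ.pos + k))
    (∀ a, a ≠ 4 → σ'.R a = σ.R a) ∧ (∀ a, a ≠ 2 → a ≠ 4 → a ≠ 5 → σ'.N a = σ.N a) ∧
    σ'.pos = σ.pos + m ∧
    (∀ i < σ.N 0 0, σ'.R 4 i = σ.R 4 i + ∑ k ∈ Finset.range m, infl lam (scaledEst lam
      (σ.R 0 (i * σ.N 0 1 + J k)) (σ.R 5 (J k)) (σ.R 7 (J k)) (σ.R 6 1) (σ.R 6 2))) ∧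
    σ'.time ≤ σ.time + m * (200 * (σ.N 0 0) + 20) + 30 := by
  intro σ' lam J
  have hc := samplesExp_cost p
  have := exec_loop (ω := ω) (a := 4) (e := Prog.samplesExp p) (σ := σ)
    (c := .seq (.draw 0 5 (.const 0)) Prog.addSample)
    (m := m)
    (fun k τ => (∀ a, a ≠ 4 → τ.R a = σ.R a) ∧ (∀ a, a ≠ 2 → a ≠ 4 → a ≠ 5 → τ.N a = σ.N a) ∧
      τ.S = σ.S ∧ τ.pos = σ.pos + k ∧
      (∀ i < σ.N 0 0, τ.R 4 i = σ.R 4 i + ∑ k ∈ Finset.range k, infl lam (scaledEst lam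
        (σ.R 0 (i * σ.N 0 1 + J k)) (σ.R 5 (J k)) (σ.R 7 (J k)) (σ.R 6 1) (σ.R 6 2))) ∧
      τ.time ≤ σ.time + k * (200 * (σ.N 0 0) + 20) + 30)
    (by rw [samplesExp_eval, hm])
    (by simp only [Store.tick]; simp; omega)
    (by
      rintro k hk τ ⟨h1, h2, h3, h4, h5, h6⟩
      rw [Cmd.exec]
      set τ' := (Cmd.draw 0 5 (.const 0)).exec ω ((τ.setN 4 0 k).tick 1) with hτ'
      obtain ⟨g1, g2, g3, g4, g5, g6⟩ := addSample_spec ω τ'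
      have e1 : τ'.R = τ.R := rfl
      have e2 : ∀ a, a ≠ 4 → a ≠ 5 → τ'.N a = τ.N a := fun a ha hb => by
        simp [hτ', Cmd.exec, Store.tick, Store.setN, ha, hb]
      have e3 : τ'.S = τ.S := rfl
      have e4 : τ'.pos = τ.pos + 1 := rfl
      have e5 : τ'.N 5 0 = J k := by
        simp [hτ', Cmd.exec, Store.tick, Store.setN, NExp.eval, J, h3, h4]
      have e6 : τ'.time = τ.time + 3 := rfl
      have e0 : τ'.N 0 = σ.N 0 := by
        rw [e2 0 (by decide) (by decide), h2 0 (by decide) (by decide) (by decide)]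
      refine ⟨fun a ha => by rw [g1 a ha, e1, h1 a ha], fun a ha hb hc => ?_,
        by rw [g3, e3, h3], by rw [g4, e4, h4, add_assoc], fun i hi => ?_, ?_⟩
      · rw [g2 a ha, e2 a hb hc, h2 a ha hb hc]
      · rw [g5 i (by rwa [e0]), Finset.sum_range_succ, e5, e0, e1, h5 i hi, add_assoc,
          h1 0 (by decide), h1 2 (by decide), h1 5 (by decide), h1 6 (by decide),
          h1 7 (by decide)]
      · rw [e0, e6] at g6
        rw [Nat.succ_mul]
        omega)
  obtain ⟨h1, h2, -, h4, h5, h6⟩ := this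
  exact ⟨h1, h2, h4, h5, h6⟩

theorem reset_spec (ω : ℕ → ℝ) (σ : Store) :
    let σ' := Prog.reset.exec ω σ
    (∀ a, a ≠ 5 → σ'.R a = σ.R a) ∧ (∀ a, a ≠ 3 → σ'.N a = σ.N a) ∧ σ'.pos = σ.pos ∧
    (∀ j < σ.N 0 1, σ'.R 5 j = 0) ∧ σ'.time ≤ σ.time + 10 * σ.N 0 1 + 10 := by
  intro σ'
  exact exec_loop (ω := ω) (a := 3) (e := .ofNat Prog.cols) (σ := σ)
    (c := .setR 5 (Prog.reg 3) (.const 0)) (m := σ.N 0 1)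
    (fun k τ => (∀ a, a ≠ 5 → τ.R a = σ.R a) ∧ (∀ a, a ≠ 3 → τ.N a = σ.N a) ∧ τ.pos = σ.pos ∧
      (∀ j < k, τ.R 5 j = 0) ∧ τ.time ≤ σ.time + 10 * k + 10)
    (by simp [RExp.eval, NExp.eval, Prog.cols])
    (by simp [Store.tick, RExp.cost, NExp.cost, Prog.cols])
    (by
      rintro k hk τ ⟨h1, h2, h3, h4, h5⟩
      simp only [Cmd.exec, Store.tick, Store.setN, Store.setR, NExp.eval, RExp.eval, Prog.reg,
        NExp.cost, RExp.cost]
      refine ⟨fun a ha => ?_, fun a ha => ?_, h3, fun j hj => ?_, ?_⟩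
      · simp [ha, h1]
      · simp [ha, h2]
      · rcases (Nat.lt_succ_iff_lt_or_eq.1 hj) with hj | rfl
        · simp [hj.ne, h4 j hj]
        · simp
      · omega)

/-- The state of the data structure between two queries. -/
structure Inv {n d : ℕ} (A : Fin n → Vec d) (R ε L : ℝ) (est : Fin n → ℝ) (D : Vec d) (pos : ℕ)
    (σ : Store) : Prop where
  rows : σ.N 0 0 = n
  cols : σ.N 0 1 = d
  entry : ∀ i : Fin n, ∀ j : Fin d, σ.R 0 (i * d + j) = A i j
  radius : σ.R 2 0 = R
  accuracy : σ.R 2 1 = ε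
  logFactor : σ.R 6 0 = L
  est_eq : readEst n σ = est
  movement : ∀ j : Fin d, σ.R 5 j = D j
  pos_eq : σ.pos = pos

/-! ### Correctness and cost of one query -/

section Query

variable {n d : ℕ} (p : ℕ) (A : Fin n → Vec d) (R ε L : ℝ)

/-- The number of samples drawn in a refresh with movement `D`. -/
def sampleCount (D : Vec d) : ℕ := ⌈numSamples R ε L (pNorm p D)⌉₊

/-- The influence of the sampled column `j` on the estimate of row `i`. -/
def sampleInfl (D : Vec d) (i : Fin n) (j : Fin d) : ℝ :=
  infl (4 * L / ε) (scaledEst (4 * L / ε) (A i j) (D j) (wt p (D j)) (∑ k, wt p (D k))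
    (sampleCount p R ε L D))

/-- The influence of a sample as a function of the uniform number from which it is drawn. -/
def drawInfl [NeZero d] (D : Vec d) (i : Fin n) (u : ℝ) : ℝ :=
  sampleInfl p A R ε L D i (Fin.ofNat d (pick d (ofVec fun j => wt p (D j)) u))

variable {p A R ε L}

theorem pick_lt {m : ℕ} (hm : 0 < m) (w : ℕ → ℝ) (u : ℝ) : pick m w u < m := by
  unfold pick
  rcases {i | i < m ∧ u * ∑ j ∈ Finset.range m, |w j| <
    ∑ j ∈ Finset.range (i + 1), |w j|}.eq_empty_or_nonempty with h | h
  · rw [h, Nat.sInf_empty]; exact hm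
  · exact (Nat.sInf_mem h).1

theorem pick_congr {m : ℕ} {w w' : ℕ → ℝ} (h : ∀ j < m, w j = w' j) (u : ℝ) :
    pick m w u = pick m w' u := by
  unfold pick
  congr 1
  ext i
  refine and_congr_right fun hi => ?_
  have : ∀ k ≤ m, ∑ j ∈ Finset.range k, |w j| = ∑ j ∈ Finset.range k, |w' j| := fun k hk =>
    Finset.sum_congr rfl fun j hj => by rw [h j ((Finset.mem_range.1 hj).trans_le hk)]
  rw [this m le_rfl, this (i + 1) hi]

/-- The two branches are the lazy case and the refresh. The hypothesis `hm` ensures that the sample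
count, by which the terms are divided, has been written. -/
theorem query_spec (hp : p = 1 ∨ p = 2) [NeZero d] {est : Fin n → ℝ} {D : Vec d} {pos : ℕ}
    {σ : Store} (h : Inv A R ε L est D pos σ) (ω : ℕ → ℝ) (Δ : Vec d)
    (hm : ε / 2 < pNorm p (D + Δ) → 0 < sampleCount p R ε L (D + Δ)) :
    let σ' := (sketch p).runQuery ω σ Δ
    (pNorm p (D + Δ) ≤ ε / 2 → Inv A R ε L est (D + Δ) pos σ' ∧ σ'.N 1 0 = 0 ∧
      σ'.time ≤ σ.time + 100 * d) ∧
    (ε / 2 < pNorm p (D + Δ) →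
      Inv A R ε L (fun i => est i + ∑ k ∈ Finset.range (sampleCount p R ε L (D + Δ)),
        drawInfl p A R ε L (D + Δ) i (ω (pos + k))) 0 (pos + sampleCount p R ε L (D + Δ)) σ' ∧
      σ'.N 1 0 = 1 ∧ σ'.time ≤ σ.time + 300 * d +
        sampleCount p R ε L (D + Δ) * (200 * n + 200)) := by
  have hd : 0 < d := NeZero.pos d
  intro σ'
  set σ1 := (Cmd.setR 6 (.const 1) (.const 0)).exec ω (loadQuery σ Δ) with hσ1
  set σ2 := (Prog.accum p).exec ω σ1 with hσ2
  have hσ' : σ' = (Cmd.ite (Prog.rootExp p (Prog.cell 6 1)) (.div (Prog.cell 2 1) (.const 2)) .skip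
    (Prog.refresh p)).exec ω σ2 := rfl
  have a0 : ∀ a, a ≠ 3 → a ≠ 6 → σ1.R a = σ.R a := fun a ha hb => by
    simp [hσ1, Cmd.exec, Store.tick, Store.setN, Store.setR, loadQuery, ha, hb]
  have a1 : ∀ j : Fin d, σ1.R 3 j = Δ j := fun j => by
    simp [hσ1, Cmd.exec, Store.tick, Store.setN, Store.setR, loadQuery]
  have a2 : σ1.R 6 0 = σ.R 6 0 := by
    simp [hσ1, Cmd.exec, Store.tick, Store.setN, Store.setR, loadQuery, NExp.eval]
  have a3 : σ1.R 6 1 = 0 := by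
    simp [hσ1, Cmd.exec, Store.tick, Store.setN, Store.setR, loadQuery, NExp.eval, RExp.eval]
  have a4 : ∀ a, a ≠ 1 → σ1.N a = σ.N a := fun a ha => by
    simp [hσ1, Cmd.exec, Store.tick, Store.setN, Store.setR, loadQuery, ha]
  have a5 : σ1.N 1 0 = 0 := by
    simp [hσ1, Cmd.exec, Store.tick, Store.setN, Store.setR, loadQuery]
  have a6 : σ1.pos = σ.pos := rfl
  have a7 : σ1.time = σ.time + 3 := rfl
  have a8 : σ1.N 0 1 = d := by rw [a4 0 (by decide), h.cols]
  obtain ⟨b1, b2, b3, b4, b5, b6, b7, b8⟩ := accum_spec p ω σ1 a3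
  rw [← hσ2] at b1 b2 b3 b4 b5 b6 b7 b8
  rw [a8] at b4 b5 b7 b8
  have hmov : ∀ j : Fin d, σ1.R 5 j + σ1.R 3 j = (D + Δ) j := fun j => by
    rw [a1, a0 5 (by decide) (by decide), h.movement]; rfl
  have hW : σ2.R 6 1 = ∑ j, wt p ((D + Δ) j) := by
    rw [b7, Finset.sum_range]
    exact Finset.sum_congr rfl fun j _ => by rw [hmov]
  have hroot : rootWt p (σ2.R 6 1) = pNorm p (D + Δ) := by rw [hW, ← pNorm_eq_rootWt hp]
  have hI2 : Inv A R ε L est (D + Δ) pos σ2 :=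
    { rows := by rw [b2 0 (by decide), a4 0 (by decide), h.rows]
      cols := by rw [b2 0 (by decide), a8]
      entry := fun i j => by
        rw [b1 0 (by decide) (by decide) (by decide), a0 0 (by decide) (by decide), h.entry]
      radius := by
        rw [b1 2 (by decide) (by decide) (by decide), a0 2 (by decide) (by decide), h.radius]
      accuracy := by
        rw [b1 2 (by decide) (by decide) (by decide), a0 2 (by decide) (by decide), h.accuracy]
      logFactor := by rw [b6, a2, h.logFactor]
      est_eq := by
        rw [← h.est_eq]
        funext i
        simp only [readEst]
        rw [b1 4 (by decide) (by decide) (by decide), a0 4 (by decide) (by decide)]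
      movement := fun j => by rw [b4 j j.2, hmov]
      pos_eq := by rw [b3, a6, h.pos_eq] }
  have hcost : (Prog.rootExp p (Prog.cell 6 1)).cost ≤ 3 := by
    simpa [RExp.cost, NExp.cost, Prog.cell] using rootExp_cost p (Prog.cell 6 1)
  set c := (Prog.rootExp p (Prog.cell 6 1)).cost + (RExp.div (Prog.cell 2 1) (.const 2)).cost + 1
    with hc
  have hc10 : c ≤ 10 := by
    simp [hc, RExp.cost, NExp.cost, Prog.cell] at hcost ⊢; omega
  have hcond : ((Prog.rootExp p (Prog.cell 6 1)).eval σ2 ≤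
      (RExp.div (Prog.cell 2 1) (.const 2)).eval σ2) ↔ pNorm p (D + Δ) ≤ ε / 2 := by
    rw [rootExp_eval]
    simp only [Prog.cell, RExp.eval, NExp.eval]
    rw [hroot, hI2.accuracy]
    norm_num
  refine ⟨fun hle => ?_, fun hlt => ?_⟩
  · have : σ' = (σ2.tick c).tick 1 := by
      rw [hσ', Cmd.exec, if_pos (hcond.2 hle), Cmd.exec]
    rw [this]
    refine ⟨⟨hI2.rows, hI2.cols, hI2.entry, hI2.radius, hI2.accuracy, hI2.logFactor, hI2.est_eq,
      hI2.movement, hI2.pos_eq⟩, ?_, ?_⟩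
    · change σ2.N 1 0 = 0
      rw [b2 1 (by decide), a5]
    · change σ2.time + c + 1 ≤ _
      omega
  · have hσ3 : σ' = (Prog.refresh p).exec ω (σ2.tick c) := by
      rw [hσ', Cmd.exec, if_neg (mt hcond.1 (not_le.2 hlt))]
    set m := sampleCount p R ε L (D + Δ) with hmdef
    set σ4 := (Cmd.prep 0 7 Prog.cols).exec ω (σ2.tick c) with hσ4
    set σ5 := (Prog.count p).exec ω σ4 with hσ5
    set σ6 := (Prog.sample p).exec ω σ5 with hσ6
    set σ7 := Prog.reset.exec ω σ6 with hσ7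
    have hσ8 : σ' = (Cmd.setN 1 (.const 0) (.const 1)).exec ω σ7 := hσ3
    have c1 : σ4.R = σ2.R := rfl
    have c2 : σ4.N = σ2.N := rfl
    have c3 : σ4.pos = σ2.pos := rfl
    have c4 : σ4.S 0 = (d, σ2.R 7) := by
      rw [hσ4, Cmd.exec]
      simp only [Function.update_self]
      have : Prog.cols.eval (σ2.tick c) = d := hI2.cols
      rw [this]; rfl
    have c5 : σ4.time = σ2.time + c + (2 + d + 1) := by
      have : Prog.cols.eval (σ2.tick c) = d := hI2.cols
      rw [hσ4, Cmd.exec, this]; rfl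
    have hm4 : ⌈numSamples (σ4.R 2 0) (σ4.R 2 1) (σ4.R 6 0) (rootWt p (σ4.R 6 1))⌉₊ = m := by
      rw [c1, hroot, hI2.radius, hI2.accuracy, hI2.logFactor, hmdef, sampleCount]
    obtain ⟨d1, d2, d3, d4, d5, d6, d7⟩ := count_spec p ω σ4 hm4
    rw [← hσ5] at d1 d2 d3 d4 d5 d6 d7
    have hm5 : ⌈numSamples (σ5.R 2 0) (σ5.R 2 1) (σ5.R 6 0) (rootWt p (σ5.R 6 1))⌉₊ = m := by
      rw [d1 2 (by decide), d5 0 (by decide), d5 1 (by decide), hm4]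
    obtain ⟨e1, e2, e3, e4, e5⟩ := sample_spec p ω σ5 hm5
    rw [← hσ6] at e1 e2 e3 e4 e5
    obtain ⟨f1, f2, f3, f4, f5⟩ := reset_spec ω σ6
    rw [← hσ7] at f1 f2 f3 f4 f5
    have r0 : ∀ a, a ≠ 4 → a ≠ 5 → a ≠ 6 → σ'.R a = σ2.R a := fun a h4 h5 h6 => by
      rw [← c1, ← d1 a h6, ← e1 a h4, ← f1 a h5, hσ8]; rfl
    have r6 : ∀ k, k ≠ 2 → σ5.R 6 k = σ2.R 6 k := fun k hk => by rw [d5 k hk, c1]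
    have n0 : ∀ a, a ≠ 2 → a ≠ 3 → a ≠ 4 → a ≠ 5 → σ7.N a = σ2.N a :=
      fun a h2 h3 h4 h5 => by rw [f2 a h3, e2 a h2 h4 h5, d2 a h4, c2]
    have n5 : σ5.N 0 = σ2.N 0 := by rw [d2 0 (by decide), c2]
    have n6 : σ6.N 0 = σ2.N 0 := by rw [e2 0 (by decide) (by decide) (by decide), n5]
    have n8 : σ'.N 0 = σ2.N 0 := by
      rw [← n0 0 (by decide) (by decide) (by decide) (by decide), hσ8]
      rfl
    rw [n6, hI2.cols] at f4 f5
    rw [n5, hI2.rows, hI2.cols] at e4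
    rw [n5, hI2.rows] at e5
    refine ⟨⟨by rw [n8, hI2.rows], by rw [n8, hI2.cols], fun i j => ?_, ?_, ?_, ?_, ?_,
      fun j => ?_, ?_⟩, ?_, ?_⟩
    · rw [r0 0 (by decide) (by decide) (by decide), hI2.entry]
    · rw [r0 2 (by decide) (by decide) (by decide), hI2.radius]
    · rw [r0 2 (by decide) (by decide) (by decide), hI2.accuracy]
    · rw [← hI2.logFactor, ← r6 0 (by decide), ← e1 6 (by decide), ← f1 6 (by decide), hσ8]; rfl
    · funext i
      have g1 : readEst n σ' i = σ6.R 4 i := by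
        rw [← f1 4 (by decide), hσ8]; rfl
      have g2 : σ5.R 4 i = est i := by
        rw [d1 4 (by decide), c1, ← hI2.est_eq]; rfl
      have g3 : σ5.pos = pos := by rw [d4, c3, hI2.pos_eq]
      rw [g1, e4 i i.2, g2, g3]
      congr 1
      refine Finset.sum_congr rfl fun k _ => ?_
      rw [d3, c4, d6 (hm hlt), r6 0 (by decide), r6 1 (by decide), hI2.logFactor,
        d1 2 (by decide), d1 0 (by decide), d1 5 (by decide), d1 7 (by decide), c1,
        hI2.accuracy, hW]
      -- Cells of the weight array beyond `d` are not controlled, but `pick d` never reads them.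
      have hpick : pick d (σ2.R 7) (ω (pos + k)) =
          pick d (ofVec fun j => wt p ((D + Δ) j)) (ω (pos + k)) :=
        pick_congr (fun j hj => by
          have := hmov ⟨j, hj⟩
          rw [b5 j hj, ofVec, dif_pos hj, ← this]) _
      obtain ⟨J, hJ⟩ : ∃ J : Fin d, pick d (ofVec fun j => wt p ((D + Δ) j)) (ω (pos + k)) = J :=
        ⟨⟨_, pick_lt hd _ _⟩, rfl⟩
      simp only [drawInfl, sampleInfl, hpick, hJ]
      rw [b5 J J.2, hmov, hI2.entry, hI2.movement, ← hmdef]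
      simp
    · change σ'.R 5 j = 0
      rw [hσ8]
      exact f4 j j.2
    · rw [← hI2.pos_eq, ← c3, ← d4, ← e3, ← f3, hσ8]; rfl
    · rw [hσ8]; simp [Cmd.exec, Store.setN, Store.tick, NExp.eval]
    · have : σ'.time = σ7.time + 3 := by rw [hσ8]; rfl
      have hexp : m * (200 * n + 200) = m * (200 * n + 20) + m * 180 := by ring
      rw [hexp]
      have hm0 := hm hlt
      omega

end Query

/-! ### Correctness and cost of the initialization -/

section Init

variable {n d : ℕ}

/-- The logarithmic factor in the number of samples. -/
def logFactor (n : ℕ) (R ε δ : ℝ) : ℝ := Real.log (4 * (n * R) / (ε * δ))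

theorem initStore_entry (A : Fin n → Vec d) (x₀ : Vec d) (R ε δ : ℝ) (i : Fin n) (j : Fin d) :
    (initStore A x₀ R ε δ).R 0 (i * d + j) = A i j := by
  have hd : 0 < d := j.pos
  have hlt : (i * d + j : ℕ) < n * d := by
    have : (i + 1 : ℕ) * d ≤ n * d := Nat.mul_le_mul_right d i.2
    rw [Nat.succ_mul] at this
    have := j.2
    omega
  simp only [initStore, if_true, ofVec, dif_pos hlt]
  congr 2
  · refine Fin.ext ?_
    simp only [Fin.coe_divNat]
    rw [add_comm, Nat.add_mul_div_right _ _ hd, Nat.div_eq_of_lt j.2, zero_add]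
  · refine Fin.ext ?_
    simp only [Fin.coe_modNat]
    rw [add_comm, Nat.add_mul_mod_self_right, Nat.mod_eq_of_lt j.2]

theorem init_spec (p : ℕ) (A : Fin n → Vec d) (x₀ : Vec d) (R ε δ : ℝ) (ω : ℕ → ℝ) :
    let σ' := (sketch p).runInit ω A x₀ R ε δ
    Inv A R ε (logFactor n R ε δ) (fun i => ∑ j, A i j * x₀ j) 0 0 σ' ∧
      σ'.time ≤ n * (30 * d + 10) + 30 := by
  intro σ'
  set σ1 := (Cmd.setR 6 (.const 0) (.log (.div (.mul (.const 4) (.mul (.ofNat Prog.rows)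
    (Prog.cell 2 0))) (.mul (Prog.cell 2 1) (Prog.cell 2 2))))).exec ω
      (initStore A x₀ R ε δ) with hσ1
  have a0 : σ1.R 6 0 = logFactor n R ε δ := by
    simp [hσ1, Cmd.exec, Store.tick, Store.setR, NExp.eval, RExp.eval, Prog.cell, Prog.rows,
      Prog.reg, initStore, ofVec, logFactor]
  have a1 : ∀ a, a ≠ 6 → σ1.R a = (initStore A x₀ R ε δ).R a := fun a ha => by
    simp [hσ1, Cmd.exec, Store.tick, Store.setR, ha]
  have a2 : σ1.N 0 0 = n := by
    simp [hσ1, Cmd.exec, Store.tick, Store.setR, initStore]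
  have a3 : σ1.N 0 1 = d := by
    simp [hσ1, Cmd.exec, Store.tick, Store.setR, initStore]
  have a4 : σ1.pos = 0 := rfl
  have a5 : σ1.time ≤ 25 := by
    simp [hσ1, Cmd.exec, Store.tick, Store.setR, initStore, NExp.cost, RExp.cost, Prog.cell,
      Prog.rows, Prog.reg]
  have a6 : ∀ j, σ1.R 4 j = 0 := fun j => by rw [a1 4 (by decide)]; simp [initStore]
  have a7 : ∀ j, σ1.R 5 j = 0 := fun j => by rw [a1 5 (by decide)]; simp [initStore]
  have inner : ∀ σ : Store, ∀ i, σ.N 2 0 = i →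
      let τ := (Cmd.loop 3 (.ofNat Prog.cols) (.setR 4 (Prog.reg 2) (.add (.get 4 (Prog.reg 2))
        (.mul (.get 0 (.add (.mul (Prog.reg 2) Prog.cols) (Prog.reg 3)))
          (.get 1 (Prog.reg 3)))))).exec ω σ
      (∀ a, a ≠ 4 → τ.R a = σ.R a) ∧ (∀ a, a ≠ 3 → τ.N a = σ.N a) ∧ τ.pos = σ.pos ∧
        (∀ k, k ≠ i → τ.R 4 k = σ.R 4 k) ∧
        τ.R 4 i = σ.R 4 i + ∑ j ∈ Finset.range (σ.N 0 1),
          σ.R 0 (i * σ.N 0 1 + j) * σ.R 1 j ∧ τ.time ≤ σ.time + 30 * σ.N 0 1 + 8 := by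
    intro σ i hi
    refine exec_loop (m := σ.N 0 1) (fun k τ => (∀ a, a ≠ 4 → τ.R a = σ.R a) ∧
        (∀ a, a ≠ 3 → τ.N a = σ.N a) ∧ τ.pos = σ.pos ∧ (∀ k, k ≠ i → τ.R 4 k = σ.R 4 k) ∧
        τ.R 4 i = σ.R 4 i + ∑ j ∈ Finset.range k, σ.R 0 (i * σ.N 0 1 + j) * σ.R 1 j ∧
        τ.time ≤ σ.time + 30 * k + 8)
      (by simp [RExp.eval, NExp.eval, Prog.cols])
      (by simp [Store.tick, RExp.cost, NExp.cost, Prog.cols]) ?_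
    rintro k hk τ ⟨h1, h2, h3, h4, h5, h6⟩
    have h2' : τ.N 2 0 = i := by rw [h2 2 (by decide), hi]
    simp only [Cmd.exec, Store.tick, Store.setN, Store.setR, NExp.eval, RExp.eval, Prog.reg,
        NExp.cost, RExp.cost, Prog.cols]
    refine ⟨fun a ha => ?_, fun a ha => ?_, h3, fun j hj => ?_, ?_, ?_⟩
    · simp [ha, h1]
    · simp [ha, h2]
    · simp [h2', hj, h4]
    · simp [h2', h5, h1, h2, Finset.sum_range_succ, add_assoc]
    · omega
  have hσ' := exec_loop (ω := ω) (a := 2) (e := .ofNat Prog.rows) (σ := σ1)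
    (c := (Cmd.loop 3 (.ofNat Prog.cols) (.setR 4 (Prog.reg 2) (.add (.get 4 (Prog.reg 2))
        (.mul (.get 0 (.add (.mul (Prog.reg 2) Prog.cols) (Prog.reg 3)))
          (.get 1 (Prog.reg 3)))))))
    (m := n) (fun k τ => (∀ a, a ≠ 4 → τ.R a = σ1.R a) ∧
        (∀ a, a ≠ 2 → a ≠ 3 → τ.N a = σ1.N a) ∧ τ.pos = σ1.pos ∧
        (∀ i < k, τ.R 4 i = ∑ j ∈ Finset.range d, σ1.R 0 (i * d + j) * σ1.R 1 j) ∧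
        (∀ i ≥ k, τ.R 4 i = 0) ∧
        τ.time ≤ 30 + k * (30 * d + 10))
      (by simp [RExp.eval, NExp.eval, Prog.rows, Prog.reg, a2])
      (by simp [Store.tick, RExp.cost, NExp.cost, Prog.rows, Prog.reg, a6]; omega)
      (by
        rintro k hk τ ⟨h1, h2, h3, h4, h5, h6⟩
        obtain ⟨g1, g2, g3, g4, g5, g6⟩ := inner ((τ.setN 2 0 k).tick 1) k
          (by simp [Store.tick, Store.setN])
        have e0 : ((τ.setN 2 0 k).tick 1).R = τ.R := rfl
        have e1 : ∀ a, a ≠ 2 → ((τ.setN 2 0 k).tick 1).N a = τ.N a := fun a ha => by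
          simp [Store.tick, Store.setN, ha]
        have e2 : ((τ.setN 2 0 k).tick 1).time = τ.time + 1 := rfl
        have e3 : ((τ.setN 2 0 k).tick 1).N 0 1 = d := by
          rw [e1 0 (by decide), h2 0 (by decide) (by decide), a3]
        rw [e3, e0] at g5
        rw [e3, e2] at g6
        refine ⟨fun a ha => by rw [g1 a ha, e0, h1 a ha],
          fun a ha hb => by rw [g2 a hb, e1 a ha, h2 a ha hb], by rw [g3]; exact h3,
          fun i hi => ?_, fun i hi => ?_, ?_⟩
        · rcases (Nat.lt_succ_iff_lt_or_eq.1 hi) with hi | rfl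
          · rw [g4 i hi.ne, e0, h4 i hi]
          · rw [g5, h5 i le_rfl, h1 0 (by decide), h1 1 (by decide), zero_add]
        · rw [g4 i (by omega), e0, h5 i (by omega)]
        · rw [Nat.succ_mul]; omega)
  obtain ⟨h1, h2, h3, h4, -, h6⟩ := hσ'
  have h7 := initStore_entry A x₀ R ε δ
  change Inv _ _ _ _ _ _ _ (Cmd.exec ω (.loop 2 _ _) σ1) ∧
    (Cmd.exec ω (.loop 2 _ _) σ1).time ≤ _
  refine ⟨⟨by rw [h2 0 (by decide) (by decide), a2], by rw [h2 0 (by decide) (by decide), a3],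
    fun i j => by rw [h1 0 (by decide), a1 0 (by decide), h7],
    by rw [h1 2 (by decide), a1 2 (by decide)]; simp [initStore, ofVec],
    by rw [h1 2 (by decide), a1 2 (by decide)]; simp [initStore, ofVec],
    by rw [h1 6 (by decide), a0], ?_, fun j => by rw [h1 5 (by decide), a7]; rfl,
    by rw [h3, a4]⟩, by omega⟩
  funext i
  rw [readEst, h4 i i.2, Finset.sum_range]
  refine Finset.sum_congr rfl fun j _ => ?_
  rw [a1 0 (by decide), a1 1 (by decide), h7]
  simp [initStore, ofVec]

end Init

/-! ### The trajectory of the data structure -/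

section Trajectory

variable {n d : ℕ} (p : ℕ) (A : Fin n → Vec d) (x₀ : Vec d) (R ε L : ℝ) (Δ : ℕ → Vec d)

open Classical in
/-- The movement since the last refresh, before query `t`. -/
def move : ℕ → Vec d
  | 0 => 0
  | t + 1 => if ε / 2 < pNorm p (move t + Δ t) then 0 else move t + Δ t

/-- The movement at query `t`. -/
def moveAt (t : ℕ) : Vec d := move p ε Δ t + Δ t

/-- Query `t` leads to a refresh. -/
def Fires (t : ℕ) : Prop := ε / 2 < pNorm p (moveAt p ε Δ t)

open Classical in
/-- The number of samples drawn in query `t`. -/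
def samplesAt (t : ℕ) : ℕ :=
  if Fires p ε Δ t then sampleCount p R ε L (moveAt p ε Δ t) else 0

/-- The number of samples drawn before query `t`. -/
def posAt (t : ℕ) : ℕ := ∑ s ∈ Finset.range t, samplesAt p R ε L Δ s

/-- The estimate of row `i` before query `t`. -/
def estAt [NeZero d] (ω : ℕ → ℝ) (t : ℕ) (i : Fin n) : ℝ :=
  ∑ j, A i j * x₀ j + ∑ s ∈ Finset.range t, ∑ k ∈ Finset.range (samplesAt p R ε L Δ s),
    drawInfl p A R ε L (moveAt p ε Δ s) i (ω (posAt p R ε L Δ s + k))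

open Classical in
/-- A bound on the time of query `t`. -/
def timeAt (n : ℕ) (t : ℕ) : ℕ :=
  100 * d + if Fires p ε Δ t then
    300 * d + sampleCount p R ε L (moveAt p ε Δ t) * (200 * n + 200) else 0

variable {p A x₀ R ε L Δ}

theorem sampleCount_pos (hR : 0 < R) (hε : 0 < ε) (hL : 0 < L) {D : Vec d}
    (h : ε / 2 < pNorm p D) : 0 < sampleCount p R ε L D := by
  refine Nat.ceil_pos.2 ?_
  have : 0 < pNorm p D := (half_pos hε).trans h
  unfold numSamples
  positivity

/-- This separates execution from probability: the refresh times, sample counts and tape positions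
depend on `Δ` alone, and the tape enters only through the sampled columns in `estAt`. -/
theorem runQueries_spec [NeZero d] (hp : p = 1 ∨ p = 2) {δ : ℝ} (hR : 0 < R) (hε : 0 < ε)
    (hLdef : logFactor n R ε δ = L) (hL : 0 < L) (ω : ℕ → ℝ) (t : ℕ) :
    let s := (sketch p).runQueries ω A x₀ R ε δ Δ t
    Inv A R ε L (estAt p A x₀ R ε L Δ ω t) (move p ε Δ t) (posAt p R ε L Δ t) s.1 ∧
      s.2 = estAt p A x₀ R ε L Δ ω t ∧
      s.1.time ≤ n * (30 * d + 10) + 30 + ∑ k ∈ Finset.range t, timeAt p R ε L Δ n k := by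
  induction t with
  | zero =>
    have h := init_spec p A x₀ R ε δ ω
    rw [hLdef] at h
    have he : estAt p A x₀ R ε L Δ ω 0 = fun i => ∑ j, A i j * x₀ j := by
      funext i; simp [estAt]
    refine ⟨?_, ?_, ?_⟩
    · rw [he]; exact h.1
    · rw [he]; exact h.1.est_eq
    · simpa [DataStructure.runQueries] using h.2
  | succ t ih =>
    obtain ⟨h1, h2, h3⟩ := ih
    obtain ⟨q1, q2⟩ := query_spec hp h1 ω (Δ t) (sampleCount_pos hR hε hL)
    simp only [DataStructure.runQueries]
    rw [Finset.sum_range_succ]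
    have hest : ∀ i, estAt p A x₀ R ε L Δ ω (t + 1) i = estAt p A x₀ R ε L Δ ω t i +
        ∑ k ∈ Finset.range (samplesAt p R ε L Δ t),
          drawInfl p A R ε L (moveAt p ε Δ t) i (ω (posAt p R ε L Δ t + k)) := fun i => by
      rw [estAt, Finset.sum_range_succ, ← add_assoc]; rfl
    have hpos : posAt p R ε L Δ (t + 1) = posAt p R ε L Δ t + samplesAt p R ε L Δ t :=
      Finset.sum_range_succ _ _
    by_cases hf : Fires p ε Δ t
    · obtain ⟨g1, g2, g3⟩ := q2 hf
      have hs : samplesAt p R ε L Δ t = sampleCount p R ε L (moveAt p ε Δ t) := if_pos hf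
      have hI : Inv A R ε L (estAt p A x₀ R ε L Δ ω (t + 1)) (move p ε Δ (t + 1))
          (posAt p R ε L Δ (t + 1)) ((sketch p).runQuery ω
            ((sketch p).runQueries ω A x₀ R ε δ Δ t).1 (Δ t)) := by
        have hmv : move p ε Δ (t + 1) = 0 := if_pos hf
        rw [hmv, hpos, hs, funext hest, hs]
        exact g1
      refine ⟨hI, ?_, ?_⟩
      · rw [newEst, if_neg (by rw [g2]; decide)]
        exact hI.est_eq
      · rw [timeAt, if_pos hf]
        change _ ≤ _ + sampleCount p R ε L (moveAt p ε Δ t) * (200 * n + 200) at g3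
        omega
    · obtain ⟨g1, g2, g3⟩ := q1 (not_lt.1 hf)
      have hs : samplesAt p R ε L Δ t = 0 := if_neg hf
      have hmv : move p ε Δ (t + 1) = moveAt p ε Δ t := if_neg hf
      have hest' : estAt p A x₀ R ε L Δ ω (t + 1) = estAt p A x₀ R ε L Δ ω t := by
        funext i; rw [hest, hs]; simp
      rw [hmv, hpos, hs, hest', timeAt, if_neg hf]
      refine ⟨g1, ?_, by omega⟩
      rw [newEst, if_pos g2, h2]

theorem runQueries_flag [NeZero d] (hp : p = 1 ∨ p = 2) {δ : ℝ} (hR : 0 < R) (hε : 0 < ε)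
    (hLdef : logFactor n R ε δ = L) (hL : 0 < L) (ω : ℕ → ℝ) (t : ℕ) :
    ((sketch p).runQueries ω A x₀ R ε δ Δ (t + 1)).1.N 1 0 = 0 ↔ ¬ Fires p ε Δ t := by
  have h1 := (runQueries_spec (x₀ := x₀) (A := A) (Δ := Δ) hp hR hε hLdef hL ω t).1
  obtain ⟨q1, q2⟩ := query_spec hp h1 ω (Δ t) (sampleCount_pos hR hε hL)
  by_cases hf : Fires p ε Δ t
  · refine iff_of_false (fun h => ?_) (not_not.2 hf)
    have := (q2 hf).2.1
    exact absurd (this.symm.trans h) (by decide)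
  · exact iff_of_true (q1 (not_lt.1 hf)).2.1 hf

end Trajectory

/-! ### Concentration of the estimates -/

/-- For the sign `+` this is an equality. For `-` it follows from `(1 + y + y²)(1 - y + y²) = 1 + y²
+ y⁴ ≥ 1`. No bound on `y` is needed. -/
theorem exp_mul_infl_le {lam y s : ℝ} (hlam : lam ≠ 0) (hs : s = 1 ∨ s = -1) :
    Real.exp (s * (lam * infl lam y)) ≤ 1 + s * y + y ^ 2 := by
  have hpos : 0 < 1 + (y + y * y) := by nlinarith [sq_nonneg (y + 1 / 2)]
  have h1 : lam * infl lam y = Real.log (1 + (y + y * y)) := by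
    rw [infl, mul_div_cancel₀ _ hlam]
  rw [h1]
  rcases hs with rfl | rfl
  · rw [one_mul, Real.exp_log hpos]
    exact le_of_eq (by ring)
  · rw [neg_one_mul, Real.exp_neg, Real.exp_log hpos, inv_le_iff_one_le_mul₀ hpos]
    nlinarith [sq_nonneg y, sq_nonneg (y ^ 2)]

/-! ### Exponential moment of a single sample -/

section Mgf

variable {n d p : ℕ} {A : Fin n → Vec d} {R ε L : ℝ} [NeZero d]

theorem measurable_drawInfl (D : Vec d) (i : Fin n) : Measurable (drawInfl p A R ε L D i) :=
  (measurable_of_countable fun k : ℕ => sampleInfl p A R ε L D i (Fin.ofNat d k)).comp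
    (measurable_pick (w := fun _ => ofVec fun j => wt p (D j)) (fun _ => measurable_const)
      measurable_id)

/-- `exp_mul_infl_le` reduces the exponential moment to the first two moments of the scaled
estimate: the mean is `λ ⟨A i, D⟩ / m`, the second moment at most `λ² ‖D‖² / m²` by
`sum_sq_div_wt_le`. Then `1 + x ≤ exp x`. -/
theorem lintegral_exp_drawInfl_le (hp : p = 1 ∨ p = 2) {i : Fin n} (hA : dualNorm p (A i) ≤ 1)
    (hlam : 4 * L / ε ≠ 0) {D : Vec d} (hD : 0 < pNorm p D) {m : ℕ}
    (hmdef : sampleCount p R ε L D = m) (hm : 0 < m) {s : ℝ} (hs : s = 1 ∨ s = -1) :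
    ∫⁻ u, ENNReal.ofReal (Real.exp (s * (4 * L / ε * drawInfl p A R ε L D i u))) ∂uniform01 ≤
      ENNReal.ofReal (Real.exp (s * (4 * L / ε) * ((∑ j, A i j * D j) / m)
        + (4 * L / ε) ^ 2 * (pNorm p D ^ 2 / m ^ 2))) := by
  set lam := 4 * L / ε with hlamdef
  have hW := sum_wt_pos hp hD
  set W := ∑ j, wt p (D j) with hWdef
  set y : Fin d → ℝ := fun j => scaledEst lam (A i j) (D j) (wt p (D j)) W m with hy
  have hm' : (0 : ℝ) < m := Nat.cast_pos.2 hm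
  have habs : ∑ j ∈ Finset.range d, |ofVec (fun j => wt p (D j)) j| = W := by
    rw [sum_range_ofVec _ fun _ x => |x|]
    exact Finset.sum_congr rfl fun j _ => abs_of_nonneg (wt_nonneg _ _)
  have h1 := lintegral_pick (m := d) (w := ofVec fun j => wt p (D j)) (by rw [habs]; exact hW)
    (fun k => ENNReal.ofReal (Real.exp (s * (lam * sampleInfl p A R ε L D i (Fin.ofNat d k)))))
  have h2 : ∫⁻ u, ENNReal.ofReal (Real.exp (s * (lam * drawInfl p A R ε L D i u))) ∂uniform01 =
      ∑ j, ENNReal.ofReal (Real.exp (s * (lam * infl lam (y j)))) *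
        ENNReal.ofReal (wt p (D j) / W) := by
    refine h1.trans ?_
    rw [habs, Finset.sum_range]
    refine Finset.sum_congr rfl fun j _ => ?_
    have e1 : Fin.ofNat d (j : ℕ) = j := by simp
    have e2 : ofVec (fun j => wt p (D j)) (j : ℕ) = wt p (D j) := by simp [ofVec]
    rw [e1, e2, abs_of_nonneg (wt_nonneg _ _), sampleInfl, hmdef]
  rw [h2]
  have hwW : ∀ j, 0 ≤ wt p (D j) / W := fun j => div_nonneg (wt_nonneg _ _) hW.le
  have hq : ∀ j, 0 ≤ 1 + s * y j + y j ^ 2 := fun j =>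
    (Real.exp_pos _).le.trans (exp_mul_infl_le hlam hs)
  have h3 : ∑ j, ENNReal.ofReal (Real.exp (s * (lam * infl lam (y j)))) *
        ENNReal.ofReal (wt p (D j) / W) ≤
      ENNReal.ofReal (∑ j, (1 + s * y j + y j ^ 2) * (wt p (D j) / W)) := by
    rw [ENNReal.ofReal_sum_of_nonneg fun j _ => mul_nonneg (hq j) (hwW j)]
    refine Finset.sum_le_sum fun j _ => ?_
    rw [ENNReal.ofReal_mul (hq j)]
    gcongr
    exact exp_mul_infl_le hlam hs
  refine h3.trans (ENNReal.ofReal_le_ofReal ?_)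
  -- A coordinate of weight zero has `D j = 0`, so both sides vanish despite the division by the
  -- weight.
  have e1 : ∀ j, y j * (wt p (D j) / W) = lam * (A i j * D j / m) := fun j => by
    simp only [hy, scaledEst]
    rcases eq_or_ne (wt p (D j)) 0 with h | h
    · simp [eq_zero_of_wt h]
    · field_simp
  have e2 : ∀ j, y j ^ 2 * (wt p (D j) / W) =
      lam ^ 2 * (1 / m ^ 2 * (W * (A i j ^ 2 * D j ^ 2 / wt p (D j)))) := fun j => by
    simp only [hy, scaledEst]
    rcases eq_or_ne (wt p (D j)) 0 with h | h
    · simp [h]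
    · field_simp
  have e3 : ∑ j, (1 + s * y j + y j ^ 2) * (wt p (D j) / W) =
      1 + s * lam * ((∑ j, A i j * D j) / m) +
        lam ^ 2 * (1 / m ^ 2 * (W * ∑ j, A i j ^ 2 * D j ^ 2 / wt p (D j))) := by
    have : ∀ j, (1 + s * y j + y j ^ 2) * (wt p (D j) / W) = wt p (D j) / W +
        s * (lam * (A i j * D j / m)) +
        lam ^ 2 * (1 / m ^ 2 * (W * (A i j ^ 2 * D j ^ 2 / wt p (D j)))) := fun j => by
      rw [← e1, ← e2]; ring
    simp_rw [this, Finset.sum_add_distrib, ← Finset.mul_sum, ← Finset.sum_div, ← hWdef]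
    rw [div_self hW.ne', mul_assoc s lam]
  rw [e3]
  have h4 := sum_sq_div_wt_le hp hA D
  rw [← hWdef] at h4
  have h5 : lam ^ 2 * (1 / m ^ 2 * (W * ∑ j, A i j ^ 2 * D j ^ 2 / wt p (D j))) ≤
      lam ^ 2 * (pNorm p D ^ 2 / m ^ 2) := by
    rw [one_div_mul_eq_div]
    gcongr
  have h6 := Real.add_one_le_exp (s * lam * ((∑ j, A i j * D j) / m)
        + lam ^ 2 * (pNorm p D ^ 2 / m ^ 2))
  linarith

end Mgf

/-! ### Error and time over a whole sequence of queries -/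

section Trajectory

variable {n d p : ℕ} {A : Fin n → Vec d} {x₀ : Vec d} {R ε L : ℝ} {Δ : ℕ → Vec d}

open Classical in
/-- The refreshes among the first `t` queries. -/
def fired (p : ℕ) (ε : ℝ) (Δ : ℕ → Vec d) (t : ℕ) : Finset ℕ :=
  (Finset.range t).filter (Fires p ε Δ)

theorem fired_succ_of_fires {t : ℕ} (h : Fires p ε Δ t) :
    fired p ε Δ (t + 1) = insert t (fired p ε Δ t) := by
  rw [fired, Finset.range_add_one, Finset.filter_insert, if_pos h]; rfl

theorem fired_succ_of_not_fires {t : ℕ} (h : ¬ Fires p ε Δ t) :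
    fired p ε Δ (t + 1) = fired p ε Δ t := by
  rw [fired, Finset.range_add_one, Finset.filter_insert, if_neg h]; rfl

theorem notMem_fired (t : ℕ) : t ∉ fired p ε Δ t := by simp [fired]

theorem mem_fired {s t : ℕ} : s ∈ fired p ε Δ t ↔ s < t ∧ Fires p ε Δ s := by simp [fired]

/-- Triangle inequality, charging each query to the refresh that absorbs it. The norm of the pending
movement serves as the potential that closes the induction. -/
theorem sum_pNorm_fired_add_le (hp : p = 1 ∨ p = 2) (t : ℕ) :
    ∑ s ∈ fired p ε Δ t, pNorm p (moveAt p ε Δ s) + pNorm p (move p ε Δ t) ≤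
      ∑ s ∈ Finset.range t, pNorm p (Δ s) := by
  induction t with
  | zero => simp [fired, move, pNorm_zero hp]
  | succ t ih =>
    rw [Finset.sum_range_succ]
    have h1 := pNorm_add_le hp (move p ε Δ t) (Δ t)
    by_cases h : Fires p ε Δ t
    · rw [fired_succ_of_fires h, Finset.sum_insert (notMem_fired t)]
      have : move p ε Δ (t + 1) = 0 := if_pos h
      rw [this, pNorm_zero hp, moveAt]
      linarith
    · rw [fired_succ_of_not_fires h]
      have : move p ε Δ (t + 1) = move p ε Δ t + Δ t := if_neg h
      rw [this]
      linarith

theorem sum_pNorm_fired_le (hp : p = 1 ∨ p = 2) (t : ℕ) :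
    ∑ s ∈ fired p ε Δ t, pNorm p (moveAt p ε Δ s) ≤ ∑ s ∈ Finset.range t, pNorm p (Δ s) := by
  have := sum_pNorm_fired_add_le (ε := ε) (Δ := Δ) hp t
  have := pNorm_nonneg hp (move p ε Δ t)
  linarith

/-- Each refresh absorbs a movement of norm more than `ε / 2`. -/
theorem card_fired_le (hp : p = 1 ∨ p = 2) (hε : 0 < ε) {t : ℕ}
    (h : ∑ s ∈ Finset.range t, pNorm p (Δ s) ≤ R) : ((fired p ε Δ t).card : ℝ) ≤ 2 * (R / ε) := by
  have h1 : (fired p ε Δ t).card • (ε / 2) ≤ ∑ s ∈ fired p ε Δ t, pNorm p (moveAt p ε Δ s) :=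
    Finset.card_nsmul_le_sum _ _ _ fun s hs => (mem_fired.1 hs).2.le
  have h2 := sum_pNorm_fired_le (ε := ε) (Δ := Δ) hp t
  rw [nsmul_eq_mul] at h1
  rw [← mul_div_assoc, le_div_iff₀ hε]
  linarith

theorem sum_move_eq (t : ℕ) (j : Fin d) :
    ∑ s ∈ fired p ε Δ t, moveAt p ε Δ s j + move p ε Δ t j = ∑ s ∈ Finset.range t, Δ s j := by
  induction t with
  | zero => simp [fired, move]
  | succ t ih =>
    rw [Finset.sum_range_succ, ← ih]
    by_cases h : Fires p ε Δ t
    · rw [fired_succ_of_fires h, Finset.sum_insert (notMem_fired t)]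
      have : move p ε Δ (t + 1) = 0 := if_pos h
      rw [this, moveAt]
      simp only [Pi.add_apply, Pi.zero_apply]
      ring
    · rw [fired_succ_of_not_fires h]
      have : move p ε Δ (t + 1) = move p ε Δ t + Δ t := if_neg h
      rw [this, Pi.add_apply]
      ring

theorem pNorm_move_le (hp : p = 1 ∨ p = 2) (hε : 0 < ε) (t : ℕ) :
    pNorm p (move p ε Δ t) ≤ ε / 2 := by
  cases t with
  | zero => rw [move, pNorm_zero hp]; exact (half_pos hε).le
  | succ t =>
    by_cases h : Fires p ε Δ t
    · have : move p ε Δ (t + 1) = 0 := if_pos h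
      rw [this, pNorm_zero hp]; exact (half_pos hε).le
    · have : move p ε Δ (t + 1) = move p ε Δ t + Δ t := if_neg h
      rw [this]; exact not_lt.1 h

/-- This is the purpose of the sample size: the variance proxy of a refresh is proportional to its
movement, so the sum over all refreshes is governed by the total movement. -/
theorem div_sampleCount_le (hR : 0 < R) (hε : 0 < ε) (hL : 0 < L) {D : Vec d}
    (hD : 0 < pNorm p D) :
    pNorm p D ^ 2 / sampleCount p R ε L D ≤ pNorm p D * (ε ^ 2 / (16 * (R * L))) := by
  have h1 : numSamples R ε L (pNorm p D) ≤ sampleCount p R ε L D := Nat.le_ceil _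
  have h2 : 0 < numSamples R ε L (pNorm p D) := by unfold numSamples; positivity
  calc _ ≤ pNorm p D ^ 2 / numSamples R ε L (pNorm p D) := by gcongr
    _ = _ := by unfold numSamples; field_simp

/-- The accumulated sampling error of row `i`. -/
def samplingErr [NeZero d] (p : ℕ) (A : Fin n → Vec d) (R ε L : ℝ) (Δ : ℕ → Vec d) (ω : ℕ → ℝ)
    (t : ℕ) (i : Fin n) : ℝ :=
  ∑ s ∈ Finset.range t, ∑ k ∈ Finset.range (samplesAt p R ε L Δ s),
    drawInfl p A R ε L (moveAt p ε Δ s) i (ω (posAt p R ε L Δ s + k))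
  - ∑ s ∈ fired p ε Δ t, ∑ j, A i j * moveAt p ε Δ s j

/-- Distinct samples, also of different refreshes, read distinct tape cells and are therefore
independent. -/
theorem posAt_injective (t : ℕ) : Function.Injective
    fun x : (Σ s : Fin t, Fin (samplesAt p R ε L Δ s)) => posAt p R ε L Δ x.1 + x.2 := by
  have hmono : Monotone (posAt p R ε L Δ) :=
    monotone_nat_of_le_succ fun k => by simp [posAt, Finset.sum_range_succ]
  have key : ∀ x y : (Σ s : Fin t, Fin (samplesAt p R ε L Δ s)), x.1 < y.1 →
      posAt p R ε L Δ x.1 + x.2 < posAt p R ε L Δ y.1 + y.2 := by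
    intro x y h
    have h1 := hmono (show (x.1 : ℕ) + 1 ≤ y.1 from h)
    have h2 : posAt p R ε L Δ ((x.1 : ℕ) + 1) =
        posAt p R ε L Δ x.1 + samplesAt p R ε L Δ x.1 := Finset.sum_range_succ _ _
    have := x.2.2
    omega
  intro x y h
  rcases lt_trichotomy x.1 y.1 with hlt | heq | hlt
  · exact absurd h (key x y hlt).ne
  · obtain ⟨s, k⟩ := x
    obtain ⟨s', k'⟩ := y
    simp only at heq
    subst heq
    simp only [Nat.add_left_cancel_iff] at h
    rw [Fin.ext h]
  · exact absurd h (key y x hlt).ne'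

theorem sum_samples_eq [NeZero d] (ω : ℕ → ℝ) (t : ℕ) (F : ℕ → ℝ → ℝ) :
    ∑ x : (Σ s : Fin t, Fin (samplesAt p R ε L Δ s)), F x.1 (ω (posAt p R ε L Δ x.1 + x.2)) =
      ∑ s ∈ Finset.range t, ∑ k ∈ Finset.range (samplesAt p R ε L Δ s),
        F s (ω (posAt p R ε L Δ s + k)) := by
  rw [Fintype.sum_sigma, Finset.sum_range]
  refine Finset.sum_congr rfl fun s _ => ?_
  rw [Finset.sum_range]

/-- By independence the exponential moment is a product over all samples. The means cancel against
the subtracted `A D`, and the variance terms add up to at most `λ² R ε² / (16 R L) = L` for `λ = 4 L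
/ ε`. -/
theorem lintegral_exp_samplingErr_le [NeZero d] (hp : p = 1 ∨ p = 2) {i : Fin n}
    (hA : dualNorm p (A i) ≤ 1) (hR : 0 < R) (hε : 0 < ε) (hL : 0 < L) {t : ℕ}
    (h : ∑ s ∈ Finset.range t, pNorm p (Δ s) ≤ R) {σ : ℝ} (hσ : σ = 1 ∨ σ = -1) :
    ∫⁻ ω, ENNReal.ofReal (Real.exp (4 * L / ε * (σ * samplingErr p A R ε L Δ ω t i))) ∂tapeMeasure
      ≤ ENNReal.ofReal (Real.exp L) := by
  set lam := 4 * L / ε with hlam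
  have hlam0 : 0 < lam := by positivity
  set b : ℕ → ℝ := fun s => ∑ j, A i j * moveAt p ε Δ s j with hb
  set v : ℕ → ℝ := fun s => pNorm p (moveAt p ε Δ s) ^ 2 / samplesAt p R ε L Δ s ^ 2 with hv
  have hN : ∀ s, Fires p ε Δ s → 0 < pNorm p (moveAt p ε Δ s) := fun s hs =>
    (half_pos hε).trans hs
  have hcnt : ∀ s, Fires p ε Δ s →
      samplesAt p R ε L Δ s = sampleCount p R ε L (moveAt p ε Δ s) := fun s hs => if_pos hs
  have hpos : ∀ s, Fires p ε Δ s → 0 < samplesAt p R ε L Δ s := fun s hs => by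
    rw [hcnt s hs]; exact sampleCount_pos hR hε hL hs
  have hzero : ∀ s, ¬ Fires p ε Δ s → samplesAt p R ε L Δ s = 0 := fun s hs => if_neg hs
  have hsum : ∀ (F : ℕ → ℝ), ∑ s ∈ Finset.range t, (samplesAt p R ε L Δ s : ℝ) * F s =
      ∑ s ∈ fired p ε Δ t, (samplesAt p R ε L Δ s : ℝ) * F s := fun F => by
    refine (Finset.sum_subset (fun s hs => Finset.mem_range.2 (mem_fired.1 hs).1)
      fun s hs hs' => ?_).symm
    rw [hzero s fun hf => hs' (mem_fired.2 ⟨Finset.mem_range.1 hs, hf⟩)]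
    simp
  have h1 : ∀ ω : ℕ → ℝ, ENNReal.ofReal (Real.exp (lam * (σ * samplingErr p A R ε L Δ ω t i))) =
      (∏ x : (Σ s : Fin t, Fin (samplesAt p R ε L Δ s)), ENNReal.ofReal (Real.exp (σ * (lam *
        drawInfl p A R ε L (moveAt p ε Δ x.1) i (ω (posAt p R ε L Δ x.1 + x.2)))))) *
      ENNReal.ofReal (Real.exp (-(σ * lam * ∑ s ∈ fired p ε Δ t, b s))) := fun ω => by
    rw [← ENNReal.ofReal_prod_of_nonneg fun _ _ => (Real.exp_pos _).le, ← Real.exp_sum,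
      ← ENNReal.ofReal_mul (Real.exp_pos _).le, ← Real.exp_add,
      sum_samples_eq ω t fun s u => σ * (lam * drawInfl p A R ε L (moveAt p ε Δ s) i u),
      samplingErr]
    congr 2
    simp_rw [← Finset.mul_sum]
    rw [hb]
    ring
  have hme : ∀ x : (Σ s : Fin t, Fin (samplesAt p R ε L Δ s)), Measurable fun u =>
      ENNReal.ofReal (Real.exp (σ * (lam * drawInfl p A R ε L (moveAt p ε Δ x.1) i u))) :=
    fun x => (((measurable_drawInfl _ i).const_mul _).const_mul _).exp.ennreal_ofReal
  have hmp : Measurable fun ω : ℕ → ℝ => ∏ x : (Σ s : Fin t, Fin (samplesAt p R ε L Δ s)),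
      ENNReal.ofReal (Real.exp (σ * (lam * drawInfl p A R ε L (moveAt p ε Δ x.1) i
        (ω (posAt p R ε L Δ x.1 + x.2))))) :=
    Finset.measurable_fun_prod _ fun x _ => (hme x).comp (measurable_pi_apply _)
  simp_rw [h1]
  rw [lintegral_mul_const _ hmp, tapeMeasure,
    lintegral_prod_infinitePi uniform01 (posAt_injective t)
      (F := fun x u => ENNReal.ofReal (Real.exp (σ * (lam *
        drawInfl p A R ε L (moveAt p ε Δ x.1) i u)))) hme]
  have h2 : ∏ x : (Σ s : Fin t, Fin (samplesAt p R ε L Δ s)), ∫⁻ u, ENNReal.ofReal (Real.exp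
      (σ * (lam * drawInfl p A R ε L (moveAt p ε Δ x.1) i u))) ∂uniform01 ≤
      ∏ x : (Σ s : Fin t, Fin (samplesAt p R ε L Δ s)), ENNReal.ofReal (Real.exp
        (σ * lam * (b x.1 / samplesAt p R ε L Δ x.1) + lam ^ 2 * v x.1)) := by
    refine Finset.prod_le_prod' fun x _ => ?_
    -- A query without refresh draws no samples, so the existence of `x.2` forces a refresh.
    have hf : Fires p ε Δ x.1 := by
      by_contra hf
      have := x.2.pos
      rw [hzero _ hf] at this
      omega
    exact lintegral_exp_drawInfl_le hp hA hlam0.ne' (hN _ hf) (hcnt _ hf).symm (hpos _ hf) hσ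
  refine (mul_le_mul_left h2 _).trans ?_
  rw [← ENNReal.ofReal_prod_of_nonneg fun _ _ => (Real.exp_pos _).le, ← Real.exp_sum,
      ← ENNReal.ofReal_mul (Real.exp_pos _).le, ← Real.exp_add,
      sum_samples_eq (fun _ => 0) t fun s _ => σ * lam * (b s / samplesAt p R ε L Δ s)
        + lam ^ 2 * v s]
  refine ENNReal.ofReal_le_ofReal (Real.exp_le_exp.2 ?_)
  simp_rw [Finset.sum_const, Finset.card_range, nsmul_eq_mul]
  rw [hsum]
  have h3 : ∀ s ∈ fired p ε Δ t, (samplesAt p R ε L Δ s : ℝ) *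
      (σ * lam * (b s / samplesAt p R ε L Δ s) + lam ^ 2 * v s) ≤
      σ * lam * b s + lam ^ 2 * (pNorm p (moveAt p ε Δ s) * (ε ^ 2 / (16 * (R * L)))) := by
    intro s hs
    have hf := (mem_fired.1 hs).2
    have hm : (0 : ℝ) < samplesAt p R ε L Δ s := Nat.cast_pos.2 (hpos s hf)
    have h4 := div_sampleCount_le (p := p) hR hε hL (hN s hf)
    rw [← hcnt s hf] at h4
    have h5 : (samplesAt p R ε L Δ s : ℝ) *
      (σ * lam * (b s / samplesAt p R ε L Δ s) + lam ^ 2 * v s) = σ * lam * b s + lam ^ 2 *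
        (pNorm p (moveAt p ε Δ s) ^ 2 / samplesAt p R ε L Δ s) := by
      simp only [hv]; field_simp
    rw [h5]
    gcongr
  have h6 := Finset.sum_le_sum h3
  rw [Finset.sum_add_distrib, ← Finset.mul_sum, ← Finset.mul_sum, ← Finset.sum_mul] at h6
  have h7 := (sum_pNorm_fired_le (ε := ε) (Δ := Δ) hp t).trans h
  have h8 : lam ^ 2 * ((∑ s ∈ fired p ε Δ t, pNorm p (moveAt p ε Δ s)) *
      (ε ^ 2 / (16 * (R * L)))) ≤ lam ^ 2 * (R * (ε ^ 2 / (16 * (R * L)))) := by gcongr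
  have h9 : lam ^ 2 * (R * (ε ^ 2 / (16 * (R * L)))) = L := by
    rw [hlam]; field_simp; norm_num
  linarith

/-- Markov's inequality for the exponential moment: the threshold `ε / 2` corresponds to `λ ε / 2 =
2 L`, which leaves `exp L / exp (2 L)`. -/
theorem tapeMeasure_samplingErr_gt_le [NeZero d] (hp : p = 1 ∨ p = 2) {i : Fin n}
    (hA : dualNorm p (A i) ≤ 1) (hR : 0 < R) (hε : 0 < ε) (hL : 0 < L) {t : ℕ}
    (h : ∑ s ∈ Finset.range t, pNorm p (Δ s) ≤ R) {σ : ℝ} (hσ : σ = 1 ∨ σ = -1) :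
    tapeMeasure {ω | ε / 2 < σ * samplingErr p A R ε L Δ ω t i} ≤
      ENNReal.ofReal (Real.exp (-L)) := by
  have hmeas : Measurable fun ω => ENNReal.ofReal (Real.exp (4 * L / ε *
      (σ * samplingErr p A R ε L Δ ω t i))) := by
    refine (Measurable.const_mul (Measurable.const_mul (Measurable.sub_const ?_ _) _)
      _).exp.ennreal_ofReal
    exact Finset.measurable_fun_sum _ fun s _ => Finset.measurable_fun_sum _ fun k _ =>
      (measurable_drawInfl _ i).comp (measurable_pi_apply _)
  have h1 := mul_meas_ge_le_lintegral (μ := tapeMeasure) hmeas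
    (ENNReal.ofReal (Real.exp (2 * L)))
  have h2 := h1.trans (lintegral_exp_samplingErr_le hp hA hR hε hL h hσ)
  have h3 : ENNReal.ofReal (Real.exp L) =
      ENNReal.ofReal (Real.exp (2 * L)) * ENNReal.ofReal (Real.exp (-L)) := by
    rw [← ENNReal.ofReal_mul (Real.exp_pos _).le, ← Real.exp_add]
    congr 2; ring
  rw [h3] at h2
  have h4 := (ENNReal.mul_le_mul_iff_right
    (ENNReal.ofReal_pos.2 (Real.exp_pos (2 * L))).ne' ENNReal.ofReal_ne_top).1 h2
  refine (measure_mono fun ω hω => ?_).trans h4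
  refine ENNReal.ofReal_le_ofReal (Real.exp_le_exp.2 ?_)
  have h5 : 4 * L / ε * (ε / 2) = 2 * L := by field_simp; norm_num
  rw [← h5]
  exact mul_le_mul_of_nonneg_left (le_of_lt hω) (by positivity)

/-- The event that all refreshes among the first `T` queries are accurate. -/
def accurateEvent [NeZero d] (p : ℕ) (A : Fin n → Vec d) (R ε L : ℝ) (Δ : ℕ → Vec d)
    (T : ℕ) : Set (ℕ → ℝ) :=
  {ω | ∀ s ∈ fired p ε Δ T, ∀ i, |samplingErr p A R ε L Δ ω (s + 1) i| ≤ ε / 2}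

/-- Union bound over at most `2 R / ε` refreshes, `n` rows and two signs. -/
theorem tapeMeasure_compl_accurateEvent_le [NeZero d] (hp : p = 1 ∨ p = 2)
    (hA : ∀ i, dualNorm p (A i) ≤ 1) (hR : 0 < R) (hε : 0 < ε) (hL : 0 < L) {T : ℕ}
    (h : ∑ s ∈ Finset.range T, pNorm p (Δ s) ≤ R) :
    tapeMeasure (accurateEvent p A R ε L Δ T)ᶜ ≤
      ENNReal.ofReal (4 * (n * R) / ε * Real.exp (-L)) := by
  have hsub : (accurateEvent p A R ε L Δ T)ᶜ ⊆ ⋃ s ∈ fired p ε Δ T, ⋃ i ∈ Finset.univ,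
      ({ω | ε / 2 < 1 * samplingErr p A R ε L Δ ω (s + 1) i} ∪
        {ω | ε / 2 < -1 * samplingErr p A R ε L Δ ω (s + 1) i}) := by
    intro ω hω
    simp only [accurateEvent, Set.mem_compl_iff, Set.mem_ofPred_eq, not_forall, not_le] at hω
    obtain ⟨s, hs, i, hi⟩ := hω
    simp only [Set.mem_iUnion]
    refine ⟨s, hs, i, Finset.mem_univ i, ?_⟩
    rcases lt_abs.1 hi with hi | hi
    · exact Or.inl (by simpa using hi)
    · exact Or.inr (by simpa using hi)
  have hle : ∀ s ∈ fired p ε Δ T, ∑ r ∈ Finset.range (s + 1), pNorm p (Δ r) ≤ R := fun s hs =>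
    (Finset.sum_le_sum_of_subset_of_nonneg (Finset.range_mono (mem_fired.1 hs).1)
      fun _ _ _ => pNorm_nonneg hp _).trans h
  refine (measure_mono hsub).trans ?_
  calc _ ≤ ∑ s ∈ fired p ε Δ T, ∑ i : Fin n,
        (ENNReal.ofReal (Real.exp (-L)) + ENNReal.ofReal (Real.exp (-L))) := by
        refine (measure_biUnion_finset_le _ _).trans (Finset.sum_le_sum fun s hs => ?_)
        refine (measure_biUnion_finset_le _ _).trans (Finset.sum_le_sum fun i _ => ?_)
        refine (measure_union_le _ _).trans (add_le_add ?_ ?_)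
        · exact tapeMeasure_samplingErr_gt_le hp (hA i) hR hε hL (hle s hs) (Or.inl rfl)
        · exact tapeMeasure_samplingErr_gt_le hp (hA i) hR hε hL (hle s hs) (Or.inr rfl)
    _ = ENNReal.ofReal ((fired p ε Δ T).card * (n * (2 * Real.exp (-L)))) := by
        rw [← ENNReal.ofReal_add (Real.exp_pos _).le (Real.exp_pos _).le, ← two_mul]
        simp only [Finset.sum_const, Finset.card_univ, Fintype.card_fin, nsmul_eq_mul]
        rw [ENNReal.ofReal_mul (by positivity), ENNReal.ofReal_mul (by positivity)]
        simp
    _ ≤ _ := by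
        refine ENNReal.ofReal_le_ofReal ?_
        have h1 := card_fired_le hp hε h
        calc _ ≤ 2 * (R / ε) * (n * (2 * Real.exp (-L))) := by gcongr
          _ = _ := by ring

/-- The sampling error changes only at refreshes, so controlling it there controls it always; this
keeps `T` out of the union bound. -/
theorem abs_samplingErr_le_of_mem [NeZero d] (hε : 0 < ε) {T : ℕ} {ω : ℕ → ℝ}
    (hω : ω ∈ accurateEvent p A R ε L Δ T) {t : ℕ} (ht : t ≤ T) (i : Fin n) :
    |samplingErr p A R ε L Δ ω t i| ≤ ε / 2 := by
  induction t with
  | zero => simp [samplingErr, fired, (half_pos hε).le]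
  | succ t ih =>
    by_cases hf : Fires p ε Δ t
    · exact hω t (mem_fired.2 ⟨ht, hf⟩) i
    · have hs : samplesAt p R ε L Δ t = 0 := if_neg hf
      have : samplingErr p A R ε L Δ ω (t + 1) i = samplingErr p A R ε L Δ ω t i := by
        rw [samplingErr, samplingErr, fired_succ_of_not_fires hf, Finset.sum_range_succ, hs]
        simp
      rw [this]
      exact ih (by omega)

/-- The total error is the sampling error minus the contribution of the pending movement. The latter
is at most `ε / 2` by Hölder, since an unabsorbed movement has norm at most `ε / 2`. -/
theorem abs_estAt_sub_le [NeZero d] (hp : p = 1 ∨ p = 2) {i : Fin n} (hA : dualNorm p (A i) ≤ 1)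
    (hε : 0 < ε) {ω : ℕ → ℝ} {t : ℕ} (h : |samplingErr p A R ε L Δ ω t i| ≤ ε / 2) :
    |estAt p A x₀ R ε L Δ ω t i - ∑ j, A i j * (x₀ + ∑ s ∈ Finset.range t, Δ s) j| ≤ ε := by
  have h1 : estAt p A x₀ R ε L Δ ω t i - ∑ j, A i j * (x₀ + ∑ s ∈ Finset.range t, Δ s) j =
      samplingErr p A R ε L Δ ω t i - dot (A i) (move p ε Δ t) := by
    have h2 : ∑ j, A i j * (x₀ + ∑ s ∈ Finset.range t, Δ s) j = ∑ j, A i j * x₀ j +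
        (∑ s ∈ fired p ε Δ t, ∑ j, A i j * moveAt p ε Δ s j + dot (A i) (move p ε Δ t)) := by
      rw [dot_apply, Finset.sum_comm, ← Finset.sum_add_distrib, ← Finset.sum_add_distrib]
      refine Finset.sum_congr rfl fun j _ => ?_
      rw [← Finset.mul_sum, ← mul_add, ← mul_add, sum_move_eq, Pi.add_apply, Finset.sum_apply]
    rw [h2, estAt, samplingErr]
    ring
  rw [h1]
  have h3 := (abs_dot_le hp (A i) (move p ε Δ t)).trans
    (mul_le_mul hA (pNorm_move_le hp hε t) (pNorm_nonneg hp _) zero_le_one)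
  have := abs_sub (samplingErr p A R ε L Δ ω t i) (dot (A i) (move p ε Δ t))
  linarith

/-- The logarithmic factor is chosen so that the union bound equals `δ`. -/
theorem exp_neg_logFactor {δ : ℝ} (hn : 0 < n) (hR : 0 < R) (hε : 0 < ε) (hδ : 0 < δ) :
    4 * (n * R) / ε * Real.exp (-logFactor n R ε δ) = δ := by
  have hn' : (0 : ℝ) < n := Nat.cast_pos.2 hn
  rw [logFactor, Real.exp_neg, Real.exp_log (by positivity)]
  field_simp

theorem logFactor_pos {δ : ℝ} (hn : 0 < n) (hε : 0 < ε) (hR : ε ≤ R / 2) (hδ : 0 < δ)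
    (hδ1 : δ < 1) : 0 < logFactor n R ε δ := by
  have hn' : (1 : ℝ) ≤ n := Nat.one_le_cast.2 hn
  refine Real.log_pos ?_
  rw [one_lt_div (by positivity)]
  nlinarith

theorem sketch_isMVM (hp : p = 1 ∨ p = 2) : (sketch p).IsMVM p := by
  intro n d A x₀ R ε δ T Δ hn hd hA hε hR hδ hδ1 hsum
  have : NeZero d := ⟨hd.ne'⟩
  have hR0 : 0 < R := by linarith
  have hL := logFactor_pos hn hε hR hδ hδ1
  set L := logFactor n R ε δ with hLdef
  have h1 := tapeMeasure_compl_accurateEvent_le hp hA hR0 hε hL hsum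
  rw [hLdef, exp_neg_logFactor hn hR0 hε hδ, ← hLdef] at h1
  have hprob : tapeMeasure Set.univ = 1 := by unfold tapeMeasure; exact measure_univ
  -- Subadditivity on the event and its complement gives this without measurability of the event.
  have h2 : (1 : ℝ≥0∞) ≤ tapeMeasure (accurateEvent p A R ε L Δ T) + ENNReal.ofReal δ := by
    rw [← hprob, ← Set.union_compl_self (accurateEvent p A R ε L Δ T)]
    exact (measure_union_le _ _).trans (by gcongr)
  rw [ENNReal.ofReal_sub _ hδ.le, ENNReal.ofReal_one]
  refine (tsub_le_iff_right.2 h2).trans (measure_mono fun ω hω t ht i => ?_)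
  rw [(runQueries_spec (Δ := Δ) hp hR0 hε hLdef.symm hL ω (t + 1)).2.1]
  exact abs_estAt_sub_le hp (hA i) hε (abs_samplingErr_le_of_mem hε hω ht i)

theorem measurable_estAt [NeZero d] (t : ℕ) (i : Fin n) :
    Measurable fun ω => estAt p A x₀ R ε L Δ ω t i :=
  measurable_const.add (Finset.measurable_fun_sum _ fun _ _ => Finset.measurable_fun_sum _
    fun _ _ => (measurable_drawInfl _ i).comp (measurable_pi_apply _))

/-- Before rounding, the sample counts are linear in the movements and sum to at most `16 (R / ε)²
L`; rounding adds one per refresh, at most `2 R / ε` altogether. -/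
theorem sum_timeAt_le (hp : p = 1 ∨ p = 2) (hn : 0 < n) (hε : 0 < ε) (hR : 0 < R) (hL : 0 < L)
    {t : ℕ} (h : ∑ s ∈ Finset.range t, pNorm p (Δ s) ≤ R) :
    ((∑ k ∈ Finset.range t, timeAt p R ε L Δ n k : ℕ) : ℝ) ≤
      100 * (d * t) + 600 * (d * (R / ε)) + 400 * n * (16 * (R / ε) ^ 2 * L + 2 * (R / ε)) := by
  classical
  have h1 : ∑ k ∈ Finset.range t, timeAt p R ε L Δ n k = 100 * d * t + ∑ s ∈ fired p ε Δ t,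
      (300 * d + sampleCount p R ε L (moveAt p ε Δ s) * (200 * n + 200)) := by
    rw [fired, Finset.sum_filter]
    simp_rw [timeAt]
    rw [Finset.sum_add_distrib, Finset.sum_const, Finset.card_range, smul_eq_mul, mul_comm t]
  have hn' : (1 : ℝ) ≤ n := Nat.one_le_cast.2 hn
  have hcard := card_fired_le hp hε h
  have h2 : ∑ s ∈ fired p ε Δ t, (sampleCount p R ε L (moveAt p ε Δ s) : ℝ) ≤
      16 * (R / ε) ^ 2 * L + 2 * (R / ε) := by
    have h3 : ∀ s ∈ fired p ε Δ t, (sampleCount p R ε L (moveAt p ε Δ s) : ℝ) ≤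
        pNorm p (moveAt p ε Δ s) * (16 * (R * L) / (ε * ε)) + 1 := fun s _ => by
      have h0 : 0 ≤ numSamples R ε L (pNorm p (moveAt p ε Δ s)) := by
        have := pNorm_nonneg hp (moveAt p ε Δ s)
        unfold numSamples
        positivity
      refine (Nat.ceil_lt_add_one h0).le.trans (le_of_eq ?_)
      unfold numSamples
      ring
    refine (Finset.sum_le_sum h3).trans ?_
    rw [Finset.sum_add_distrib, ← Finset.sum_mul, Finset.sum_const, nsmul_eq_mul, mul_one]
    have h4 := (sum_pNorm_fired_le (ε := ε) (Δ := Δ) hp t).trans h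
    refine add_le_add ?_ hcard
    calc _ ≤ R * (16 * (R * L) / (ε * ε)) := by gcongr
      _ = _ := by field_simp
  rw [h1]
  push_cast
  rw [Finset.sum_add_distrib, Finset.sum_const, nsmul_eq_mul, ← Finset.sum_mul]
  have hS : 0 ≤ ∑ s ∈ fired p ε Δ t, (sampleCount p R ε L (moveAt p ε Δ s) : ℝ) := by positivity
  have hd' : (0 : ℝ) ≤ d := Nat.cast_nonneg d
  have h5 : ((fired p ε Δ t).card : ℝ) * (300 * d) ≤ 2 * (R / ε) * (300 * d) := by gcongr
  have h6 : (∑ s ∈ fired p ε Δ t, (sampleCount p R ε L (moveAt p ε Δ s) : ℝ)) * (200 * n + 200) ≤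
      (16 * (R / ε) ^ 2 * L + 2 * (R / ε)) * (400 * n) := by
    refine mul_le_mul h2 (by linarith) (by positivity) (by positivity)
  linarith

end Trajectory

/-! ### Rejection sampling -/

/-- The law of the two uniform numbers of an attempt. -/
def pairMeasure : Measure (Bool → ℝ) := Measure.infinitePi fun _ => uniform01

instance : IsProbabilityMeasure pairMeasure := by unfold pairMeasure; infer_instance

/-- The law of the uniform numbers of all attempts of an iteration. -/
def attemptMeasure : Measure (ℕ → Bool → ℝ) := Measure.infinitePi fun _ => pairMeasure

instance : IsProbabilityMeasure attemptMeasure := by unfold attemptMeasure; infer_instance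

theorem uniform01_Iio {a : ℝ} (h1 : a ≤ 1) :
    uniform01 (Set.Iio a) = ENNReal.ofReal a := by
  rw [uniform01, Measure.restrict_apply measurableSet_Iio]
  have : Set.Iio a ∩ Set.Icc 0 1 = Set.Ico 0 a := by
    ext x
    simp only [Set.mem_inter_iff, Set.mem_Iio, Set.mem_Icc, Set.mem_Ico]
    constructor
    · rintro ⟨h, h', -⟩; exact ⟨h', h⟩
    · rintro ⟨h', h⟩; exact ⟨h, h', h.le.trans h1⟩
  rw [this, Real.volume_Ico, sub_zero]

/-! ### First success in a sequence of independent trials -/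

section FirstHit

variable {β : Type*} [MeasurableSpace β] (ρ : Measure β) [IsProbabilityMeasure ρ]

theorem infinitePi_forall_lt_notMem {S : Set β} (hS : MeasurableSet S) (k : ℕ) :
    (Measure.infinitePi fun _ : ℕ => ρ) {u | ∀ j < k, u j ∉ S} = (ρ Sᶜ) ^ k := by
  have : {u : ℕ → β | ∀ j < k, u j ∉ S} = Set.pi (Finset.range k : Set ℕ) fun _ => Sᶜ := by
    ext u; simp [Set.mem_pi]
  rw [this, Measure.infinitePi_pi (fun _ : ℕ => ρ) fun _ _ => hS.compl]
  simp

theorem infinitePi_first_mem {S S' : Set β} (hS : MeasurableSet S) (hS' : MeasurableSet S')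
    (k : ℕ) : (Measure.infinitePi fun _ : ℕ => ρ) {u | (∀ j < k, u j ∉ S) ∧ u k ∈ S'} =
      (ρ Sᶜ) ^ k * ρ S' := by
  have : {u : ℕ → β | (∀ j < k, u j ∉ S) ∧ u k ∈ S'} =
      Set.pi (Finset.range (k + 1) : Set ℕ) fun j => if j < k then Sᶜ else S' := by
    ext u
    simp only [Set.mem_ofPred_eq, Set.mem_pi, Finset.coe_range, Set.mem_Iio, Nat.lt_succ_iff]
    constructor
    · rintro ⟨h1, h2⟩ j hj
      rcases hj.lt_or_eq with hj | rfl
      · rw [if_pos hj]; exact h1 j hj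
      · rw [if_neg (lt_irrefl _)]; exact h2
    · intro h
      refine ⟨fun j hj => ?_, ?_⟩
      · have := h j hj.le
        rwa [if_pos hj] at this
      · have := h k le_rfl
        rwa [if_neg (lt_irrefl _)] at this
  rw [this, Measure.infinitePi_pi (fun _ : ℕ => ρ) fun j _ => by split_ifs; exacts [hS.compl, hS'],
    Finset.prod_range_succ, if_neg (lt_irrefl _)]
  congr 1
  rw [Finset.prod_congr rfl fun j hj => by rw [if_pos (Finset.mem_range.1 hj)]]
  simp

/-- The law of a property of the first element of `S` in a sequence of independent trials. -/
theorem infinitePi_exists_first_mem {S S' : Set β} (hS : MeasurableSet S) (hS' : MeasurableSet S')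
    (hsub : S' ⊆ S) :
    (Measure.infinitePi fun _ : ℕ => ρ) {u | ∃ k, (∀ j < k, u j ∉ S) ∧ u k ∈ S'} =
      (ρ S)⁻¹ * ρ S' := by
  have h1 : {u : ℕ → β | ∃ k, (∀ j < k, u j ∉ S) ∧ u k ∈ S'} =
      ⋃ k, {u | (∀ j < k, u j ∉ S) ∧ u k ∈ S'} := by ext; simp
  have hmeas : ∀ k, MeasurableSet {u : ℕ → β | (∀ j < k, u j ∉ S) ∧ u k ∈ S'} := fun k => by
    have : {u : ℕ → β | ∀ j < k, u j ∉ S} = ⋂ j : Fin k, (fun u => u j) ⁻¹' Sᶜ := by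
      ext u; simp [Fin.forall_iff]
    have h2 : MeasurableSet {u : ℕ → β | ∀ j < k, u j ∉ S} := by
      rw [this]
      exact .iInter fun j => measurable_pi_apply _ hS.compl
    exact h2.inter (measurable_pi_apply k hS')
  rw [h1, measure_iUnion _ hmeas]
  · simp_rw [infinitePi_first_mem ρ hS hS']
    -- Summing over the time of the first success gives a geometric series with ratio `1 - ρ S`.
    rw [ENNReal.tsum_mul_right, ENNReal.tsum_geometric, prob_compl_eq_one_sub hS,
      ENNReal.sub_sub_cancel ENNReal.one_ne_top prob_le_one]
  · have key : ∀ k l, k < l → Disjoint {u : ℕ → β | (∀ j < k, u j ∉ S) ∧ u k ∈ S'}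
        {u : ℕ → β | (∀ j < l, u j ∉ S) ∧ u l ∈ S'} := fun k l h =>
      Set.disjoint_left.2 fun u hu hu' => hu'.1 k h (hsub hu.2)
    intro k l h
    rcases lt_or_gt_of_ne h with h | h
    · exact key k l h
    · exact (key l k h).symm

theorem infinitePi_forall_notMem {S : Set β} (hS : MeasurableSet S) (h0 : ρ S ≠ 0) :
    (Measure.infinitePi fun _ : ℕ => ρ) {u | ∀ j, u j ∉ S} = 0 := by
  have hlt : ρ Sᶜ < 1 := by
    rw [prob_compl_eq_one_sub hS]
    exact ENNReal.sub_lt_self ENNReal.one_ne_top one_ne_zero h0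
  have h1 : ∀ k, (Measure.infinitePi fun _ : ℕ => ρ) {u | ∀ j, u j ∉ S} ≤ (ρ Sᶜ) ^ k := fun k => by
    rw [← infinitePi_forall_lt_notMem ρ hS k]
    exact measure_mono fun u hu j _ => hu j
  exact le_antisymm (ge_of_tendsto' (ENNReal.tendsto_pow_atTop_nhds_zero_of_lt_one hlt) h1)
    zero_le

end FirstHit

/-- The estimate is accurate enough for rejection sampling. -/
def Input.Good {n d : ℕ} (P : Input n d) (y : Fin n → ℝ) (x : Vec d) : Prop :=
  ∀ i, |P.f i x - P.f i P.x₀ - y i| ≤ 2 * P.ε'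

theorem Input.measurable_acceptProb {n d : ℕ} (P : Input n d) {α : Type*} [MeasurableSpace α]
    {y : α → Fin n → ℝ} (hy : ∀ i, Measurable fun a => y a i) (x : Vec d) (i : Fin n) :
    Measurable fun a => P.acceptProb (y a) x i :=
  (((((hy i).const_sub _).div_const _).sub_const _).exp).min measurable_const

/-- The shift by `-2` puts the exponent into `[-4, 0]`: the upper end makes the minimum inactive,
which is needed for exactness, and the lower end bounds the rejection rate. -/
theorem Input.acceptProb_of_good {n d : ℕ} {P : Input n d} {y : Fin n → ℝ} {x : Vec d} (hε : 0 < P.ε') (h : P.Good y x)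
    (i : Fin n) : P.acceptProb y x i = Real.exp ((P.f i x - P.f i P.x₀ - y i) / P.ε' - 2) ∧
      Real.exp (-4) ≤ P.acceptProb y x i := by
  have h1 := abs_le.1 (h i)
  have h2 : (P.f i x - P.f i P.x₀ - y i) / P.ε' ≤ 2 := by rw [div_le_iff₀ hε]; exact h1.2
  have h3 : -2 ≤ (P.f i x - P.f i P.x₀ - y i) / P.ε' := by rw [le_div_iff₀ hε]; linarith [h1.1]
  have h4 : P.acceptProb y x i = Real.exp ((P.f i x - P.f i P.x₀ - y i) / P.ε' - 2) :=
    min_eq_left (Real.exp_le_one_iff.2 (by linarith))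
  exact ⟨h4, by rw [h4]; exact Real.exp_le_exp.2 (by linarith)⟩

/-! ### Law of the index chosen in one iteration -/

section Rejection

variable {n d : ℕ} [NeZero n] (P : Input n d)

/-- The attempts that are accepted. -/
def Input.acceptSet (y : Fin n → ℝ) (x : Vec d) : Set (Bool → ℝ) :=
  {b | b true < P.acceptProb y x (P.propose y (b false))}

/-- The attempts that are accepted and yield the index `i`. -/
def Input.acceptSetAt (y : Fin n → ℝ) (x : Vec d) (i : Fin n) : Set (Bool → ℝ) :=
  {b | P.propose y (b false) = i ∧ b true < P.acceptProb y x i}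

theorem Input.acceptSet_eq_iUnion (y : Fin n → ℝ) (x : Vec d) :
    P.acceptSet y x = ⋃ i, P.acceptSetAt y x i := by
  ext b
  simp [Input.acceptSet, Input.acceptSetAt]

theorem Input.mem_accepted {y : Fin n → ℝ} {x : Vec d} {u : ℕ → Bool → ℝ} {k : ℕ} :
    k ∈ P.accepted y x u ↔ u k ∈ P.acceptSet y x := Iff.rfl

section Measurability

variable {α : Type*} [MeasurableSpace α] {y : α → Fin n → ℝ} {v : α → ℝ}
  {u : α → ℕ → Bool → ℝ}

theorem measurable_ofVec_apply {m : ℕ} {w : α → Fin m → ℝ} (hw : ∀ i, Measurable fun a => w a i)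
    (j : ℕ) : Measurable fun a => ofVec (w a) j := by
  unfold ofVec
  split_ifs
  · exact hw _
  · exact measurable_const

theorem Input.measurable_propose (hy : ∀ i, Measurable fun a => y a i) (hv : Measurable v) :
    Measurable fun a => P.propose (y a) (v a) :=
  (measurable_of_countable (Fin.ofNat n)).comp (measurable_pick (measurable_ofVec_apply fun i =>
    (((hy i).const_add (P.f i P.x₀)).div_const P.ε').exp) hv)

theorem Input.measurableSet_mem_accepted (hy : ∀ i, Measurable fun a => y a i)
    (hu : ∀ k b, Measurable fun a => u a k b) (x : Vec d) (k : ℕ) :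
    MeasurableSet {a | k ∈ P.accepted (y a) x (u a)} := by
  have : {a | k ∈ P.accepted (y a) x (u a)} = ⋃ i, ({a | P.propose (y a) (u a k false) = i} ∩
      {a | u a k true < P.acceptProb (y a) x i}) := by
    ext a
    simp [Input.accepted]
  rw [this]
  exact .iUnion fun i =>
    ((P.measurable_propose hy (hu k false)) (measurableSet_singleton i)).inter
      (measurableSet_lt (hu k true) (P.measurable_acceptProb hy x i))

theorem Input.measurable_chosen (hy : ∀ i, Measurable fun a => y a i)
    (hu : ∀ k b, Measurable fun a => u a k b) (x : Vec d) :
    Measurable fun a => P.chosen (y a) x (u a) := by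
  have h1 : Measurable fun a => sInf (P.accepted (y a) x (u a)) :=
    measurable_sInf_nat (Q := fun k => {a | k ∈ P.accepted (y a) x (u a)})
      (P.measurableSet_mem_accepted hy hu x)
  have h2 : Measurable fun q : ℕ × α => P.propose (y q.2) (u q.2 q.1 false) :=
    measurable_from_prod_countable_right fun k => P.measurable_propose hy (hu k false)
  exact h2.comp (h1.prodMk measurable_id)

end Measurability

theorem Input.measurableSet_acceptSetAt (y : Fin n → ℝ) (x : Vec d) (i : Fin n) :
    MeasurableSet (P.acceptSetAt y x i) :=
  ((P.measurable_propose (y := fun _ => y) (fun _ => measurable_const)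
    (measurable_pi_apply false)) (measurableSet_singleton i)).inter
    (measurableSet_lt (measurable_pi_apply true) measurable_const)

theorem Input.measurableSet_acceptSet (y : Fin n → ℝ) (x : Vec d) :
    MeasurableSet (P.acceptSet y x) := by
  rw [P.acceptSet_eq_iUnion]
  exact .iUnion fun i => P.measurableSet_acceptSetAt y x i

/-- The total weight of the proposals. -/
def Input.proposalWeight (y : Fin n → ℝ) : ℝ := ∑ i, Real.exp ((P.f i P.x₀ + y i) / P.ε')

theorem Input.proposalWeight_pos (y : Fin n → ℝ) : 0 < P.proposalWeight y :=
  Finset.sum_pos (fun _ _ => Real.exp_pos _) Finset.univ_nonempty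

theorem Input.uniform01_propose (y : Fin n → ℝ) (i : Fin n) :
    uniform01 {u | P.propose y u = i} =
      ENNReal.ofReal (Real.exp ((P.f i P.x₀ + y i) / P.ε') / P.proposalWeight y) := by
  set w : ℕ → ℝ := ofVec fun i => Real.exp ((P.f i P.x₀ + y i) / P.ε') with hw
  have hsum : ∑ j ∈ Finset.range n, |w j| = P.proposalWeight y := by
    rw [sum_range_ofVec _ fun _ x => |x|]
    exact Finset.sum_congr rfl fun j _ => abs_of_pos (Real.exp_pos _)
  have h1 : {u | P.propose y u = i} = {u | pick n w u = i} := by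
    ext u
    have hlt : pick n w u < n := pick_lt (NeZero.pos n) _ _
    simp only [Set.mem_ofPred_eq, Input.propose, ← hw]
    rw [Fin.ext_iff, Fin.val_ofNat, Nat.mod_eq_of_lt hlt]
  have h2 := uniform01_pick (w := w) (by rw [hsum]; exact P.proposalWeight_pos y) i.2
  rw [h1, h2, hsum]
  have : w i = Real.exp ((P.f i P.x₀ + y i) / P.ε') := by simp [hw, ofVec]
  rw [this, abs_of_pos (Real.exp_pos _)]

theorem Input.pairMeasure_acceptSetAt (y : Fin n → ℝ) (x : Vec d) (i : Fin n) :
    pairMeasure (P.acceptSetAt y x i) = ENNReal.ofReal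
      (Real.exp ((P.f i P.x₀ + y i) / P.ε') / P.proposalWeight y * P.acceptProb y x i) := by
  have h1 : P.acceptSetAt y x i = Set.pi (Finset.univ : Finset Bool) fun b =>
      if b then Set.Iio (P.acceptProb y x i) else {u | P.propose y u = i} := by
    ext b
    simp [Input.acceptSetAt, and_comm]
  have hm : MeasurableSet {u | P.propose y u = i} :=
    (P.measurable_propose (y := fun _ => y) (fun _ => measurable_const) measurable_id)
      (measurableSet_singleton i)
  rw [h1, pairMeasure, Measure.infinitePi_pi (fun _ : Bool => uniform01) fun b _ => by
    split_ifs; exacts [measurableSet_Iio, hm]]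
  rw [Fintype.prod_bool]
  simp only [if_true, Bool.false_eq_true, if_false]
  rw [uniform01_Iio (show P.acceptProb y x i ≤ 1 from min_le_right _ _), P.uniform01_propose, mul_comm,
    ENNReal.ofReal_mul (div_nonneg (Real.exp_pos _).le (P.proposalWeight_pos y).le)]

variable {P}

/-- The exponents of proposal and acceptance add up and `y i` cancels. The estimate survives only in
the normalization, which is the same for all indices. -/
theorem Input.pairMeasure_acceptSetAt_of_good {y : Fin n → ℝ} {x : Vec d} (hε : 0 < P.ε')
    (h : P.Good y x) (i : Fin n) : pairMeasure (P.acceptSetAt y x i) =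
      ENNReal.ofReal (Real.exp (-2) / P.proposalWeight y * Real.exp (P.f i x / P.ε')) := by
  rw [P.pairMeasure_acceptSetAt, (Input.acceptProb_of_good hε h i).1]
  congr 1
  rw [div_mul_eq_mul_div, div_mul_eq_mul_div, ← Real.exp_add, ← Real.exp_add]
  congr 2
  ring

theorem Input.pairMeasure_acceptSet (y : Fin n → ℝ) (x : Vec d) :
    pairMeasure (P.acceptSet y x) = ∑ i, pairMeasure (P.acceptSetAt y x i) := by
  rw [P.acceptSet_eq_iUnion, measure_iUnion _ fun i => P.measurableSet_acceptSetAt y x i,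
    tsum_fintype]
  intro i j hij
  exact Set.disjoint_left.2 fun b hb hb' => hij (hb.1.symm.trans hb'.1)

theorem Input.exp_neg_four_le_pairMeasure {y : Fin n → ℝ} {x : Vec d} (hε : 0 < P.ε')
    (h : P.Good y x) : ENNReal.ofReal (Real.exp (-4)) ≤ pairMeasure (P.acceptSet y x) := by
  have hW := P.proposalWeight_pos y
  rw [Input.pairMeasure_acceptSet]
  simp_rw [P.pairMeasure_acceptSetAt]
  rw [← ENNReal.ofReal_sum_of_nonneg fun i _ => mul_nonneg (div_nonneg (Real.exp_pos _).le hW.le)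
    ((Real.exp_pos _).le.trans (Input.acceptProb_of_good hε h i).2)]
  refine ENNReal.ofReal_le_ofReal ?_
  calc Real.exp (-4) = ∑ i, Real.exp ((P.f i P.x₀ + y i) / P.ε') / P.proposalWeight y *
        Real.exp (-4) := by
        rw [← Finset.sum_mul, ← Finset.sum_div]
        change _ = P.proposalWeight y / _ * _
        rw [div_self hW.ne', one_mul]
    _ ≤ _ := Finset.sum_le_sum fun i _ => mul_le_mul_of_nonneg_left
        (Input.acceptProb_of_good hε h i).2 (div_nonneg (Real.exp_pos _).le hW.le)

variable (P) in
/-- The weight of the index `i` in the gradient of the softmax. -/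
def Input.softWeight (x : Vec d) (i : Fin n) : ℝ :=
  Real.exp (P.f i x / P.ε') / ∑ k, Real.exp (P.f k x / P.ε')

/-- The index found by rejection sampling has the softmax distribution. -/
theorem Input.attemptMeasure_chosen {y : Fin n → ℝ} {x : Vec d} (hε : 0 < P.ε')
    (h : P.Good y x) (i : Fin n) :
    attemptMeasure {u | P.chosen y x u = i} = ENNReal.ofReal (P.softWeight x i) := by
  have hS := P.measurableSet_acceptSet y x
  have hpos : pairMeasure (P.acceptSet y x) ≠ 0 :=
    ((ENNReal.ofReal_pos.2 (Real.exp_pos _)).trans_le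
      (Input.exp_neg_four_le_pairMeasure hε h)).ne'
  have hsub : P.acceptSetAt y x i ⊆ P.acceptSet y x := by
    rw [P.acceptSet_eq_iUnion]; exact Set.subset_iUnion _ i
  -- Equality is only almost sure: if nothing is accepted, `sInf ∅ = 0` makes `chosen` the first
  -- proposal.
  have h1 : {u | P.chosen y x u = i} =ᵐ[attemptMeasure]
      {u | ∃ k, (∀ j < k, u j ∉ P.acceptSet y x) ∧ u k ∈ P.acceptSetAt y x i} := by
    have h0 : ∀ᵐ u ∂attemptMeasure, ¬ ∀ j, u j ∉ P.acceptSet y x :=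
      ae_iff.2 (by
        simp only [not_not]
        exact infinitePi_forall_notMem pairMeasure hS hpos)
    filter_upwards [h0] with u hu
    have hne : (P.accepted y x u).Nonempty := by
      by_contra hne
      rw [Set.not_nonempty_iff_eq_empty] at hne
      exact hu fun j hj => Set.eq_empty_iff_forall_notMem.1 hne j (P.mem_accepted.2 hj)
    refine propext ?_
    change P.chosen y x u = i ↔ ∃ k, (∀ j < k, u j ∉ P.acceptSet y x) ∧ u k ∈ P.acceptSetAt y x i
    constructor
    · intro hi
      refine ⟨sInf (P.accepted y x u), fun j hj hmem => Nat.notMem_of_lt_sInf hj hmem, hi, ?_⟩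
      have := Nat.sInf_mem hne
      rw [← hi]
      exact this
    · rintro ⟨k, hk1, hk2⟩
      have hk : sInf (P.accepted y x u) = k := by
        refine le_antisymm (Nat.sInf_le (hsub hk2)) (le_csInf hne fun j hj => ?_)
        by_contra hlt
        exact hk1 j (not_le.1 hlt) hj
      rw [Input.chosen, hk]
      exact hk2.1
  have hW := P.proposalWeight_pos y
  have hE : 0 < ∑ k, Real.exp (P.f k x / P.ε') :=
    Finset.sum_pos (fun _ _ => Real.exp_pos _) Finset.univ_nonempty
  rw [measure_congr h1, attemptMeasure,
    infinitePi_exists_first_mem pairMeasure hS (P.measurableSet_acceptSetAt y x i) hsub,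
    Input.pairMeasure_acceptSet]
  simp_rw [Input.pairMeasure_acceptSetAt_of_good hε h]
  rw [← ENNReal.ofReal_sum_of_nonneg fun i _ => by positivity, ← Finset.mul_sum,
    ← ENNReal.ofReal_inv_of_pos (by positivity), ← ENNReal.ofReal_mul (by positivity)]
  congr 1
  rw [Input.softWeight]
  have := Real.exp_pos (-2)
  field_simp

/-! ### Exponential moment of the number of attempts in one iteration -/

/-- The base of the exponential moment of the number of attempts. -/
def growth : ℝ := 1 + Real.exp (-4) / 2

variable (P) in
/-- An upper bound on `growth ^ attempts`. -/
def Input.moment (y : Fin n → ℝ) (x : Vec d) (u : ℕ → Bool → ℝ) : ℝ≥0∞ :=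
  ∑' k : ℕ, ENNReal.ofReal growth ^ (k + 1) *
    Set.indicator {u | ∀ j < k, j ∉ P.accepted y x u} 1 u

theorem one_lt_growth : 1 < growth := by
  have := Real.exp_pos (-4)
  unfold growth; linarith

theorem Input.measurable_moment {α : Type*} [MeasurableSpace α] {y : α → Fin n → ℝ}
    {u : α → ℕ → Bool → ℝ} (hy : ∀ i, Measurable fun a => y a i)
    (hu : ∀ k b, Measurable fun a => u a k b) (x : Vec d) :
    Measurable fun a => P.moment (y a) x (u a) := by
  refine Measurable.tsum fun k => Measurable.const_mul ?_ _
  have : (fun a => Set.indicator {u | ∀ j < k, j ∉ P.accepted (y a) x u}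
      (1 : (ℕ → Bool → ℝ) → ℝ≥0∞) (u a)) =
      Set.indicator {a | ∀ j < k, j ∉ P.accepted (y a) x (u a)} 1 := by
    ext a; simp [Set.indicator]
  rw [this]
  refine measurable_one.indicator ?_
  have : {a | ∀ j < k, j ∉ P.accepted (y a) x (u a)} =
      ⋂ j : Fin k, {a | (j : ℕ) ∈ P.accepted (y a) x (u a)}ᶜ := by
    ext a; simp [Fin.forall_iff]
  rw [this]
  exact .iInter fun j => (P.measurableSet_mem_accepted hy hu x j).compl

/-- With `c = e⁻⁴` the first `k` attempts fail with probability at most `(1 - c)^k`. Since `(1 -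
c)(1 + c / 2) ≤ 1 - c / 2`, the series is dominated by a geometric one with sum `2 / c`, up to one
factor `growth`. -/
theorem Input.lintegral_moment_le {y : Fin n → ℝ} {x : Vec d} (hε : 0 < P.ε') (h : P.Good y x) :
    ∫⁻ u, P.moment y x u ∂attemptMeasure ≤
      ENNReal.ofReal (growth * (2 * Real.exp 4)) := by
  set c := Real.exp (-4) with hc
  have hc0 : 0 < c := Real.exp_pos _
  have hS := P.measurableSet_acceptSet y x
  have hcS := Input.exp_neg_four_le_pairMeasure hε h
  have hset : ∀ k, MeasurableSet {u : ℕ → Bool → ℝ | ∀ j < k, j ∉ P.accepted y x u} := fun k => by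
    have : {u : ℕ → Bool → ℝ | ∀ j < k, j ∉ P.accepted y x u} =
        ⋂ j : Fin k, (fun u => u j) ⁻¹' (P.acceptSet y x)ᶜ := by
      ext u; simp [Fin.forall_iff, Input.mem_accepted]
    rw [this]
    exact .iInter fun j => measurable_pi_apply _ hS.compl
  have hg : 0 < growth := one_pos.trans one_lt_growth
  have hle : pairMeasure (P.acceptSet y x)ᶜ ≤ ENNReal.ofReal (1 - c) := by
    rw [prob_compl_eq_one_sub hS, ENNReal.ofReal_sub _ hc0.le, ENNReal.ofReal_one]
    gcongr
  have hc1 : c ≤ 1 := Real.exp_le_one_iff.2 (by norm_num)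
  unfold Input.moment
  rw [lintegral_tsum fun k => ((measurable_one.indicator (hset k)).const_mul _).aemeasurable]
  have h1 : ∀ k, ∫⁻ u, ENNReal.ofReal growth ^ (k + 1) *
      Set.indicator {u | ∀ j < k, j ∉ P.accepted y x u} 1 u ∂attemptMeasure ≤
      ENNReal.ofReal growth * ENNReal.ofReal (1 - c / 2) ^ k := fun k => by
    rw [lintegral_const_mul _ (measurable_one.indicator (hset k)), lintegral_indicator_one (hset k)]
    have h2 : attemptMeasure {u : ℕ → Bool → ℝ | ∀ j < k, j ∉ P.accepted y x u} =
        pairMeasure (P.acceptSet y x)ᶜ ^ k := infinitePi_forall_lt_notMem pairMeasure hS k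
    rw [h2, pow_succ, mul_comm (_ ^ k), mul_assoc, ← mul_pow]
    gcongr
    refine (mul_le_mul_right hle _).trans ?_
    rw [← ENNReal.ofReal_mul hg.le]
    refine ENNReal.ofReal_le_ofReal ?_
    unfold growth
    rw [← hc]
    nlinarith
  refine (ENNReal.tsum_le_tsum h1).trans ?_
  rw [ENNReal.tsum_mul_left, ENNReal.tsum_geometric, ← ENNReal.ofReal_one,
    ← ENNReal.ofReal_sub _ (by linarith), sub_sub_cancel,
    ← ENNReal.ofReal_inv_of_pos (by positivity), ← ENNReal.ofReal_mul hg.le]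
  refine le_of_eq ?_
  congr 2
  rw [hc, Real.exp_neg]
  field_simp

/-- If at least `N` attempts are made, the first `N - 1` are rejected, so the summand of index `N -
1` is present. A lower bound `N`, rather than the exact count, also covers infinitely many attempts.
-/
theorem Input.growth_pow_le_moment {y : Fin n → ℝ} {x : Vec d} {u : ℕ → Bool → ℝ} {N : ℕ}
    (h : (N : ℕ∞) ≤ P.attempts y x u) : ENNReal.ofReal growth ^ N ≤ P.moment y x u := by
  have hg : 1 ≤ ENNReal.ofReal growth := ENNReal.one_le_ofReal.2 one_lt_growth.le
  have hmem : u ∈ {u | ∀ j < N - 1, j ∉ P.accepted y x u} := by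
    intro j hj hmem
    have h1 : P.attempts y x u ≤ ((j + 1 : ℕ) : ℕ∞) := iInf₂_le j hmem
    have := Nat.cast_le.1 (h.trans h1)
    omega
  calc _ ≤ ENNReal.ofReal growth ^ (N - 1 + 1) := pow_le_pow_right₀ hg (by omega)
    _ = ENNReal.ofReal growth ^ (N - 1 + 1) *
          Set.indicator {u | ∀ j < N - 1, j ∉ P.accepted y x u} 1 u := by
        rw [Set.indicator_of_mem hmem]; simp
    _ ≤ _ := ENNReal.le_tsum (N - 1)

end Rejection

/-! ### Functions of two independent sources of randomness -/

section Indep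

variable {Ω α β : Type*} [MeasurableSpace Ω] [MeasurableSpace α] [MeasurableSpace β]
  {μ : Measure Ω} [IsProbabilityMeasure μ] {X : Ω → α} {U : Ω → β}

theorem lintegral_of_indepFun (hX : Measurable X) (hU : Measurable U) (h : IndepFun X U μ)
    {Φ : α × β → ℝ≥0∞} (hΦ : Measurable Φ) :
    ∫⁻ ω, Φ (X ω, U ω) ∂μ = ∫⁻ ω, ∫⁻ u, Φ (X ω, u) ∂(μ.map U) ∂μ := by
  have hU' : IsProbabilityMeasure (μ.map U) := Measure.isProbabilityMeasure_map hU.aemeasurable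
  have h1 := (indepFun_iff_map_prod_eq_prod_map_map hX.aemeasurable hU.aemeasurable).1 h
  rw [← lintegral_map hΦ (hX.prodMk hU), h1, lintegral_prod _ hΦ.aemeasurable,
    lintegral_map hΦ.lintegral_prod_right' hX]

/-- Independence makes the conditional distribution of `U` given `X` the constant kernel, so
conditioning freezes `X` and integrates over `U`. -/
theorem condExp_of_indepFun [StandardBorelSpace β] [Nonempty β] {F : Type*} [NormedAddCommGroup F]
    [NormedSpace ℝ F] [CompleteSpace F] (hX : Measurable X) (hU : Measurable U)
    (h : IndepFun X U μ) {Φ : α × β → F} (hΦ : StronglyMeasurable Φ)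
    (hint : Integrable (fun ω => Φ (X ω, U ω)) μ) :
    μ[fun ω => Φ (X ω, U ω) | MeasurableSpace.comap X inferInstance] =ᵐ[μ]
      fun ω => ∫ u, Φ (X ω, u) ∂(μ.map U) := by
  have hU' : IsProbabilityMeasure (μ.map U) := Measure.isProbabilityMeasure_map hU.aemeasurable
  have h1 := (indepFun_iff_map_prod_eq_prod_map_map hX.aemeasurable hU.aemeasurable).1 h
  have h2 : condDistrib U X μ =ᵐ[μ.map X] Kernel.const α (μ.map U) :=
    condDistrib_ae_eq_of_measure_eq_compProd X hU.aemeasurable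
      (by rw [h1, Measure.compProd_const])
  refine (condExp_prod_ae_eq_integral_condDistrib hX hU.aemeasurable hΦ hint).trans ?_
  filter_upwards [ae_of_ae_map hX.aemeasurable h2] with ω hω
  rw [hω, Kernel.const_apply]

end Indep

/-! ### The past of an iteration -/

/-- The sample space with the events determined before iteration `t`. -/
def Past (_t : ℕ) : Type := Sample

instance (t : ℕ) : MeasurableSpace (Past t) := sourceFiltration t

/-- The identity map. -/
def toPast (t : ℕ) : Sample → Past t := id

/-- The tape of the data structure. -/
def tape (ω : Sample) : ℕ → ℝ := fun k => ω (Sum.inl k)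

/-- The uniform numbers of iteration `t`. -/
def unif (t : ℕ) (ω : Sample) : ℕ → Bool → ℝ := fun k b => ω (Sum.inr (t, k, b))

/-- With `Past t` as a type of its own, measurability with respect to the filtration becomes
ordinary measurability, and the past becomes a random variable that generates `sourceFiltration t`.
-/
theorem measurable_toPast (t : ℕ) : Measurable (toPast t) :=
  measurable_id'' (sourceFiltration.le t)

theorem comap_toPast (t : ℕ) :
    MeasurableSpace.comap (toPast t) inferInstance = sourceFiltration t :=
  MeasurableSpace.comap_id

theorem measurable_past_apply {t : ℕ} {s : Source} (hs : s ∈ usedBefore t) :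
    Measurable fun a : Past t => (show Sample from a) s :=
  measurable_iff_comap_le.2
    (le_biSup (fun s => MeasurableSpace.comap (fun ω : Sample => ω s) inferInstance) hs)

theorem measurable_tape_past (t : ℕ) : Measurable fun a : Past t => tape a :=
  measurable_pi_lambda _ fun k => measurable_past_apply (s := Sum.inl k) fun a h => by cases h

theorem measurable_unif_past {s t : ℕ} (h : s < t) (k : ℕ) (b : Bool) :
    Measurable fun a : Past t => unif s a k b :=
  measurable_past_apply (s := Sum.inr (s, k, b)) fun a ha => by
    cases ha; exact h

theorem measurable_tape : Measurable tape :=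
  measurable_pi_lambda _ fun _ => measurable_pi_apply _

theorem measurable_unif (t : ℕ) : Measurable (unif t) :=
  measurable_pi_lambda _ fun _ => measurable_pi_lambda _ fun _ => measurable_pi_apply _

theorem map_tape : sampleMeasure.map tape = tapeMeasure :=
  Measure.map_infinitePi_infinitePi_of_inj (P := fun _ : Source => uniform01)
    (f := fun k : ℕ => (Sum.inl k : Source)) Sum.inl_injective

theorem map_unif (t : ℕ) : sampleMeasure.map (unif t) = attemptMeasure := by
  have h1 := Measure.map_infinitePi_infinitePi_of_inj (P := fun _ : Source => uniform01)
    (f := fun q : ℕ × Bool => (Sum.inr (t, q.1, q.2) : Source)) (by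
      rintro ⟨k, b⟩ ⟨k', b'⟩ h
      simpa using h)
  have h2 := Measure.infinitePi_map_curry (fun (_ : ℕ) (_ : Bool) => uniform01)
  rw [attemptMeasure]
  unfold pairMeasure
  rw [← h2, ← h1, Measure.map_map (MeasurableEquiv.measurable _) (by fun_prop)]
  rfl

/-- The two sides are generated by disjoint sets of coordinates of a product measure; the whole tape
of the data structure lies on the side of the past. -/
theorem indepFun_toPast_unif (t : ℕ) : IndepFun (toPast t) (unif t) sampleMeasure := by
  have h1 : iIndepFun (fun (s : Source) (ω : Sample) => ω s) sampleMeasure :=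
    iIndepFun_infinitePi (P := fun _ : Source => uniform01) (X := fun _ x => x)
      fun _ => measurable_id
  have hdisj : Disjoint (usedBefore t) {s : Source | ∃ k b, s = Sum.inr (t, k, b)} := by
    refine Set.disjoint_left.2 ?_
    rintro s hs ⟨k, b, rfl⟩
    exact lt_irrefl _ (hs _ rfl)
  have h2 := indep_iSup_of_disjoint (fun s => (measurable_pi_apply s).comap_le) h1 hdisj
  rw [IndepFun_iff_Indep]
  refine indep_of_indep_of_le_left (indep_of_indep_of_le_right h2 ?_) ?_
  · simp only [MeasurableSpace.pi, MeasurableSpace.comap_iSup, MeasurableSpace.comap_comp]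
    exact iSup_le fun k => iSup_le fun b => le_biSup
      (fun s => MeasurableSpace.comap (fun ω : Sample => ω s) inferInstance) ⟨k, b, rfl⟩
  · exact (comap_toPast t).le

theorem lintegral_past_unif (t : ℕ) {Φ : Past t × (ℕ → Bool → ℝ) → ℝ≥0∞} (hΦ : Measurable Φ) :
    ∫⁻ ω, Φ (toPast t ω, unif t ω) ∂sampleMeasure =
      ∫⁻ ω, ∫⁻ u, Φ (toPast t ω, u) ∂attemptMeasure ∂sampleMeasure := by
  rw [lintegral_of_indepFun (measurable_toPast t) (measurable_unif t) (indepFun_toPast_unif t) hΦ,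
    map_unif]

theorem condExp_past_unif {d : ℕ} (t : ℕ) {Φ : Past t × (ℕ → Bool → ℝ) → Vec d}
    (hΦ : Measurable Φ) (hint : Integrable (fun ω => Φ (toPast t ω, unif t ω)) sampleMeasure) :
    sampleMeasure[fun ω => Φ (toPast t ω, unif t ω) | sourceFiltration t] =ᵐ[sampleMeasure]
      fun ω => ∫ u, Φ (toPast t ω, u) ∂attemptMeasure := by
  have := condExp_of_indepFun (measurable_toPast t) (measurable_unif t) (indepFun_toPast_unif t)
    hΦ.stronglyMeasurable hint
  rwa [map_unif, comap_toPast] at this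

/-! ### Functions of finitely many indices -/

/-- Extension of a finite sequence. -/
def extend {n : ℕ} [NeZero n] {t : ℕ} (κ : Fin t → Fin n) : ℕ → Fin n :=
  fun s => if h : s < t then κ ⟨s, h⟩ else 0

theorem extend_of_lt {n : ℕ} [NeZero n] {t : ℕ} (κ : Fin t → Fin n) {s : ℕ} (h : s < t) :
    extend κ s = κ ⟨s, h⟩ := dif_pos h

/-- `F` depends only on the first `t` indices. -/
def DependsOnPrefix {n : ℕ} {β : Type*} (t : ℕ) (F : (ℕ → Fin n) → β) : Prop :=
  ∀ idx idx' : ℕ → Fin n, (∀ s < t, idx s = idx' s) → F idx = F idx'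

theorem DependsOnPrefix.eq_extend {n : ℕ} [NeZero n] {β : Type*} {t : ℕ} {F : (ℕ → Fin n) → β}
    (h : DependsOnPrefix t F) (idx : ℕ → Fin n) : F idx = F (extend fun j : Fin t => idx j) :=
  h _ _ fun s hs => by rw [extend_of_lt _ hs]

/-- A prefix takes only finitely many values, so measurability can be checked for each fixed one.
For this reason the rule `next` and the functions `f`, `g` need no measurability. -/
theorem measurable_comp_prefix {n : ℕ} [NeZero n] {α β : Type*} [MeasurableSpace α]
    [MeasurableSpace β] {t : ℕ} {q : α → ℕ → Fin n} (hq : ∀ s < t, Measurable fun a => q a s)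
    {F : (ℕ → Fin n) → α → β} (hdep : DependsOnPrefix t F) (hF : ∀ idx, Measurable (F idx)) :
    Measurable fun a => F (q a) a := by
  have h1 : Measurable fun z : (Fin t → Fin n) × α => F (extend z.1) z.2 :=
    measurable_from_prod_countable_right fun κ => hF (extend κ)
  have h2 : Measurable fun a => ((fun j : Fin t => q a j), a) :=
    (measurable_pi_lambda _ fun j : Fin t => hq j j.2).prodMk measurable_id
  have h3 : (fun a => F (q a) a) = fun a => F (extend fun j : Fin t => q a j) a := by
    funext a
    exact congrFun (hdep.eq_extend (q a)) a
  rw [h3]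
  exact h1.comp h2

/-- The products are path probabilities in a tree of depth `t`; summing out the last index reduces
the depth by one. -/
theorem sum_prod_extend {n : ℕ} [NeZero n] {w : (ℕ → Fin n) → ℕ → Fin n → ℝ≥0∞}
    (hdep : ∀ t, DependsOnPrefix t fun idx => w idx t) (hw : ∀ idx t, ∑ i, w idx t i = 1) (t : ℕ) :
    ∑ κ : Fin t → Fin n, ∏ s ∈ Finset.range t, w (extend κ) s (extend κ s) = 1 := by
  induction t with
  | zero => simp
  | succ t ih =>
    have key : ∀ q : Fin n × (Fin t → Fin n), ∏ s ∈ Finset.range (t + 1),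
        w (extend (Fin.snocEquiv (fun _ => Fin n) q)) s (extend (Fin.snocEquiv (fun _ => Fin n) q) s)
        = (∏ s ∈ Finset.range t, w (extend q.2) s (extend q.2 s)) * w (extend q.2) t q.1 := by
      rintro ⟨i, κ⟩
      have h1 : ∀ s < t, extend (Fin.snocEquiv (fun _ => Fin n) (i, κ)) s = extend κ s := by
        intro s hs
        rw [extend_of_lt _ (hs.trans (Nat.lt_succ_self t)), extend_of_lt _ hs]
        exact Fin.snoc_castSucc (α := fun _ => Fin n) i κ ⟨s, hs⟩
      have h2 : extend (Fin.snocEquiv (fun _ => Fin n) (i, κ)) t = i := by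
        rw [extend_of_lt _ (Nat.lt_succ_self t)]
        exact Fin.snoc_last (α := fun _ => Fin n) i κ
      have h3 : ∀ r ≤ t, w (extend (Fin.snocEquiv (fun _ => Fin n) (i, κ))) r = w (extend κ) r :=
        fun r hr => hdep r _ _ fun s hs => h1 s (hs.trans_le hr)
      rw [Finset.prod_range_succ, h2, h3 t le_rfl]
      congr 1
      refine Finset.prod_congr rfl fun s hs => ?_
      have hs := Finset.mem_range.1 hs
      rw [h1 s hs, h3 s hs.le]
    rw [← (Fin.snocEquiv fun _ => Fin n).sum_comp, Fintype.sum_prod_type_right]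
    simp_rw [key, ← Finset.mul_sum, hw, mul_one, ih]

/-! ### The estimator along a sequence of indices -/

theorem runQueries_congr (M : DataStructure) (ω : ℕ → ℝ) {n d : ℕ} (A : Fin n → Vec d)
    (x₀ : Vec d) (R ε δ : ℝ) {Δ Δ' : ℕ → Vec d} {t : ℕ} (h : ∀ s < t, Δ s = Δ' s) :
    M.runQueries ω A x₀ R ε δ Δ t = M.runQueries ω A x₀ R ε δ Δ' t := by
  induction t with
  | zero => rfl
  | succ t ih =>
    simp only [DataStructure.runQueries]
    rw [ih fun s hs => h s (by omega), h t (by omega)]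

section Along

variable {n d : ℕ} (P : Input n d) (M : DataStructure)

/-- The matrix passed to the data structure. -/
def Input.matrix : Fin n → Vec d := fun i => P.Lf⁻¹ • P.g i P.x₀

/-- The queries to the data structure. -/
def Input.moves (idx : ℕ → Fin n) (s : ℕ) : Vec d :=
  P.pointAlong idx (s + 1) - P.pointAlong idx s

/-- The store and the output of the data structure after `t` queries. -/
def Input.dsAlong (τ : ℕ → ℝ) (idx : ℕ → Fin n) (t : ℕ) : Store × (Fin n → ℝ) :=
  M.runQueries τ P.matrix 0 P.r' (P.ε' / P.Lf) (P.δ / 2) (P.moves idx) t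

/-- The scaled estimate after `t` queries. -/
def Input.estAlong (τ : ℕ → ℝ) (idx : ℕ → Fin n) (t : ℕ) : Fin n → ℝ :=
  P.Lf • (P.dsAlong M τ idx t).2

theorem Input.outsAlong_dependsOnPrefix (t : ℕ) :
    DependsOnPrefix t fun idx => P.outsAlong idx t := by
  intro idx idx' h
  induction t with
  | zero => rfl
  | succ t ih =>
    have := ih fun s hs => h s (by omega)
    simp only [Input.outsAlong] at this ⊢
    rw [this, h t (by omega)]

theorem Input.pointAlong_dependsOnPrefix (t : ℕ) :
    DependsOnPrefix t fun idx => P.pointAlong idx (t + 1) := by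
  intro idx idx' h
  simp only [Input.pointAlong]
  exact congrArg P.next (P.outsAlong_dependsOnPrefix t idx idx' h)

theorem Input.pointAlong_congr {idx idx' : ℕ → Fin n} {t : ℕ} (h : ∀ s < t, idx s = idx' s) {s : ℕ}
    (hs : s ≤ t + 1) : P.pointAlong idx s = P.pointAlong idx' s := by
  cases s with
  | zero => rfl
  | succ s => exact P.pointAlong_dependsOnPrefix s _ _ fun r hr => h r (by omega)

theorem Input.estAlong_dependsOnPrefix (τ : ℕ → ℝ) (t : ℕ) :
    DependsOnPrefix t fun idx => P.estAlong M τ idx (t + 1) := by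
  intro idx idx' h
  simp only [Input.estAlong, Input.dsAlong]
  rw [runQueries_congr M τ P.matrix 0 P.r' _ _ (Δ := P.moves idx) (Δ' := P.moves idx')]
  intro s hs
  rw [Input.moves, Input.moves, P.pointAlong_congr h (by omega), P.pointAlong_congr h (by omega)]

variable [NeZero n]

/-- The index chosen in iteration `t`. -/
def Input.choice (ω : Sample) (t : ℕ) : Fin n :=
  P.chosen (P.run M ω (t + 1)).est (P.run M ω (t + 1)).x (unif t ω)

/-- The adaptive run coincides with a run against the fixed query sequence determined by the
realized indices. This is the bridge to oblivious guarantees. -/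
theorem Input.run_spec (ω : Sample) (t : ℕ) :
    (P.run M ω t).outs = P.outsAlong (P.choice M ω) t ∧
    (P.run M ω t).x = P.pointAlong (P.choice M ω) t ∧
    (P.run M ω t).mem = (P.dsAlong M (tape ω) (P.choice M ω) t).1 ∧
    (P.run M ω t).est = P.estAlong M (tape ω) (P.choice M ω) t := by
  induction t with
  | zero => exact ⟨rfl, rfl, rfl, rfl⟩
  | succ t ih =>
    obtain ⟨h1, h2, h3, h4⟩ := ih
    have hx : (P.run M ω (t + 1)).x = P.pointAlong (P.choice M ω) (t + 1) := by
      simp only [Input.run, Input.step, Input.pointAlong]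
      rw [h1]
    have hm : (P.run M ω (t + 1)).mem =
        M.runQuery (tape ω) (P.run M ω t).mem (P.moves (P.choice M ω) t) := by
      rw [Input.moves, ← hx, ← h2]; rfl
    have hds : P.dsAlong M (tape ω) (P.choice M ω) (t + 1) =
        ((P.run M ω (t + 1)).mem, newEst (P.run M ω (t + 1)).mem
          (P.dsAlong M (tape ω) (P.choice M ω) t).2) := by
      rw [hm, h3]; rfl
    refine ⟨?_, hx, by rw [hds], ?_⟩
    · have : (P.run M ω (t + 1)).outs = (P.run M ω t).outs ++
          [P.g (P.choice M ω t) (P.run M ω (t + 1)).x] := rfl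
      rw [this, hx, h1]; rfl
    · have : (P.run M ω (t + 1)).est = if (P.run M ω (t + 1)).mem.N 1 0 = 0 then (P.run M ω t).est
          else P.Lf • readEst n (P.run M ω (t + 1)).mem := rfl
      rw [this, Input.estAlong, hds, newEst, h4]
      split_ifs <;> rfl

/-- The index that is chosen in iteration `t` after the indices `idx`. -/
def Input.choiceAlong (idx : ℕ → Fin n) (t : ℕ) (τ : ℕ → ℝ) (u : ℕ → Bool → ℝ) : Fin n :=
  P.chosen (P.estAlong M τ idx (t + 1)) (P.pointAlong idx (t + 1)) u

/-- Not circular: by `choiceAlong_congr` the right side depends only on choices made before `t`. It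
therefore serves as a recursion. -/
theorem Input.choice_eq (ω : Sample) (t : ℕ) :
    P.choice M ω t = P.choiceAlong M (P.choice M ω) t (tape ω) (unif t ω) := by
  obtain ⟨-, h2, -, h4⟩ := P.run_spec M ω (t + 1)
  rw [Input.choiceAlong, ← h2, ← h4]; rfl

theorem Input.choiceAlong_congr {idx idx' : ℕ → Fin n} {t : ℕ} (h : ∀ s < t, idx s = idx' s)
    (τ : ℕ → ℝ) (u : ℕ → Bool → ℝ) :
    P.choiceAlong M idx t τ u = P.choiceAlong M idx' t τ u := by
  rw [Input.choiceAlong, Input.choiceAlong]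
  congr 1
  · exact P.estAlong_dependsOnPrefix M τ t idx idx' h
  · exact P.pointAlong_dependsOnPrefix t idx idx' h

theorem Input.output_eq (ω : Sample) (t : ℕ) : P.output M (t + 1) ω =
    P.g (P.choice M ω t) (P.pointAlong (P.choice M ω) (t + 1)) := by
  rw [Input.output, (P.run_spec M ω (t + 1)).1]
  simp [Input.outsAlong, Input.pointAlong]

theorem Input.point_eq (ω : Sample) (t : ℕ) :
    P.point M t ω = P.pointAlong (P.choice M ω) t := (P.run_spec M ω t).2.1

/-- The number of attempts of iteration `t`. -/
def Input.attemptsAt (ω : Sample) (t : ℕ) : ℕ∞ :=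
  P.attempts (P.estAlong M (tape ω) (P.choice M ω) (t + 1))
    (P.pointAlong (P.choice M ω) (t + 1)) (unif t ω)

theorem Input.numQueries_eq (ω : Sample) (T : ℕ) :
    P.numQueries M T ω = n + ∑ t ∈ Finset.range T, P.attemptsAt M ω t := by
  induction T with
  | zero => simp [Input.numQueries, Input.run, Input.start]
  | succ T ih =>
    have : P.numQueries M (T + 1) ω = P.numQueries M T ω +
        P.attempts (P.run M ω (T + 1)).est (P.run M ω (T + 1)).x (unif T ω) := rfl
    obtain ⟨-, h2, -, h4⟩ := P.run_spec M ω (T + 1)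
    rw [this, ih, h2, h4, Finset.sum_range_succ, add_assoc]; rfl

open Classical in
theorem Input.work_eq (ω : Sample) (T : ℕ) : (P.run M ω T).work =
    ((2 * (n * d) + 10 * (n + d) + 10 + T * (10 * d + 10) + 10 * n * ((Finset.range T).filter
      fun t => (P.dsAlong M (tape ω) (P.choice M ω) (t + 1)).1.N 1 0 ≠ 0).card : ℕ) : ℕ∞) +
      10 * ∑ t ∈ Finset.range T, P.attemptsAt M ω t := by
  induction T with
  | zero => simp [Input.run, Input.start]
  | succ T ih =>
    have : (P.run M ω (T + 1)).work = (P.run M ω T).work + (10 * d + 10 : ℕ) +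
        (if (P.run M ω (T + 1)).mem.N 1 0 = 0 then 0 else 10 * n : ℕ) +
        10 * P.attempts (P.run M ω (T + 1)).est (P.run M ω (T + 1)).x (unif T ω) := rfl
    obtain ⟨-, h2, h3, h4⟩ := P.run_spec M ω (T + 1)
    rw [this, ih, h2, h3, h4, Finset.sum_range_succ, Finset.range_add_one, Finset.filter_insert,
      mul_add]
    change _ + 10 * P.attemptsAt M ω T = _
    by_cases hN : (P.dsAlong M (tape ω) (P.choice M ω) (T + 1)).1.N 1 0 = 0
    · rw [if_pos hN, if_neg (not_not.2 hN)]
      push_cast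
      ring
    · rw [if_neg hN, if_pos hN, Finset.card_insert_of_notMem (by simp)]
      push_cast
      ring

end Along

/-! ### Measurability of the choices -/

section Measurable

variable {n d : ℕ} [NeZero n] {P : Input n d} {M : DataStructure}

/-- The output of the data structure is a measurable function of its tape. -/
def Input.MeasurableEst (P : Input n d) (M : DataStructure) : Prop :=
  ∀ idx t i, Measurable fun τ => P.estAlong M τ idx t i

/-- Strong induction through the recursion `choice_eq`: for each fixed prefix the next choice is
measurable in the tape and the fresh uniforms. -/
theorem Input.measurable_choice (hM : P.MeasurableEst M) {s t : ℕ} (hs : s < t) :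
    Measurable fun a : Past t => P.choice M a s := by
  induction s using Nat.strong_induction_on with
  | _ s ih =>
    have h1 : (fun a : Past t => P.choice M a s) =
        fun a : Past t => P.choiceAlong M (P.choice M a) s (tape a) (unif s a) :=
      funext fun a => P.choice_eq M a s
    rw [h1]
    refine measurable_comp_prefix (t := s)
      (F := fun idx (a : Past t) => P.choiceAlong M idx s (tape a) (unif s a))
      (fun r hr => ih r hr (hr.trans hs)) (fun idx idx' h => ?_) fun idx => ?_
    · funext a
      exact P.choiceAlong_congr M h _ _
    · exact P.measurable_chosen (fun i => (hM idx (s + 1) i).comp (measurable_tape_past t))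
        (measurable_unif_past hs) _

theorem Input.measurable_choice_sample (hM : P.MeasurableEst M) (s : ℕ) :
    Measurable fun ω => P.choice M ω s :=
  (Input.measurable_choice hM (Nat.lt_succ_self s)).comp (measurable_toPast (s + 1))

end Measurable

/-! ### Joint law of the choices and the tape -/

section Law

variable {n d : ℕ} {P : Input n d} {M : DataStructure}

/-- The tapes of the data structure on which all estimates are accurate. -/
def Input.goodTape (P : Input n d) (M : DataStructure) (idx : ℕ → Fin n) (T : ℕ) :
    Set (ℕ → ℝ) :=
  {τ | ∀ t < T, P.Good (P.estAlong M τ idx (t + 1)) (P.pointAlong idx (t + 1))}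

theorem Input.measurableSet_good {α : Type*} [MeasurableSpace α] {y : α → Fin n → ℝ}
    (hy : ∀ i, Measurable fun a => y a i) (x : Vec d) : MeasurableSet {a | P.Good (y a) x} := by
  have : {a | P.Good (y a) x} = ⋂ i, {a | |P.f i x - P.f i P.x₀ - y a i| ≤ 2 * P.ε'} := by
    ext a; simp [Input.Good]
  rw [this]
  exact .iInter fun i => measurableSet_le ((hy i).const_sub _).abs measurable_const

theorem Input.measurableSet_goodTape (hM : P.MeasurableEst M) (idx : ℕ → Fin n) (T : ℕ) :
    MeasurableSet (P.goodTape M idx T) := by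
  have : P.goodTape M idx T = ⋂ t : Fin T,
      {τ | P.Good (P.estAlong M τ idx (t + 1)) (P.pointAlong idx (t + 1))} := by
    ext τ; simp [Input.goodTape, Fin.forall_iff]
  rw [this]
  exact .iInter fun t => Input.measurableSet_good (hM idx (t + 1)) _

theorem Input.goodTape_dependsOnPrefix (T : ℕ) :
    DependsOnPrefix T fun idx => P.goodTape M idx T := by
  intro idx idx' h
  ext τ
  refine forall₂_congr fun t ht => ?_
  have h1 := P.estAlong_dependsOnPrefix M τ t idx idx' fun s hs => h s (hs.trans ht)
  have h2 := P.pointAlong_dependsOnPrefix t idx idx' fun s hs => h s (hs.trans ht)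
  simp only at h1 h2
  rw [h1, h2]

variable [NeZero n]

/-- The law of the first indices and of the tape. -/
theorem Input.sampleMeasure_prefix (hM : P.MeasurableEst M) (hε : 0 < P.ε') {T : ℕ}
    (idx : ℕ → Fin n) {t : ℕ} (ht : t ≤ T) :
    sampleMeasure {ω | (∀ s < t, P.choice M ω s = idx s) ∧ tape ω ∈ P.goodTape M idx T} =
      (∏ s ∈ Finset.range t, ENNReal.ofReal (P.softWeight (P.pointAlong idx (s + 1)) (idx s))) *
        tapeMeasure (P.goodTape M idx T) := by
  have hG := Input.measurableSet_goodTape hM idx T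
  -- The sequence `idx` and the horizon `T` stay fixed while `t` grows: `goodTape` for all of `idx`
  -- is an event of the tape alone, hence known before every iteration.
  induction t with
  | zero =>
    rw [← map_tape, Measure.map_apply measurable_tape hG]
    simp
    rfl
  | succ t ih =>
    set A : Set (Past t) := {a | (∀ s < t, P.choice M a s = idx s) ∧ tape a ∈ P.goodTape M idx T}
      with hA
    have hAm : MeasurableSet A := by
      have : A = (⋂ s : Fin t, {a : Past t | P.choice M a s = idx s}) ∩
          (fun a : Past t => tape a) ⁻¹' P.goodTape M idx T := by
        ext a; simp [hA, Fin.forall_iff]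
      rw [this]
      exact (MeasurableSet.iInter fun s : Fin t =>
        (Input.measurable_choice hM s.2) (measurableSet_singleton (idx s))).inter
          (measurable_tape_past t hG)
    set B : Set (Past t × (ℕ → Bool → ℝ)) :=
      {z | z.1 ∈ A ∧ P.choiceAlong M idx t (tape z.1) z.2 = idx t} with hB
    have hBm : MeasurableSet B := by
      refine (measurable_fst hAm).inter ?_
      exact P.measurable_chosen (y := fun z : Past t × (ℕ → Bool → ℝ) =>
        P.estAlong M (tape z.1) idx (t + 1)) (u := fun z => z.2)
        (fun i => (hM idx (t + 1) i).comp ((measurable_tape_past t).comp measurable_fst))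
        (fun k b => by fun_prop) _ (measurableSet_singleton (idx t))
    have h1 : {ω | (∀ s < t + 1, P.choice M ω s = idx s) ∧ tape ω ∈ P.goodTape M idx T} =
        (fun ω => (toPast t ω, unif t ω)) ⁻¹' B := by
      ext ω
      have hc : (∀ s < t, P.choice M ω s = idx s) →
          P.choice M ω t = P.choiceAlong M idx t (tape ω) (unif t ω) := fun h => by
        rw [P.choice_eq M ω t]
        exact P.choiceAlong_congr M h _ _
      constructor
      · rintro ⟨h, h'⟩
        have h0 : ∀ s < t, P.choice M ω s = idx s := fun s hs => h s (by omega)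
        exact ⟨⟨h0, h'⟩, (hc h0).symm.trans (h t (by omega))⟩
      · rintro ⟨⟨h0, h'⟩, h⟩
        refine ⟨fun s hs => ?_, h'⟩
        rcases Nat.lt_succ_iff_lt_or_eq.1 hs with hs | rfl
        · exact h0 s hs
        · exact (hc h0).trans h
    have hm : Measurable fun ω => (toPast t ω, unif t ω) :=
      (measurable_toPast t).prodMk (measurable_unif t)
    rw [h1, ← lintegral_indicator_one (hm hBm)]
    change ∫⁻ ω, B.indicator 1 (toPast t ω, unif t ω) ∂sampleMeasure = _
    rw [lintegral_past_unif t (measurable_one.indicator hBm)]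
    -- On `A` the estimate is good, so the conditional probability of the next index is its softmax
    -- weight whatever the tape is; this is where the dependence on the tape disappears.
    have h2 : ∀ ω : Sample, ∫⁻ u, B.indicator 1 (toPast t ω, u) ∂attemptMeasure =
        (toPast t ⁻¹' A).indicator (fun _ => ENNReal.ofReal
          (P.softWeight (P.pointAlong idx (t + 1)) (idx t))) ω := by
      intro ω
      by_cases hω : toPast t ω ∈ A
      · rw [Set.indicator_of_mem (show ω ∈ toPast t ⁻¹' A from hω),
          ← Input.attemptMeasure_chosen hε (hω.2 t ht) (idx t),
          ← lintegral_indicator_one]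
        · refine lintegral_congr fun u => ?_
          by_cases hu : P.choiceAlong M idx t (tape (toPast t ω)) u = idx t
          · have h2 : u ∈ {u | P.chosen (P.estAlong M (tape (toPast t ω)) idx (t + 1))
              (P.pointAlong idx (t + 1)) u = idx t} := hu
            exact (Set.indicator_of_mem (show (toPast t ω, u) ∈ B from ⟨hω, hu⟩) _).trans
              (Set.indicator_of_mem h2 (1 : (ℕ → Bool → ℝ) → ℝ≥0∞)).symm
          · have h2 : u ∉ {u | P.chosen (P.estAlong M (tape (toPast t ω)) idx (t + 1))
              (P.pointAlong idx (t + 1)) u = idx t} := hu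
            exact (Set.indicator_of_notMem (fun h : (toPast t ω, u) ∈ B => hu h.2) _).trans
              (Set.indicator_of_notMem h2 _).symm
        · exact P.measurable_chosen (y := fun _ => P.estAlong M (tape (toPast t ω)) idx (t + 1))
            (u := fun u => u) (fun i => measurable_const) (fun k b => by fun_prop) _
            (measurableSet_singleton (idx t))
      · rw [Set.indicator_of_notMem (show ω ∉ toPast t ⁻¹' A from hω)]
        refine (lintegral_congr fun u => ?_).trans lintegral_zero
        exact Set.indicator_of_notMem (fun h => hω h.1) _
    rw [lintegral_congr h2, lintegral_indicator (measurable_toPast t hAm), lintegral_const,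
      Measure.restrict_apply_univ, Finset.prod_range_succ]
    have h3 : sampleMeasure (toPast t ⁻¹' A) = _ := ih (by omega)
    rw [h3]
    ring

/-- The samples for which all estimates are accurate. -/
def Input.accurate (P : Input n d) (M : DataStructure) (T : ℕ) : Set Sample :=
  {ω | tape ω ∈ P.goodTape M (P.choice M ω) T}

theorem Input.measurableSet_accurate (hM : P.MeasurableEst M) (T : ℕ) :
    MeasurableSet (P.accurate M T) := by
  refine measurableSet_setOfPred.2 (measurable_comp_prefix (t := T)
    (F := fun idx ω => tape ω ∈ P.goodTape M idx T)
    (fun s _ => Input.measurable_choice_sample hM s) (fun idx idx' h => ?_)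
    fun idx => measurableSet_setOfPred.1 (measurable_tape (Input.measurableSet_goodTape hM idx T)))
  funext ω
  exact congrArg (fun S => tape ω ∈ S) (Input.goodTape_dependsOnPrefix (P := P) (M := M) T idx idx' h)

theorem Input.sum_softWeight (x : Vec d) : ∑ i, P.softWeight x i = 1 := by
  have : 0 < ∑ k, Real.exp (P.f k x / P.ε') :=
    Finset.sum_pos (fun _ _ => Real.exp_pos _) Finset.univ_nonempty
  simp_rw [Input.softWeight, ← Finset.sum_div]
  exact div_self this.ne'

theorem Input.softWeight_nonneg (x : Vec d) (i : Fin n) : 0 ≤ P.softWeight x i := by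
  unfold Input.softWeight; positivity

/-- The adaptive guarantee from the oblivious one: the event is split by the realized prefix, each
part factors by `sampleMeasure_prefix`, and the path probabilities sum to one. -/
theorem Input.le_sampleMeasure_accurate (hM : P.MeasurableEst M) (hε : 0 < P.ε') {T : ℕ}
    {q : ℝ≥0∞} (hq : ∀ idx, q ≤ tapeMeasure (P.goodTape M idx T)) :
    q ≤ sampleMeasure (P.accurate M T) := by
  set S : (Fin T → Fin n) → Set Sample := fun κ =>
    {ω | (∀ s < T, P.choice M ω s = extend κ s) ∧ tape ω ∈ P.goodTape M (extend κ) T} with hS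
  have hsub : (⋃ κ, S κ) ⊆ P.accurate M T := by
    refine Set.iUnion_subset fun κ ω hω => ?_
    have := Input.goodTape_dependsOnPrefix (P := P) (M := M) T _ _ hω.1
    simp only at this
    rw [Input.accurate, Set.mem_ofPred_eq, this]
    exact hω.2
  have hdisj : Pairwise (Function.onFun Disjoint S) := by
    intro κ κ' hne
    refine Set.disjoint_left.2 fun ω hω hω' => hne ?_
    funext s
    have h1 := hω.1 s s.2
    have h2 := hω'.1 s s.2
    rw [extend_of_lt _ s.2] at h1 h2
    exact h1.symm.trans h2
  have hSm : ∀ κ, MeasurableSet (S κ) := by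
    intro κ
    have : S κ = (⋂ s : Fin T, {ω | P.choice M ω s = extend κ s}) ∩
        tape ⁻¹' P.goodTape M (extend κ) T := by
      ext ω; simp [hS, Fin.forall_iff]
    rw [this]
    exact (MeasurableSet.iInter fun s : Fin T => (Input.measurable_choice_sample hM s)
      (measurableSet_singleton (extend κ s))).inter
        (measurable_tape (Input.measurableSet_goodTape hM _ T))
  refine le_trans ?_ (measure_mono hsub)
  rw [measure_iUnion hdisj hSm, tsum_fintype]
  have hw := sum_prod_extend
    (w := fun idx t i => ENNReal.ofReal (P.softWeight (P.pointAlong idx (t + 1)) i))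
    (fun t idx idx' h => by
      have := P.pointAlong_dependsOnPrefix t idx idx' h
      simp only at this ⊢
      rw [this])
    (fun idx t => by
      rw [← ENNReal.ofReal_sum_of_nonneg fun i _ => Input.softWeight_nonneg _ i,
        Input.sum_softWeight, ENNReal.ofReal_one]) T
  calc q = ∑ κ : Fin T → Fin n, (∏ s ∈ Finset.range T, ENNReal.ofReal
        (P.softWeight (P.pointAlong (extend κ) (s + 1)) (extend κ s))) * q := by
        rw [← Finset.sum_mul, hw, one_mul]
    _ ≤ _ := by
        refine Finset.sum_le_sum fun κ _ => ?_
        have h : sampleMeasure (S κ) = _ := Input.sampleMeasure_prefix hM hε (extend κ) (le_refl T)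
        rw [h]
        gcongr
        exact hq _

/-! ### The number of attempts -/

/-- The bound on the moments of the attempts of iteration `t`. -/
def Input.momentAt (P : Input n d) (M : DataStructure) (ω : Sample) (t : ℕ) : ℝ≥0∞ :=
  P.moment (P.estAlong M (tape ω) (P.choice M ω) (t + 1))
    (P.pointAlong (P.choice M ω) (t + 1)) (unif t ω)

theorem Input.momentAt_prefix (t : ℕ) (τ : ℕ → ℝ) (u : ℕ → Bool → ℝ) :
    DependsOnPrefix t fun idx => P.moment (P.estAlong M τ idx (t + 1))
      (P.pointAlong idx (t + 1)) u := by
  intro idx idx' h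
  have h1 := P.estAlong_dependsOnPrefix M τ t idx idx' h
  have h2 := P.pointAlong_dependsOnPrefix t idx idx' h
  simp only at h1 h2 ⊢
  rw [h1, h2]

theorem Input.measurable_momentAt (hM : P.MeasurableEst M) {s t : ℕ} (hs : s < t) :
    Measurable fun a : Past t => P.momentAt M a s :=
  measurable_comp_prefix (t := s)
    (F := fun idx (a : Past t) => P.moment (P.estAlong M (tape a) idx (s + 1))
      (P.pointAlong idx (s + 1)) (unif s a))
    (fun _ hr => Input.measurable_choice hM (hr.trans hs))
    (fun idx idx' h => funext fun a => Input.momentAt_prefix s (tape a) (unif s a) idx idx' h)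
    fun idx => Input.measurable_moment (fun i => (hM idx (s + 1) i).comp (measurable_tape_past t))
      (measurable_unif_past hs) _

theorem Input.measurable_momentAt_sample (hM : P.MeasurableEst M) (s : ℕ) :
    Measurable fun ω => P.momentAt M ω s :=
  (Input.measurable_momentAt hM (Nat.lt_succ_self s)).comp (measurable_toPast (s + 1))

/-- The estimate used in iteration `t` depends on the tape and on earlier choices only, so accuracy
up to and including that iteration is already decided before its uniforms are drawn. -/
theorem Input.measurableSet_accurate_past (hM : P.MeasurableEst M) (t : ℕ) :
    MeasurableSet {a : Past t | a ∈ P.accurate M (t + 1)} := by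
  have h1 : {a : Past t | a ∈ P.accurate M (t + 1)} = ⋂ s : Fin (t + 1), {a : Past t |
      P.Good (P.estAlong M (tape a) (P.choice M a) (s + 1))
        (P.pointAlong (P.choice M a) (s + 1))} := by
    ext a
    simp only [Set.mem_iInter, Fin.forall_iff]
    rfl
  rw [h1]
  refine .iInter fun s => measurableSet_setOfPred.2 (measurable_comp_prefix (t := s)
    (F := fun idx (a : Past t) => P.Good (P.estAlong M (tape a) idx (s + 1))
        (P.pointAlong idx (s + 1)))
    (fun _ hr => Input.measurable_choice hM (by omega)) (fun idx idx' h => ?_) fun idx => ?_)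
  · funext a
    exact congrArg₂ P.Good (P.estAlong_dependsOnPrefix M (tape a) s idx idx' h)
      (P.pointAlong_dependsOnPrefix s idx idx' h)
  · exact measurableSet_setOfPred.1 (Input.measurableSet_good
      (fun i => (hM idx (s + 1) i).comp (measurable_tape_past t)) _)

/-- The last iteration is integrated first. Given the past, its moment is at most the constant
wherever the estimate is good, and this is known in advance; then the indicator is relaxed from `t +
1` to `t` iterations. -/
theorem Input.lintegral_prod_moment_le (hM : P.MeasurableEst M) (hε : 0 < P.ε') (t : ℕ) :
    ∫⁻ ω, (P.accurate M t).indicator (fun ω => ∏ s ∈ Finset.range t, P.momentAt M ω s) ω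
      ∂sampleMeasure ≤ ENNReal.ofReal (growth * (2 * Real.exp 4)) ^ t := by
  induction t with
  | zero =>
    refine (lintegral_mono fun ω => Set.indicator_le_self' (fun _ _ => zero_le) ω).trans ?_
    simp
  | succ t ih =>
    set K := ENNReal.ofReal (growth * (2 * Real.exp 4)) with hK
    set Z : Past t → ℝ≥0∞ := {a : Past t | a ∈ P.accurate M (t + 1)}.indicator
      fun a => ∏ s ∈ Finset.range t, P.momentAt M a s with hZ
    have hZm : Measurable Z := (Finset.measurable_fun_prod _ fun s hs =>
      Input.measurable_momentAt hM (Finset.mem_range.1 hs)).indicator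
        (Input.measurableSet_accurate_past hM t)
    set Φ : Past t × (ℕ → Bool → ℝ) → ℝ≥0∞ := fun z => Z z.1 *
      P.moment (P.estAlong M (tape z.1) (P.choice M z.1) (t + 1))
        (P.pointAlong (P.choice M z.1) (t + 1)) z.2 with hΦ
    have hΦm : Measurable Φ := by
      refine (hZm.comp measurable_fst).mul ?_
      refine measurable_comp_prefix (t := t) (q := fun z : Past t × (ℕ → Bool → ℝ) => P.choice M z.1)
        (F := fun idx (z : Past t × (ℕ → Bool → ℝ)) =>
          P.moment (P.estAlong M (tape z.1) idx (t + 1)) (P.pointAlong idx (t + 1)) z.2)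
        (fun _ hr => (Input.measurable_choice hM hr).comp
      (measurable_fst : Measurable fun z : Past t × (ℕ → Bool → ℝ) => z.1))
        (fun idx idx' h => funext fun z => Input.momentAt_prefix t (tape z.1) z.2 idx idx' h)
        fun idx => Input.measurable_moment
          (fun i => (hM idx (t + 1) i).comp ((measurable_tape_past t).comp measurable_fst))
          (fun k b => by fun_prop) _
    have h1 : ∀ ω, (P.accurate M (t + 1)).indicator
        (fun ω => ∏ s ∈ Finset.range (t + 1), P.momentAt M ω s) ω =
        Φ (toPast t ω, unif t ω) := by
      intro ω
      by_cases hω : ω ∈ P.accurate M (t + 1)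
      · have hz : Z (toPast t ω) = ∏ s ∈ Finset.range t, P.momentAt M ω s :=
          Set.indicator_of_mem hω _
        rw [Set.indicator_of_mem hω, Finset.prod_range_succ, hΦ]
        simp only
        rw [hz]; rfl
      · have hz : Z (toPast t ω) = 0 := Set.indicator_of_notMem hω _
        rw [Set.indicator_of_notMem hω, hΦ]
        simp only
        rw [hz, zero_mul]
    rw [lintegral_congr h1, lintegral_past_unif t hΦm]
    have h2 : ∀ ω, ∫⁻ u, Φ (toPast t ω, u) ∂attemptMeasure ≤
        (P.accurate M t).indicator (fun ω => ∏ s ∈ Finset.range t, P.momentAt M ω s) ω * K := by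
      intro ω
      have hmm : Measurable fun u => P.moment
          (P.estAlong M (tape (toPast t ω)) (P.choice M (toPast t ω)) (t + 1))
          (P.pointAlong (P.choice M (toPast t ω)) (t + 1)) u :=
        Input.measurable_moment (y := fun _ => P.estAlong M (tape (toPast t ω))
          (P.choice M (toPast t ω)) (t + 1)) (u := fun u => u) (fun _ => measurable_const)
          (fun k b => by fun_prop) _
      simp only [hΦ]
      rw [lintegral_const_mul _ hmm]
      by_cases hω : ω ∈ P.accurate M (t + 1)
      · have hz : Z (toPast t ω) = ∏ s ∈ Finset.range t, P.momentAt M ω s :=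
          Set.indicator_of_mem hω _
        have hω' : ω ∈ P.accurate M t := fun s hs => hω s (by omega)
        rw [hz, Set.indicator_of_mem hω']
        gcongr
        exact Input.lintegral_moment_le hε (hω t (by omega))
      · have hz : Z (toPast t ω) = 0 := Set.indicator_of_notMem hω _
        rw [hz, zero_mul]
        exact zero_le
    refine (lintegral_mono h2).trans ?_
    rw [lintegral_mul_const _ ((Finset.measurable_fun_prod _ fun s _ =>
      Input.measurable_momentAt_sample hM s).indicator (Input.measurableSet_accurate hM t)),
      pow_succ]
    gcongr

/-- The samples for which the estimates are accurate and few attempts are made. -/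
def Input.success (P : Input n d) (M : DataStructure) (T B : ℕ) : Set Sample :=
  P.accurate M T ∩ {ω | ∏ s ∈ Finset.range T, P.momentAt M ω s < ENNReal.ofReal growth ^ B}

theorem Input.measurableSet_success (hM : P.MeasurableEst M) (T B : ℕ) :
    MeasurableSet (P.success M T B) :=
  (Input.measurableSet_accurate hM T).inter (measurableSet_lt
    (Finset.measurable_fun_prod _ fun s _ => Input.measurable_momentAt_sample hM s)
    measurable_const)

theorem Input.growth_pow_le_prod_momentAt {T B : ℕ} {ω : Sample}
    (h : (B : ℕ∞) ≤ ∑ t ∈ Finset.range T, P.attemptsAt M ω t) :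
    ENNReal.ofReal growth ^ B ≤ ∏ s ∈ Finset.range T, P.momentAt M ω s := by
  induction T generalizing B with
  | zero =>
    have : B = 0 := by simpa using h
    simp [this]
  | succ T ih =>
    rw [Finset.sum_range_succ] at h
    -- A finite lower bound for a sum in `ℕ∞` is distributed over the two summands, either of which
    -- may be infinite.
    obtain ⟨B₁, B₂, rfl, h1, h2⟩ : ∃ B₁ B₂ : ℕ, B = B₁ + B₂ ∧
        (B₁ : ℕ∞) ≤ ∑ t ∈ Finset.range T, P.attemptsAt M ω t ∧
        (B₂ : ℕ∞) ≤ P.attemptsAt M ω T := by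
      generalize ∑ t ∈ Finset.range T, P.attemptsAt M ω t = S at h
      generalize P.attemptsAt M ω T = S' at h
      induction S using ENat.recTopCoe with
      | top => exact ⟨B, 0, rfl, le_top, by simp⟩
      | coe S =>
        induction S' using ENat.recTopCoe with
        | top => exact ⟨0, B, by simp, by simp, le_top⟩
        | coe S' =>
          have : B ≤ S + S' := by exact_mod_cast h
          refine ⟨min B S, B - min B S, by omega, ?_, ?_⟩
          · exact_mod_cast min_le_right B S
          · exact_mod_cast (show B - min B S ≤ S' by omega)
    rw [pow_add, Finset.prod_range_succ]
    gcongr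
    · exact ih h1
    · exact Input.growth_pow_le_moment h2

theorem Input.sum_attemptsAt_lt {T B : ℕ} {ω : Sample} (hω : ω ∈ P.success M T B) :
    ∑ t ∈ Finset.range T, P.attemptsAt M ω t < B := by
  by_contra h
  exact absurd hω.2 (not_lt.2 (Input.growth_pow_le_prod_momentAt (not_lt.1 h)))

/-- Markov's inequality for the product of the moments restricted to the accurate event. -/
theorem Input.sampleMeasure_accurate_diff_success_le (hM : P.MeasurableEst M) (hε : 0 < P.ε')
    (T B : ℕ) : sampleMeasure (P.accurate M T \ P.success M T B) ≤
      ENNReal.ofReal ((growth * (2 * Real.exp 4)) ^ T / growth ^ B) := by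
  have hg : 0 < growth := one_pos.trans one_lt_growth
  have hm : Measurable fun ω => (P.accurate M T).indicator
      (fun ω => ∏ s ∈ Finset.range T, P.momentAt M ω s) ω :=
    (Finset.measurable_fun_prod _ fun s _ => Input.measurable_momentAt_sample hM s).indicator
      (Input.measurableSet_accurate hM T)
  have h1 := (mul_meas_ge_le_lintegral (μ := sampleMeasure) hm
    (ENNReal.ofReal growth ^ B)).trans (Input.lintegral_prod_moment_le hM hε T)
  have hpos : ENNReal.ofReal growth ^ B ≠ 0 := pow_ne_zero _ (ENNReal.ofReal_pos.2 hg).ne'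
  have htop : ENNReal.ofReal growth ^ B ≠ ∞ := ENNReal.pow_ne_top ENNReal.ofReal_ne_top
  have hsub : P.accurate M T \ P.success M T B ⊆ {ω | ENNReal.ofReal growth ^ B ≤
      (P.accurate M T).indicator (fun ω => ∏ s ∈ Finset.range T, P.momentAt M ω s) ω} := by
    rintro ω ⟨h, h'⟩
    rw [Set.mem_ofPred_eq, Set.indicator_of_mem h]
    by_contra hlt
    exact h' ⟨h, not_le.1 hlt⟩
  refine (measure_mono hsub).trans ?_
  rw [ENNReal.ofReal_div_of_pos (by positivity), ENNReal.ofReal_pow (by positivity),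
    ENNReal.ofReal_pow hg.le, ENNReal.le_div_iff_mul_le (Or.inl hpos) (Or.inl htop), mul_comm]
  exact h1

/-! ### The conditional expectation of the output -/

theorem Input.measurable_output_past (hM : P.MeasurableEst M) (t : ℕ) :
    Measurable fun z : Past t × (ℕ → Bool → ℝ) =>
      P.g (P.choiceAlong M (P.choice M z.1) t (tape z.1) z.2)
        (P.pointAlong (P.choice M z.1) (t + 1)) := by
  refine measurable_comp_prefix (t := t) (q := fun z : Past t × (ℕ → Bool → ℝ) => P.choice M z.1)
    (F := fun idx (z : Past t × (ℕ → Bool → ℝ)) => P.g (P.choiceAlong M idx t (tape z.1) z.2)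
        (P.pointAlong idx (t + 1)))
    (fun _ hr => (Input.measurable_choice hM hr).comp
      (measurable_fst : Measurable fun z : Past t × (ℕ → Bool → ℝ) => z.1))
    (fun idx idx' h => funext fun z => ?_) fun idx => ?_
  · exact congrArg₂ P.g (P.choiceAlong_congr M h (tape z.1) z.2)
      (P.pointAlong_dependsOnPrefix t idx idx' h)
  · refine (measurable_of_countable fun i : Fin n => P.g i (P.pointAlong idx (t + 1))).comp ?_
    exact P.measurable_chosen (y := fun z : Past t × (ℕ → Bool → ℝ) =>
        P.estAlong M (tape z.1) idx (t + 1)) (u := fun z => z.2)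
        (fun i => (hM idx (t + 1) i).comp ((measurable_tape_past t).comp measurable_fst))
        (fun k b => by fun_prop) _

theorem Input.output_eq_past (t : ℕ) : P.output M (t + 1) = fun ω =>
    (fun z : Past t × (ℕ → Bool → ℝ) => P.g (P.choiceAlong M (P.choice M z.1) t (tape z.1) z.2)
        (P.pointAlong (P.choice M z.1) (t + 1))) (toPast t ω, unif t ω) := by
  funext ω
  rw [P.output_eq, P.choice_eq]
  rfl

theorem Input.integrable_output (hM : P.MeasurableEst M) (t : ℕ) :
    Integrable (P.output M (t + 1)) sampleMeasure := by
  have hmeas : Measurable (P.output M (t + 1)) := by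
    rw [Input.output_eq_past]
    exact (Input.measurable_output_past hM t).comp
      ((measurable_toPast t).prodMk (measurable_unif t))
  -- The output is determined by the current index and the prefix, hence takes finitely many values.
  obtain ⟨C, hC⟩ := (Set.finite_range fun q : Fin n × (Fin t → Fin n) =>
    ‖P.g q.1 (P.pointAlong (extend q.2) (t + 1))‖).bddAbove
  refine Integrable.of_bound hmeas.aestronglyMeasurable C (Filter.Eventually.of_forall fun ω => ?_)
  rw [P.output_eq]
  have := (P.pointAlong_dependsOnPrefix t).eq_extend (P.choice M ω)
  rw [this]
  exact hC ⟨(_, _), rfl⟩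

/-- Conditioning freezes the estimate and the query point and leaves an integral over the fresh
attempts, in which the chosen index has the softmax law. -/
theorem Input.condExp_output (hM : P.MeasurableEst M) (hε : 0 < P.ε') (t : ℕ) :
    ∀ᵐ ω ∂sampleMeasure, ω ∈ P.accurate M (t + 1) →
      (sampleMeasure[P.output M (t + 1) | sourceFiltration t]) ω =
        smaxGrad P.f P.g P.ε' (P.point M (t + 1) ω) := by
  have hint := Input.integrable_output hM t
  rw [Input.output_eq_past] at hint ⊢
  filter_upwards [condExp_past_unif t (Input.measurable_output_past hM t) hint] with ω hω hacc
  rw [hω]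
  set y := P.estAlong M (tape ω) (P.choice M ω) (t + 1) with hy
  set x := P.pointAlong (P.choice M ω) (t + 1) with hx
  have hgood : P.Good y x := hacc t (Nat.lt_succ_self t)
  have hc : Measurable fun u => P.chosen y x u :=
    P.measurable_chosen (y := fun _ => y) (u := fun u => u) (fun _ => measurable_const)
      (fun k b => by fun_prop) x
  change ∫ u, P.g (P.chosen y x u) x ∂attemptMeasure = _
  have : IsProbabilityMeasure (attemptMeasure.map fun u => P.chosen y x u) :=
    Measure.isProbabilityMeasure_map hc.aemeasurable
  rw [← integral_map (f := fun i => P.g i x) hc.aemeasurable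
    (measurable_of_countable _).aestronglyMeasurable, integral_fintype Integrable.of_finite,
    P.point_eq, smaxGrad]
  refine Finset.sum_congr rfl fun i _ => ?_
  rw [measureReal_def, Measure.map_apply hc (measurableSet_singleton i)]
  have h1 : attemptMeasure ((fun u => P.chosen y x u) ⁻¹' {i}) = _ :=
    Input.attemptMeasure_chosen hε hgood i
  rw [h1, ENNReal.toReal_ofReal (Input.softWeight_nonneg _ i)]
  rfl

end Law

/-! ### The estimator with the sketch: accuracy and success probability -/

/-- The assumptions on the estimator, for `T` iterations. -/
structure Input.Admissible {n d : ℕ} (P : Input n d) (p T : ℕ) (X : Set (Vec d)) (Lg r : ℝ) :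
    Prop where
  hp : p = 1 ∨ p = 2
  dim_pos : 0 < d
  convex : Convex ℝ X
  start_mem : P.x₀ ∈ X
  smooth : ∀ i, LipschitzSmooth p X P.Lf Lg (P.f i) (P.g i)
  eps_pos : 0 < P.ε'
  move_pos : 0 < P.r'
  smooth_le : Lg * r ^ 2 / 2 ≤ P.ε'
  eps_le : P.ε' ≤ P.Lf * P.r' / 2
  δ_pos : 0 < P.δ
  δ_lt : P.δ < 1
  points : ∀ idx : ℕ → Fin n, (∀ t ≤ T, P.pointAlong idx t ∈ X) ∧
    (∀ t ≤ T, pNorm p (P.pointAlong idx t - P.x₀) ≤ r) ∧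
    ∑ t ∈ Finset.range T, pNorm p (P.pointAlong idx (t + 1) - P.pointAlong idx t) ≤ P.r'

theorem dualNorm_smul_le {d p : ℕ} (hp : p = 1 ∨ p = 2) {a L : ℝ} (ha : 0 ≤ a) (hL : 0 ≤ L)
    {v : Vec d} (hv : dualNorm p v ≤ L) : dualNorm p (a • v) ≤ a * L := by
  refine dualNorm_le hp (mul_nonneg ha hL) fun w => ?_
  have h1 : dot (a • v) w = a * dot v w := by
    simp only [dot_apply, Pi.smul_apply, smul_eq_mul, Finset.mul_sum, mul_assoc]
  rw [h1, abs_mul, abs_of_nonneg ha, mul_assoc]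
  gcongr
  exact (abs_dot_le hp v w).trans (mul_le_mul_of_nonneg_right hv (pNorm_nonneg hp w))

section Final

variable {n d p T : ℕ} {P : Input n d} {X : Set (Vec d)} {Lg r : ℝ}

theorem Input.Admissible.lipschitz_pos (h : P.Admissible p T X Lg r) : 0 < P.Lf := by
  have := h.eps_pos
  have := h.eps_le
  exact pos_of_mul_pos_left (a := P.Lf) (b := P.r') (by linarith) h.move_pos.le

theorem Input.Admissible.accuracy_pos (h : P.Admissible p T X Lg r) : 0 < P.ε' / P.Lf :=
  div_pos h.eps_pos h.lipschitz_pos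

theorem Input.Admissible.accuracy_le (h : P.Admissible p T X Lg r) :
    P.ε' / P.Lf ≤ P.r' / 2 := by
  rw [div_le_iff₀ h.lipschitz_pos]
  linarith [h.eps_le]

theorem Input.Admissible.dualNorm_matrix_le (h : P.Admissible p T X Lg r) (i : Fin n) :
    dualNorm p (P.matrix i) ≤ 1 := by
  have h1 := dualNorm_smul_le h.hp (inv_nonneg.2 h.lipschitz_pos.le) h.lipschitz_pos.le
    (dualNorm_grad_le h.hp h.convex h.lipschitz_pos.le (h.smooth i) h.start_mem)
  rwa [inv_mul_cancel₀ h.lipschitz_pos.ne'] at h1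

/-- The tolerance `2 ε'` is the sum of the rescaled error `Lf * (ε' / Lf)` of the data structure and
the Taylor remainder within distance `r`. The moves telescope to `x - x₀`. -/
theorem Input.Admissible.good_of_abs_le (h : P.Admissible p T X Lg r) (idx : ℕ → Fin n)
    {t : ℕ} (ht : t < T) {y : Fin n → ℝ} (hy : ∀ i, |y i - ∑ j, P.matrix i j *
      ((0 : Vec d) + ∑ s ∈ Finset.range (t + 1), P.moves idx s) j| ≤ P.ε' / P.Lf) :
    P.Good (P.Lf • y) (P.pointAlong idx (t + 1)) := by
  intro i
  obtain ⟨h1, h2, -⟩ := h.points idx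
  set x := P.pointAlong idx (t + 1) with hx
  have hsum : (0 : Vec d) + ∑ s ∈ Finset.range (t + 1), P.moves idx s = x - P.x₀ := by
    simp only [Input.moves]
    rw [zero_add, Finset.sum_range_sub]
    rfl
  have hdot : ∑ j, P.matrix i j * (x - P.x₀) j = P.Lf⁻¹ * dot (P.g i P.x₀) (x - P.x₀) := by
    simp only [dot_apply, Input.matrix, Pi.smul_apply, smul_eq_mul, Finset.mul_sum, mul_assoc]
  have h3 := hy i
  rw [hsum, hdot] at h3
  have h4 : |P.Lf * y i - dot (P.g i P.x₀) (x - P.x₀)| ≤ P.ε' := by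
    have h5 : P.Lf * y i - dot (P.g i P.x₀) (x - P.x₀) =
        P.Lf * (y i - P.Lf⁻¹ * dot (P.g i P.x₀) (x - P.x₀)) := by
      rw [mul_sub, mul_inv_cancel_left₀ h.lipschitz_pos.ne']
    rw [h5, abs_mul, abs_of_pos h.lipschitz_pos]
    rw [le_div_iff₀ h.lipschitz_pos] at h3
    linarith
  have h6 := abs_taylor_le_of_dist_le h.hp h.convex (h.smooth i) h.start_mem (h1 _ ht) (h2 _ ht)
    h.eps_pos.le h.smooth_le
  rw [Pi.smul_apply, smul_eq_mul]
  rw [abs_le] at *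
  constructor <;> linarith

theorem Input.Admissible.two_le_ratio (h : P.Admissible p T X Lg r) :
    2 ≤ P.Lf * P.r' / P.ε' := by
  rw [le_div_iff₀ h.eps_pos]
  linarith [h.eps_le]

variable [NeZero n]

theorem Input.Admissible.logFactor_pos (h : P.Admissible p T X Lg r) :
    0 < logFactor n P.r' (P.ε' / P.Lf) (P.δ / 2) :=
  SoftmaxEst.logFactor_pos (NeZero.pos n) h.accuracy_pos h.accuracy_le (half_pos h.δ_pos)
    (by linarith [h.δ_lt, h.δ_pos])

theorem Input.Admissible.measurableEst (h : P.Admissible p T X Lg r) :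
    P.MeasurableEst (sketch p) := by
  have : NeZero d := ⟨h.dim_pos.ne'⟩
  intro idx t i
  have h1 : (fun τ => P.estAlong (sketch p) τ idx t i) = fun τ => P.Lf * estAt p P.matrix 0 P.r'
      (P.ε' / P.Lf) (logFactor n P.r' (P.ε' / P.Lf) (P.δ / 2)) (P.moves idx) τ t i := by
    funext τ
    rw [Input.estAlong, Input.dsAlong, (runQueries_spec h.hp h.move_pos h.accuracy_pos rfl
      h.logFactor_pos τ t).2.1]
    rfl
  rw [h1]
  exact (measurable_estAt t i).const_mul _

theorem Input.Admissible.le_tapeMeasure_goodTape (h : P.Admissible p T X Lg r)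
    (idx : ℕ → Fin n) :
    ENNReal.ofReal (1 - P.δ / 2) ≤ tapeMeasure (P.goodTape (sketch p) idx T) := by
  refine (sketch_isMVM h.hp n d P.matrix 0 P.r' (P.ε' / P.Lf) (P.δ / 2) T (P.moves idx)
    (NeZero.pos n) h.dim_pos h.dualNorm_matrix_le h.accuracy_pos h.accuracy_le (half_pos h.δ_pos)
    (by linarith [h.δ_lt, h.δ_pos]) (h.points idx).2.2).trans (measure_mono fun τ hτ t ht => ?_)
  exact h.good_of_abs_le idx ht (hτ t ht)

theorem Input.Admissible.le_sampleMeasure_success (h : P.Admissible p T X Lg r) {B : ℕ}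
    (hB : (growth * (2 * Real.exp 4)) ^ T / growth ^ B ≤ P.δ / 2) :
    ENNReal.ofReal (1 - P.δ) ≤ sampleMeasure (P.success (sketch p) T B) := by
  have h1 := Input.le_sampleMeasure_accurate h.measurableEst h.eps_pos h.le_tapeMeasure_goodTape
  have h2 := (Input.sampleMeasure_accurate_diff_success_le h.measurableEst h.eps_pos T B).trans
    (ENNReal.ofReal_le_ofReal hB)
  have h3 : ENNReal.ofReal (1 - P.δ / 2) ≤
      sampleMeasure (P.success (sketch p) T B) + ENNReal.ofReal (P.δ / 2) := by
    refine h1.trans (le_trans ?_ (add_le_add_right h2 _))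
    refine (measure_mono fun ω hω => ?_).trans (measure_union_le _ _)
    by_cases hs : ω ∈ P.success (sketch p) T B
    · exact Or.inl hs
    · exact Or.inr ⟨hω, hs⟩
  have h4 : (1 : ℝ) - P.δ = (1 - P.δ / 2) - P.δ / 2 := by ring
  rw [h4, ENNReal.ofReal_sub _ (half_pos h.δ_pos).le]
  exact tsub_le_iff_right.2 h3

/-! ### Queries and runtime -/

/-- The constant in the bound on the number of attempts. -/
def attemptConst : ℝ :=
  (Real.log (growth * (2 * Real.exp 4)) + Real.log 2 + 1) / Real.log growth + 1

theorem log_growth_mul_nonneg : 0 ≤ Real.log (growth * (2 * Real.exp 4)) := by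
  refine Real.log_nonneg ?_
  have h1 := one_lt_growth
  have h2 : (1 : ℝ) ≤ Real.exp 4 := Real.one_le_exp (by norm_num)
  nlinarith

theorem one_le_attemptConst : 1 ≤ attemptConst := by
  have h1 := log_growth_mul_nonneg
  have h2 := Real.log_pos one_lt_growth
  have h3 : 0 ≤ Real.log 2 := Real.log_nonneg (by norm_num)
  have h4 : 0 ≤ (Real.log (growth * (2 * Real.exp 4)) + Real.log 2 + 1) / Real.log growth := by
    positivity
  unfold attemptConst
  linarith

/-- `B` is the least natural number at or above the solution of `growth ^ b = K ^ T * 2 / δ`. For `T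
= 0` the right side of the second bound is zero while `B` is positive, hence the restriction. -/
theorem exists_attempt_bound (T : ℕ) {δ : ℝ} (hδ : 0 < δ) (hδ1 : δ < 1) : ∃ B : ℕ,
    (growth * (2 * Real.exp 4)) ^ T / growth ^ B ≤ δ / 2 ∧
      (0 < T → (B : ℝ) ≤ attemptConst * (T * (1 + Real.log (1 / δ)))) := by
  have hg : 0 < growth := one_pos.trans one_lt_growth
  have hlg := Real.log_pos one_lt_growth
  have hK := log_growth_mul_nonneg
  have hl : 0 ≤ Real.log (1 / δ) := Real.log_nonneg (by rw [le_div_iff₀ hδ]; linarith)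
  have hl2 : 0 ≤ Real.log 2 := Real.log_nonneg (by norm_num)
  set K := growth * (2 * Real.exp 4) with hKdef
  have hKpos : 0 < K := by positivity
  set b := (T * Real.log K + (Real.log 2 + Real.log (1 / δ))) / Real.log growth with hb
  have hb0 : 0 ≤ b := by positivity
  refine ⟨⌈b⌉₊, ?_, fun hT => ?_⟩
  · have h1 : T * Real.log K + (Real.log 2 + Real.log (1 / δ)) ≤ ⌈b⌉₊ * Real.log growth := by
      rw [← div_le_iff₀ hlg]
      exact Nat.le_ceil b
    rw [← Real.log_mul (by norm_num) (by positivity), ← Real.log_pow, ← Real.log_pow,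
      ← Real.log_mul (by positivity) (by positivity),
      Real.log_le_log_iff (by positivity) (by positivity)] at h1
    rw [div_le_iff₀ (by positivity)]
    calc K ^ T = δ / 2 * (K ^ T * (2 * (1 / δ))) := by field_simp
      _ ≤ _ := by gcongr
  · have hT1 : (1 : ℝ) ≤ T := Nat.one_le_cast.2 hT
    have h2 : b ≤ (Real.log K + Real.log 2 + 1) / Real.log growth *
        (T * (1 + Real.log (1 / δ))) := by
      rw [hb, div_mul_eq_mul_div]
      gcongr
      have h3 : Real.log K * T ≤ Real.log K * (T * (1 + Real.log (1 / δ))) := by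
        gcongr; nlinarith
      have h4 : Real.log 2 ≤ Real.log 2 * (T * (1 + Real.log (1 / δ))) :=
        le_mul_of_one_le_right hl2 (by nlinarith)
      have h5 : Real.log (1 / δ) ≤ T * (1 + Real.log (1 / δ)) := by nlinarith
      linarith
    have h6 : 1 ≤ T * (1 + Real.log (1 / δ)) := by nlinarith
    have h7 := Nat.ceil_lt_add_one hb0
    rw [attemptConst, add_mul, one_mul]
    linarith

/-- On the success event the count is finite, so the estimates can continue in `ℝ`. Without
iterations the count is zero, which covers the case left out by `hB`. -/
theorem Input.exists_sum_attemptsAt_eq {M : DataStructure} {B : ℕ} {ω : Sample} {c : ℝ}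
    (hω : ω ∈ P.success M T B) (hc : 0 ≤ c) (hB : 0 < T → (B : ℝ) ≤ c) :
    ∃ N : ℕ, ∑ t ∈ Finset.range T, P.attemptsAt M ω t = N ∧ (N : ℝ) ≤ c := by
  rcases Nat.eq_zero_or_pos T with rfl | hT
  · exact ⟨0, by simp, by simpa using hc⟩
  · have h1 := Input.sum_attemptsAt_lt hω
    obtain ⟨N, hN⟩ := ENat.ne_top_iff_exists.1 (ne_top_of_lt h1)
    rw [← hN] at h1
    have h2 : N < B := by exact_mod_cast h1
    exact ⟨N, hN.symm, (Nat.cast_le.2 h2.le).trans (hB hT)⟩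

open Classical in
theorem Input.Admissible.runtime_eq (h : P.Admissible p T X Lg r) {ω : Sample} {N : ℕ}
    (hN : ∑ t ∈ Finset.range T, P.attemptsAt (sketch p) ω t = N) :
    ∃ W : ℕ, P.runtime (sketch p) T ω = W ∧ (W : ℝ) ≤ 2 * (n * d) + 10 * (n + d) + 10 +
      T * (10 * d + 10) + 10 * n * (2 * (P.Lf * P.r' / P.ε')) + 10 * N +
      (n * (30 * d + 10) + 30 + (100 * (d * T) + 600 * (d * (P.Lf * P.r' / P.ε')) +
        400 * n * (16 * (P.Lf * P.r' / P.ε') ^ 2 * logFactor n P.r' (P.ε' / P.Lf) (P.δ / 2) +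
          2 * (P.Lf * P.r' / P.ε')))) := by
  have : NeZero d := ⟨h.dim_pos.ne'⟩
  set idx := P.choice (sketch p) ω
  have hρ : P.r' / (P.ε' / P.Lf) = P.Lf * P.r' / P.ε' := by
    rw [div_div_eq_mul_div, mul_comm]
  have hs := (h.points idx).2.2
  have h1 := card_fired_le h.hp h.accuracy_pos hs
  have h2 := sum_timeAt_le (n := n) h.hp (NeZero.pos n) h.accuracy_pos h.move_pos
    h.logFactor_pos hs
  rw [hρ] at h1 h2
  have h3 := (runQueries_spec (x₀ := 0) (A := P.matrix) (Δ := P.moves idx) h.hp h.move_pos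
    h.accuracy_pos rfl h.logFactor_pos (tape ω) T).2.2
  -- The proposal weights are preprocessed again only when the flag is set, which happens only at
  -- refreshes.
  have h4 : (Finset.range T).filter
      (fun t => (P.dsAlong (sketch p) (tape ω) idx (t + 1)).1.N 1 0 ≠ 0) ⊆
      fired p (P.ε' / P.Lf) (P.moves idx) T := by
    intro t ht
    rw [Finset.mem_filter, Finset.mem_range] at ht
    refine mem_fired.2 ⟨ht.1, ?_⟩
    by_contra hf
    exact ht.2 ((runQueries_flag h.hp h.move_pos h.accuracy_pos rfl h.logFactor_pos
      (tape ω) t).2 hf)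
  have h5 : (((Finset.range T).filter
      (fun t => (P.dsAlong (sketch p) (tape ω) idx (t + 1)).1.N 1 0 ≠ 0)).card : ℝ) ≤
      2 * (P.Lf * P.r' / P.ε') := (Nat.cast_le.2 (Finset.card_le_card h4)).trans h1
  have h6 := P.work_eq (sketch p) ω T
  have h7 : (P.dsAlong (sketch p) (tape ω) idx T).1.time ≤ _ := h3
  rw [hN] at h6
  set K := ((Finset.range T).filter
    (fun t => (P.dsAlong (sketch p) (tape ω) idx (t + 1)).1.N 1 0 ≠ 0)).card
  set S := ∑ k ∈ Finset.range T, timeAt p P.r' (P.ε' / P.Lf)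
    (logFactor n P.r' (P.ε' / P.Lf) (P.δ / 2)) (P.moves idx) n k
  set t₀ := (P.dsAlong (sketch p) (tape ω) idx T).1.time
  refine ⟨2 * (n * d) + 10 * (n + d) + 10 + T * (10 * d + 10) + 10 * n * K + 10 * N + t₀,
    ?_, ?_⟩
  · rw [Input.runtime, h6, (P.run_spec (sketch p) ω T).2.2.1]
    push_cast
    rfl
  · have h8 : (t₀ : ℝ) ≤ ((n * (30 * d + 10) + 30 + S : ℕ) : ℝ) := Nat.cast_le.2 h7
    have h9 : (S : ℝ) ≤ _ := h2
    push_cast at h8 ⊢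
    have h10 : 10 * (n : ℝ) * K ≤ 10 * n * (2 * (P.Lf * P.r' / P.ε')) :=
      mul_le_mul_of_nonneg_left h5 (by positivity)
    linarith

/-- The cost of the sketch has no such powers of logarithms; to fit the stated bound they only have
to be bounded below. -/
theorem half_le_pow_pred {p : ℕ} (hp : p = 1 ∨ p = 2) {a : ℝ} (ha : 1 / 2 ≤ a) :
    1 / 2 ≤ a ^ (p - 1) := by
  rcases hp with rfl | rfl
  · norm_num
  · simpa using ha

theorem half_le_log {a : ℝ} (ha : 2 ≤ a) : 1 / 2 ≤ Real.log a :=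
  (by linarith [Real.log_two_gt_d9] : (1 : ℝ) / 2 ≤ Real.log 2).trans
    (Real.log_le_log (by norm_num) ha)

theorem Input.Admissible.logFactor_le (h : P.Admissible p T X Lg r) :
    2 ≤ n * P.Lf * P.r' / (P.ε' * P.δ) ∧ logFactor n P.r' (P.ε' / P.Lf) (P.δ / 2) ≤
      4 * Real.log (n * P.Lf * P.r' / (P.ε' * P.δ)) := by
  have hn : (1 : ℝ) ≤ n := Nat.one_le_cast.2 (NeZero.pos n)
  have hδ := h.δ_pos
  have hδ1 := h.δ_lt
  have he := h.eps_pos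
  have hL := h.lipschitz_pos
  have hr := h.move_pos
  have h1 : 2 ≤ n * P.Lf * P.r' / (P.ε' * P.δ) := by
    rw [le_div_iff₀ (by positivity)]
    have h2 := h.eps_le
    have h3 : P.ε' * P.δ ≤ P.ε' := mul_le_of_le_one_right he.le hδ1.le
    have h4 : P.Lf * P.r' ≤ n * (P.Lf * P.r') := le_mul_of_one_le_left (by positivity) hn
    rw [mul_assoc (n : ℝ)]
    linarith
  refine ⟨h1, ?_⟩
  set y := n * P.Lf * P.r' / (P.ε' * P.δ) with hy
  -- The factor `2 ^ 3` is the `4` of the union bound times the `2` from the failure probability `δ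
  -- / 2`; as `y ≥ 2`, its logarithm is at most `3 log y`.
  have h2 : 4 * (n * P.r') / (P.ε' / P.Lf * (P.δ / 2)) = 2 ^ 3 * y := by
    rw [hy]; field_simp; norm_num
  rw [logFactor, h2, Real.log_mul (by norm_num) (by positivity), Real.log_pow]
  have := Real.log_le_log (by norm_num) h1
  push_cast
  linarith

/-- The constant is dominated by the samples, `400 * 16 * 4 = 25600` after `logFactor_le`; the
summand `10 * attemptConst` pays for the attempts. -/
theorem Input.Admissible.runtime_le (h : P.Admissible p T X Lg r) {ω : Sample} {N : ℕ}
    (hN : ∑ t ∈ Finset.range T, P.attemptsAt (sketch p) ω t = N)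
    (hN' : (N : ℝ) ≤ attemptConst * (T * (1 + Real.log (1 / P.δ)))) :
    (P.runtime (sketch p) T ω : ℝ≥0∞) ≤ ENNReal.ofReal
      ((30000 + 10 * attemptConst) * runtimeBound p n d T P.Lf P.ε' P.r' P.δ) := by
  obtain ⟨W, hW, hWle⟩ := h.runtime_eq hN
  rw [hW, ENat.toENNReal_coe, ← ENNReal.ofReal_natCast]
  refine ENNReal.ofReal_le_ofReal (hWle.trans ?_)
  obtain ⟨h1, h2⟩ := h.logFactor_le
  have hρ := h.two_le_ratio
  have hn : (1 : ℝ) ≤ n := Nat.one_le_cast.2 (NeZero.pos n)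
  have hd : (1 : ℝ) ≤ d := Nat.one_le_cast.2 h.dim_pos
  have hT : (0 : ℝ) ≤ T := T.cast_nonneg
  have hc := one_le_attemptConst
  have hl : 0 ≤ Real.log (1 / P.δ) :=
    Real.log_nonneg (by rw [le_div_iff₀ h.δ_pos]; linarith [h.δ_lt])
  have ha := half_le_pow_pred h.hp (half_le_log hρ)
  have hb := half_le_pow_pred h.hp (half_le_log h1)
  have hℓ := half_le_log h1
  unfold runtimeBound
  set ρ := P.Lf * P.r' / P.ε'
  set a := Real.log ρ ^ (p - 1)
  set ℓ := Real.log (n * P.Lf * P.r' / (P.ε' * P.δ))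
  set b := ℓ ^ (p - 1)
  set L := logFactor n P.r' (P.ε' / P.Lf) (P.δ / 2)
  set l := Real.log (1 / P.δ)
  have e1 : (1 : ℝ) ≤ n * d := one_le_mul_of_one_le_of_one_le hn hd
  have e2 : (n * d : ℝ) ≤ 4 * (n * d * a * b) := by
    have : 1 / 4 ≤ a * b := by nlinarith
    nlinarith
  have e3 : d * ρ ≤ 2 * (d * ρ * b) := by
    have : 0 ≤ d * ρ := by positivity
    nlinarith
  have e4 : n * ρ ≤ n * ρ ^ 2 * ℓ := by
    have h3 : 1 ≤ ρ * ℓ := by nlinarith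
    have h4 : n * ρ * 1 ≤ n * ρ * (ρ * ℓ) := by gcongr
    linarith
  have e5 : n * ρ ^ 2 * L ≤ 4 * (n * ρ ^ 2 * ℓ) := by
    have := mul_le_mul_of_nonneg_left h2 (by positivity : 0 ≤ n * ρ ^ 2)
    linarith
  have e6 : (n : ℝ) ≤ n * d := le_mul_of_one_le_right (by positivity) hd
  have e7 : (d : ℝ) ≤ n * d := le_mul_of_one_le_left (by positivity) hn
  have e8 : (T : ℝ) ≤ T * d := le_mul_of_one_le_right hT hd
  have e9 : attemptConst * (T * (1 + l)) ≤ attemptConst * (T * (d + l)) := by gcongr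
  have q1 : 0 ≤ T * (d + l) := by positivity
  have q2 : 0 ≤ n * d * a * b := by positivity
  have q3 : 0 ≤ d * ρ * b := by positivity
  have q4 : 0 ≤ n * ρ ^ 2 * ℓ := by positivity
  have q5 : 0 ≤ T * l := by positivity
  have q6 : 0 ≤ attemptConst * ((n * d * a + d * ρ) * b + n * ρ ^ 2 * ℓ) := by positivity
  linarith

theorem Input.Admissible.numQueries_le (h : P.Admissible p T X Lg r) {ω : Sample} {N : ℕ}
    (hN : ∑ t ∈ Finset.range T, P.attemptsAt (sketch p) ω t = N)
    (hN' : (N : ℝ) ≤ attemptConst * (T * (1 + Real.log (1 / P.δ)))) :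
    (P.numQueries (sketch p) T ω : ℝ≥0∞) ≤ ENNReal.ofReal
      ((30000 + 10 * attemptConst) * (n + T * (1 + Real.log (1 / P.δ)))) := by
  have hl : 0 ≤ Real.log (1 / P.δ) :=
    Real.log_nonneg (by rw [le_div_iff₀ h.δ_pos]; linarith [h.δ_lt])
  have hc := one_le_attemptConst
  rw [P.numQueries_eq, hN, ← Nat.cast_add, ENat.toENNReal_coe, ← ENNReal.ofReal_natCast]
  refine ENNReal.ofReal_le_ofReal ?_
  push_cast
  have q1 : 0 ≤ T * (1 + Real.log (1 / P.δ)) := by positivity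
  have q2 : 0 ≤ attemptConst * n := by positivity
  have q3 : 0 ≤ attemptConst * (T * (1 + Real.log (1 / P.δ))) := by positivity
  have q4 : (0 : ℝ) ≤ n := n.cast_nonneg
  linarith

theorem Input.Admissible.dualNorm_output_le (h : P.Admissible p T X Lg r) (ω : Sample) {t : ℕ}
    (ht : t < T) : dualNorm p (P.output (sketch p) (t + 1) ω) ≤ P.Lf := by
  rw [P.output_eq]
  exact dualNorm_grad_le h.hp h.convex h.lipschitz_pos.le (h.smooth _) ((h.points _).1 _ ht)

end Final

end SoftmaxEst

end

/-! ### The theorem -/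

theorem mainTheorem7 :
    ∃ C : ℝ, 0 < C ∧ ∀ p : ℕ, p = 1 ∨ p = 2 → ∃ M : DataStructure, M.IsMVM p ∧
      ∀ (n d T : ℕ) [NeZero n] (P : Input n d) (X : Set (Vec d)) (Lg r : ℝ),
        0 < d → Convex ℝ X → P.x₀ ∈ X →
        (∀ i, LipschitzSmooth p X P.Lf Lg (P.f i) (P.g i)) →
        0 < P.ε' → 0 < r → 0 < P.r' → Lg * r ^ 2 / 2 ≤ P.ε' → P.ε' ≤ P.Lf * P.r' / 2 →
        0 < P.δ → P.δ < 1 →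
        (∀ idx : ℕ → Fin n, (∀ t ≤ T, P.pointAlong idx t ∈ X) ∧
          (∀ t ≤ T, pNorm p (P.pointAlong idx t - P.x₀) ≤ r) ∧
          ∑ t ∈ Finset.range T,
            pNorm p (P.pointAlong idx (t + 1) - P.pointAlong idx t) ≤ P.r') →
        (∀ x ∈ X, HasFDerivWithinAt (smax P.f P.ε') (dot (smaxGrad P.f P.g P.ε' x)) X x) ∧
        (∀ t < T, Integrable (P.output M (t + 1)) sampleMeasure) ∧
        ∃ E : Set Sample, MeasurableSet E ∧
          ENNReal.ofReal (1 - P.δ) ≤ sampleMeasure E ∧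
          (∀ᵐ ω ∂sampleMeasure, ω ∈ E → ∀ t < T,
            (sampleMeasure[P.output M (t + 1) | sourceFiltration t]) ω
              = smaxGrad P.f P.g P.ε' (P.point M (t + 1) ω)) ∧
          (∀ ω ∈ E,
            (P.numQueries M T ω : ℝ≥0∞)
              ≤ ENNReal.ofReal (C * (n + T * (1 + Real.log (1 / P.δ)))) ∧
            (P.runtime M T ω : ℝ≥0∞)
              ≤ ENNReal.ofReal (C * runtimeBound p n d T P.Lf P.ε' P.r' P.δ)) ∧
          (∀ᵐ ω ∂sampleMeasure, ∀ t < T, dualNorm p (P.output M (t + 1) ω) ≤ P.Lf) := by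
  refine ⟨30000 + 10 * attemptConst, by linarith [one_le_attemptConst], fun p hp =>
    ⟨sketch p, sketch_isMVM hp, ?_⟩⟩
  intro n d T _ P X Lg r hd hX hx₀ hf hε hr hr' hLg hεle hδ hδ1 hpts
  have h : P.Admissible p T X Lg r :=
    ⟨hp, hd, hX, hx₀, hf, hε, hr', hLg, hεle, hδ, hδ1, hpts⟩
  obtain ⟨B, hB, hB'⟩ := exists_attempt_bound T hδ hδ1
  have hl : 0 ≤ Real.log (1 / P.δ) := Real.log_nonneg (by rw [le_div_iff₀ hδ]; linarith)
  have hc := one_le_attemptConst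
  refine ⟨fun x hx => hasFDerivWithinAt_smax hε.ne' fun i => (hf i).hasGrad x hx,
    fun t _ => Input.integrable_output h.measurableEst t, P.success (sketch p) T B,
    Input.measurableSet_success h.measurableEst T B, h.le_sampleMeasure_success hB, ?_, ?_,
    Filter.Eventually.of_forall fun ω t ht => h.dualNorm_output_le ω ht⟩
  · filter_upwards [ae_all_iff.2 fun t => Input.condExp_output h.measurableEst hε t]
      with ω hω hE t ht
    -- Accuracy over all `T` iterations contains accuracy up to iteration `t`, which is all that
    -- `condExp_output` uses.
    exact hω t fun s hs => hE.1 s (by omega)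
  · intro ω hω
    obtain ⟨N, hN, hN'⟩ := Input.exists_sum_attemptsAt_eq hω (by positivity) hB'
    exact ⟨h.numQueries_le hN hN', h.runtime_le hN hN'⟩
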